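/- Notation. Let $\mathbb H$ be the quaternions with units $1,e_1,e_2,e_3$, let $\mathcal A=\mathrm{span}_{\mathbb R}\{1,e_1,e_2\}$, and let $\psi=(\psi_0,\psi_1,\psi_2)$ be an orthonormal triple in $\mathcal A$, i.e. $\psi_k\overline{\psi_s}+\psi_s\overline{\psi_k}=2\delta_{ks}$. Identify $x\in\mathbb R^3$ with $\sum_k x_k\psi_k$; in particular $\sigma,\rho\in\mathbb R^3$ below also denote quaternions. Let $a,b\in\mathbb R^3$ with $a_i<b_i$, and $J=\prod_{i=0}^2(a_i,b_i)$. Let $\alpha,\beta\in\mathbb C^3$ with $0<\Re\alpha_i,\Re\beta_i<1$ and $\sigma,\rho\in\mathbb R^3$ with $0<\sigma_i,\rho_i\le1$. Fix $y\in J$, and write $y[i:t]$ for $y$ with its $i$-th coordinate replaced by $t$. Let $\varphi,\vartheta\in C^1(\overline J,\mathbb R)$ be such that $\varphi_i(t):=\varphi(y[i:t])$ and $\vartheta_i(t):=\vartheta(y[i:t])$ have positive derivative on $[a_i,b_i]$, $i=0,1,2$. Put $D\varphi(x,y)=\sum_i\varphi_i'(x_i)$, and similarly $D\vartheta$. For a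 scalar order $\gamma$ with $0<\Re\gamma<1$, a proportion $r\in(0,1]$ and a scale $\chi$ of one variable, put $$({}_cI^{\gamma,r,\chi}h)(t)=\frac1{r^\gamma\Gamma(\gamma)}\int_c^t e^{\frac{r-1}{r}(\chi(t)-\chi(\tau))}(\chi(t)-\chi(\tau))^{\gamma-1}h(\tau)\chi'(\tau)\,d\tau,$$ $${}_cD^{\gamma,r,\chi}h=(1-r)\,{}_cI^{1-\gamma,r,\chi}h+\frac{r}{\chi'}\frac{d}{dt}\,{}_cI^{1-\gamma,r,\chi}h .$$ On quaternion-valued functions these act coordinatewise, with values in the complexified quaternions $\mathbb C\otimes\mathbb H$ because the orders are complex. For $f:J\to\mathcal A$ put $$({}_aI^{1-\alpha,\sigma,\varphi}f)(x,y)=\sum_{i=0}^2\big({}_{a_i}I^{1-\alpha_i,\sigma_i,\varphi_i}f\big)(y[i:x_i]),$$ where the $i$-th operator acts in the $i$-th variable. With ${}^\psi\overline\partial F=\sum_k\psi_k\partial_kF$ and ${}^\psi\overline\partial_rF=\sum_k(\partial_kF)\psi_k$ (derivatives in $x$), put $${}^\psi_a\overline\partial^{\alpha,\sigma,\varphi}f=(1-\sigma)\,{}_aI^{1-\alpha,\sigma,\varphi}f+\sigma\,\frac{{}^\psi\overline\partial({}_aI^{1-\alpha,\sigma,\varphi}f)}{D\varphi},\qquad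 {}^\psi_a\overline\partial_r^{\beta,\rho,\vartheta}g=({}_aI^{1-\beta,\rho,\vartheta}g)(1-\rho)+\frac{{}^\psi\overline\partial_r({}_aI^{1-\beta,\rho,\vartheta}g)}{D\vartheta}\,\rho .$$ Let $f,g:J\to\mathcal A$ be, along every segment of $J$ parallel to a coordinate axis, absolutely continuous on compact subintervals and integrable on the whole segment (this holds in particular if they are absolutely continuous there). Assume that $F={}_aI^{1-\alpha,\sigma,\varphi}f(\cdot,y)$ and $G={}_aI^{1-\beta,\rho,\vartheta}g(\cdot,y)$ are $C^1$ up to the boundary of $J$; on $\partial J$ the letters $F,G$ denote the continuous extensions. Let $f$ be left $\alpha$-$\varphi$-$\sigma$-$\psi$-hyperholomorphic and $g$ right $\beta$-$\vartheta$-$\rho$-$\psi$-hyperholomorphic at $y$, that is, ${}^\psi_a\overline\partial^{\alpha,\sigma,\varphi}f(x,y)=0$ and ${}^\psi_a\overline\partial_r^{\beta,\rho,\vartheta}g(x,y)=0$ for all $x\in J$. Let $\lambda_0,\lambda_1,\lambda_2,\mu_0,\mu_1,\mu_2\in C^1(\overline J,\mathbb R)$ satisfy on $J$ $${}^\psi\overline\partial\Big(\sum_j\lambda_j\Big)=D\varphi(\cdot,y)\,\sigma^{-1}(1-\sigma),\qquad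 {}^\psi\overline\partial\Big(\sum_j\mu_j\Big)=D\vartheta(\cdot,y)\,(1-\rho)\rho^{-1}.$$ Let ${}^\psi\eta_x=\sum_k(-1)^k\psi_k\,d\hat x_k$, where $d\hat x_k$ is $dx_0\wedge dx_1\wedge dx_2$ with $dx_k$ omitted, let $\partial J$ be outward oriented, and let $K_\psi(x)=\dfrac{\overline{x}}{4\pi|x|^3}$. Put $$K_\psi^{\alpha,\sigma,\varphi}(\zeta,x)=\sum_{i=0}^2{}_{a_i}D^{1-\alpha_i,\sigma_i,\varphi_i}\Big[K_\psi(\zeta-x)\,e^{\sum_k(\lambda_k(\zeta)-\lambda_k(x))}\Big],\qquad K_\psi^{\beta,\rho,\vartheta}(\zeta,x)=\sum_{i=0}^2{}_{a_i}D^{1-\beta_i,\rho_i,\vartheta_i}\Big[K_\psi(\zeta-x)\,e^{\sum_k(\mu_k(\zeta)-\mu_k(x))}\Big],$$ where the $i$-th operator acts in the variable $x_i$, the other coordinates of $x$ being fixed, and $$R^{\alpha,\sigma,\varphi}(f,x,y)=\sum_{i=0}^2\big({}_{a_i}I^{1-\alpha_i,\sigma_i,\varphi_i}f\big)(y[i:x_i])\sum_{j\ne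 i}\big({}_{a_j}D^{1-\alpha_j,\sigma_j,\varphi_j}1\big)(x_j),$$ and similarly $R^{\beta,\rho,\vartheta}(g,x,y)$. Statement. Then (Cauchy theorem) $$\int_{\partial J}e^{\sum_k(\mu_k(x)+\lambda_k(x))}\,G(x)\;{}^\psi\eta_x\;F(x)=0,$$ and (Cauchy formula) for every $x\in J$ the integral on the left below converges absolutely and $$\int_{\partial J}\Big[K_\psi^{\alpha,\sigma,\varphi}(\zeta,x)\,{}^\psi\eta_\zeta\,F(\zeta)+G(\zeta)\,{}^\psi\eta_\zeta\,K_\psi^{\beta,\rho,\vartheta}(\zeta,x)\Big]=\sum_{i=0}^2(f+g)(y[i:x_i])+R^{\alpha,\sigma,\varphi}(f,x,y)+R^{\beta,\rho,\vartheta}(g,x,y).$$ -/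

import Mathlib

open MeasureTheory Set
open scoped Quaternion

noncomputable section

namespace FracPsi

/-! ### Proportional fractional calculus on an interval -/

/-- Left proportional fractional integral of complex order `α`, proportion `ρ`, lower limit `a`,
with respect to `φ`. -/
def fracInt (a : ℝ) (α : ℂ) (ρ : ℝ) (φ : ℝ → ℝ) (h : ℝ → ℂ) (t : ℝ) : ℂ :=
  1 / ((ρ : ℂ) ^ α * Complex.Gamma α) *
    ∫ τ in a..t, (Real.exp ((ρ - 1) / ρ * (φ t - φ τ)) : ℂ) *
      ((φ t - φ τ : ℝ) : ℂ) ^ (α - 1) * h τ * ((deriv φ τ : ℝ) : ℂ)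

/-- Proportional derivative with respect to `φ`: `(1 - ρ) h + ρ h' / φ'`. -/
def propDeriv (ρ : ℝ) (φ : ℝ → ℝ) (h : ℝ → ℂ) (t : ℝ) : ℂ :=
  (1 - ρ) * h t + ρ * (deriv h t / ((deriv φ t : ℝ) : ℂ))

/-- Left proportional fractional derivative of order `α` with respect to `φ`. -/
def fracDeriv (a : ℝ) (α : ℂ) (ρ : ℝ) (φ : ℝ → ℝ) (h : ℝ → ℂ) (t : ℝ) : ℂ :=
  propDeriv ρ φ (fracInt a (1 - α) ρ φ h) t

/-! ### Quaternions and complexified quaternions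

The orders of the integrals are complex numbers, so that the values lie in the complexified
quaternions `ℍ[ℂ]`; integrals and derivatives are taken coordinatewise. -/

/-- The inclusion of the real quaternions into the complexified quaternions. -/
def cq (q : ℍ[ℝ]) : ℍ[ℂ] := ⟨(q.re : ℂ), (q.imI : ℂ), (q.imJ : ℂ), (q.imK : ℂ)⟩

/-- Apply an operation on complex-valued functions to each of the four coordinates. -/
def coordwise {X : Type*} (L : (X → ℂ) → ℂ) (F : X → ℍ[ℂ]) : ℍ[ℂ] :=
  ⟨L fun x => (F x).re, L fun x => (F x).imI, L fun x => (F x).imJ, L fun x => (F x).imK⟩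

/-- A property of complex-valued functions required of each of the four coordinates. -/
def AllCoords {X : Type*} (P : (X → ℂ) → Prop) (F : X → ℍ[ℂ]) : Prop :=
  P (fun x => (F x).re) ∧ P (fun x => (F x).imI) ∧ P (fun x => (F x).imJ) ∧
    P (fun x => (F x).imK)

/-- `fracInt` for functions with values in the complexified quaternions. -/
def fracIntQ (a : ℝ) (α : ℂ) (ρ : ℝ) (φ : ℝ → ℝ) (h : ℝ → ℍ[ℂ]) (t : ℝ) : ℍ[ℂ] :=
  coordwise (fun u => fracInt a α ρ φ u t) h

/-- `fracDeriv` for functions with values in the complexified quaternions. -/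
def fracDerivQ (a : ℝ) (α : ℂ) (ρ : ℝ) (φ : ℝ → ℝ) (h : ℝ → ℍ[ℂ]) (t : ℝ) : ℍ[ℂ] :=
  coordwise (fun u => fracDeriv a α ρ φ u t) h

/-- An ordered orthonormal triple in the real span of `1, i, j`. -/
def IsStructuralSet (ψ : Fin 3 → ℍ[ℝ]) : Prop :=
  (∀ k, (ψ k).imK = 0) ∧
    ∀ k s, ψ k * star (ψ s) + ψ s * star (ψ k) = if k = s then 2 else 0

/-- The identification `x ↦ ∑ x_k ψ_k` of `ℝ³` with the span of `1, i, j`. -/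
def embed (ψ : Fin 3 → ℍ[ℝ]) (x : Fin 3 → ℝ) : ℍ[ℝ] := ∑ k, x k • ψ k

/-- The Cauchy-Riemann kernel `conj(z) / (4 π |z|³)`. -/
def kernel (ψ : Fin 3 → ℍ[ℝ]) (z : Fin 3 → ℝ) : ℍ[ℝ] :=
  (4 * Real.pi * ‖embed ψ z‖ ^ 3)⁻¹ • star (embed ψ z)

/-! ### The box, its boundary, and partial derivatives -/

/-- The open box with opposite corners `a` and `b`. -/
def box (a b : Fin 3 → ℝ) : Set (Fin 3 → ℝ) := univ.pi fun i => Ioo (a i) (b i)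

/-- The restriction `t ↦ φ(y_0, …, t, …, y_2)`, with `t` in position `i`. -/
def line {E : Type*} (φ : (Fin 3 → ℝ) → E) (y : Fin 3 → ℝ) (i : Fin 3) : ℝ → E :=
  fun t => φ (Function.update y i t)

/-- Partial derivative in the coordinate `x_k`. -/
def partialQ (k : Fin 3) (F : (Fin 3 → ℝ) → ℍ[ℂ]) (x : Fin 3 → ℝ) : ℍ[ℂ] :=
  coordwise (fun u => deriv u (x k)) (line F x k)

/-- Left Cauchy-Riemann operator `∑ ψ_k ∂_k F`. -/
def crLeft (ψ : Fin 3 → ℍ[ℝ]) (F : (Fin 3 → ℝ) → ℍ[ℂ]) (x : Fin 3 → ℝ) : ℍ[ℂ] :=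
  ∑ k, cq (ψ k) * partialQ k F x

/-- Right Cauchy-Riemann operator `∑ (∂_k F) ψ_k`. -/
def crRight (ψ : Fin 3 → ℍ[ℝ]) (F : (Fin 3 → ℝ) → ℍ[ℂ]) (x : Fin 3 → ℝ) : ℍ[ℂ] :=
  ∑ k, partialQ k F x * cq (ψ k)

/-- The integral over the boundary of the box, with its outward orientation, of the 2-form
`∑ (-1)^k ω_k dx̂_k`, where `dx̂_k` is `dx_0 ∧ dx_1 ∧ dx_2` with `dx_k` omitted. On the faces
`x_k = b_k` and `x_k = a_k` the form `(-1)^k dx̂_k` is plus, respectively minus, the area. -/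
def boundaryIntegral (a b : Fin 3 → ℝ) (ω : Fin 3 → (Fin 3 → ℝ) → ℍ[ℂ]) : ℍ[ℂ] :=
  ∑ k : Fin 3,
    (coordwise (fun u => ∫ w in Icc (a ∘ k.succAbove) (b ∘ k.succAbove), u w)
        (fun w : Fin 2 → ℝ => ω k (k.insertNth (b k) w)) -
      coordwise (fun u => ∫ w in Icc (a ∘ k.succAbove) (b ∘ k.succAbove), u w)
        (fun w : Fin 2 → ℝ => ω k (k.insertNth (a k) w)))

/-- Absolute integrability, on each of the six faces, of the form in `boundaryIntegral`. -/
def BoundaryIntegrable (a b : Fin 3 → ℝ) (ω : Fin 3 → (Fin 3 → ℝ) → ℍ[ℂ]) : Prop :=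
  ∀ k : Fin 3, ∀ c : ℝ, c = a k ∨ c = b k →
    AllCoords (fun u => IntegrableOn u (Icc (a ∘ k.succAbove) (b ∘ k.succAbove)))
      (fun w : Fin 2 → ℝ => ω k (k.insertNth c w))

/-! ### Fractional operators on the box -/

/-- `f` takes values in the span of `1, i, j` and along every segment of the box parallel to an
axis it is absolutely continuous on compact subintervals and integrable. -/
def MemAC (a b : Fin 3 → ℝ) (f : (Fin 3 → ℝ) → ℍ[ℝ]) : Prop :=
  (∀ x ∈ box a b, (f x).imK = 0) ∧
    ∀ y ∈ box a b, ∀ j,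
      (∀ c d, a j < c → c ≤ d → d < b j → AbsolutelyContinuousOnInterval (line f y j) c d) ∧
        IntegrableOn (line f y j) (Ioo (a j) (b j))

/-- The fractional integral `∑_i (I^{α_i, σ_i, φ_i} f)(y_0, …, x_i, …, y_2)`. -/
def boxFracInt (a : Fin 3 → ℝ) (α : Fin 3 → ℂ) (σ : Fin 3 → ℝ) (φ : (Fin 3 → ℝ) → ℝ)
    (f : (Fin 3 → ℝ) → ℍ[ℝ]) (y x : Fin 3 → ℝ) : ℍ[ℂ] :=
  ∑ i, fracIntQ (a i) (α i) (σ i) (line φ y i) (fun t => cq (line f y i t)) (x i)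

/-- `Dφ(x, y) = ∑_i (∂φ/∂x_i)(y_0, …, x_i, …, y_2)`. -/
def sumDeriv (φ : (Fin 3 → ℝ) → ℝ) (x y : Fin 3 → ℝ) : ℝ := ∑ i, deriv (line φ y i) (x i)

/-- Left fractional proportional Cauchy-Riemann operator with respect to `φ`. -/
def fracCRLeft (ψ : Fin 3 → ℍ[ℝ]) (a : Fin 3 → ℝ) (α : Fin 3 → ℂ) (σ : Fin 3 → ℝ)
    (φ : (Fin 3 → ℝ) → ℝ) (f : (Fin 3 → ℝ) → ℍ[ℝ]) (x y : Fin 3 → ℝ) : ℍ[ℂ] :=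
  cq (1 - embed ψ σ) * boxFracInt a (fun i => 1 - α i) σ φ f y x +
    cq (embed ψ σ) *
      ((sumDeriv φ x y : ℂ)⁻¹ • crLeft ψ (boxFracInt a (fun i => 1 - α i) σ φ f y) x)

/-- Right fractional proportional Cauchy-Riemann operator with respect to `φ`. -/
def fracCRRight (ψ : Fin 3 → ℍ[ℝ]) (a : Fin 3 → ℝ) (α : Fin 3 → ℂ) (σ : Fin 3 → ℝ)
    (φ : (Fin 3 → ℝ) → ℝ) (f : (Fin 3 → ℝ) → ℍ[ℝ]) (x y : Fin 3 → ℝ) : ℍ[ℂ] :=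
  boxFracInt a (fun i => 1 - α i) σ φ f y x * cq (1 - embed ψ σ) +
    ((sumDeriv φ x y : ℂ)⁻¹ • crRight ψ (boxFracInt a (fun i => 1 - α i) σ φ f y) x) *
      cq (embed ψ σ)

/-- `F` is continuously differentiable on the closed box and agrees with `F₀` on the open box. -/
def IsC1Extension (a b : Fin 3 → ℝ) (F₀ F : (Fin 3 → ℝ) → ℍ[ℂ]) : Prop :=
  AllCoords (fun u => ContDiffOn ℝ 1 u (Icc a b)) F ∧ EqOn F F₀ (box a b)

/-- `f` is left hyperholomorphic at the parameter point `y`: its fractional integral is `C¹` up to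
the boundary in `x` and its left fractional Cauchy-Riemann derivative vanishes for all `x`. -/
def IsLeftHyperholomorphicAt (ψ : Fin 3 → ℍ[ℝ]) (a b : Fin 3 → ℝ) (α : Fin 3 → ℂ)
    (σ : Fin 3 → ℝ) (φ : (Fin 3 → ℝ) → ℝ) (y : Fin 3 → ℝ) (f : (Fin 3 → ℝ) → ℍ[ℝ]) : Prop :=
  MemAC a b f ∧ (∃ F, IsC1Extension a b (boxFracInt a (fun i => 1 - α i) σ φ f y) F) ∧
    ∀ x ∈ box a b, fracCRLeft ψ a α σ φ f x y = 0

/-- Right hyperholomorphic functions at the parameter point `y`. -/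
def IsRightHyperholomorphicAt (ψ : Fin 3 → ℍ[ℝ]) (a b : Fin 3 → ℝ) (α : Fin 3 → ℂ)
    (σ : Fin 3 → ℝ) (φ : (Fin 3 → ℝ) → ℝ) (y : Fin 3 → ℝ) (f : (Fin 3 → ℝ) → ℍ[ℝ]) : Prop :=
  MemAC a b f ∧ (∃ F, IsC1Extension a b (boxFracInt a (fun i => 1 - α i) σ φ f y) F) ∧
    ∀ x ∈ box a b, fracCRRight ψ a α σ φ f x y = 0

/-- `φ` is `C¹` on the closed box, with positive derivative along each closed segment through `y`
parallel to an axis. -/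
def IsScale (a b : Fin 3 → ℝ) (y : Fin 3 → ℝ) (φ : (Fin 3 → ℝ) → ℝ) : Prop :=
  ContDiffOn ℝ 1 φ (Icc a b) ∧
    ∀ i, ∀ t ∈ Icc (a i) (b i), 0 < derivWithin (line φ y i) (Icc (a i) (b i)) t

/-- The functions `l_0, l_1, l_2` are `C¹` on the closed box and the Cauchy-Riemann derivative of
their sum is `Dφ(x, y) σ⁻¹ (1 - σ)`. -/
def IsWeight (ψ : Fin 3 → ℍ[ℝ]) (a b : Fin 3 → ℝ) (σ : Fin 3 → ℝ) (φ : (Fin 3 → ℝ) → ℝ)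
    (y : Fin 3 → ℝ) (l : Fin 3 → (Fin 3 → ℝ) → ℝ) : Prop :=
  (∀ k, ContDiffOn ℝ 1 (l k) (Icc a b)) ∧
    ∀ x ∈ box a b,
      ∑ k, deriv (line (fun z => ∑ j, l j z) x k) (x k) • ψ k =
        sumDeriv φ x y • ((embed ψ σ)⁻¹ * (1 - embed ψ σ))

/-- The fractional kernel
`∑_i D_{x_i}^{1 - α_i, σ_i, φ_i} [K(ζ - x) exp(∑_k (l_k(ζ) - l_k(x)))]`. -/
def fracKernel (ψ : Fin 3 → ℍ[ℝ]) (a : Fin 3 → ℝ) (α : Fin 3 → ℂ) (σ : Fin 3 → ℝ)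
    (φ : (Fin 3 → ℝ) → ℝ) (y : Fin 3 → ℝ) (l : Fin 3 → (Fin 3 → ℝ) → ℝ)
    (ζ x : Fin 3 → ℝ) : ℍ[ℂ] :=
  ∑ i, fracDerivQ (a i) (1 - α i) (σ i) (line φ y i)
    (line (fun z => cq (Real.exp (∑ k, (l k ζ - l k z)) • kernel ψ (ζ - z))) x i) (x i)

/-- The remainder
`∑_i (I^{1 - α_i, σ_i, φ_i} f)(y_0, …, x_i, …, y_2) ∑_{j ≠ i} D_{x_j}^{1 - α_j, σ_j, φ_j}(1)`. -/
def remainder (a : Fin 3 → ℝ) (α : Fin 3 → ℂ) (σ : Fin 3 → ℝ) (φ : (Fin 3 → ℝ) → ℝ)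
    (f : (Fin 3 → ℝ) → ℍ[ℝ]) (x y : Fin 3 → ℝ) : ℍ[ℂ] :=
  ∑ i, (∑ j ∈ Finset.univ.erase i,
      fracDeriv (a j) (1 - α j) (σ j) (line φ y j) (fun _ => 1) (x j)) •
    fracIntQ (a i) (1 - α i) (σ i) (line φ y i) (fun t => cq (line f y i t)) (x i)

end FracPsi

end

noncomputable section
namespace FracPsi

/-! ### The normed space of complexified quaternions -/

/-! Write Λ = ∑ λ_j and M = ∑ μ_j. The product rule and the weight equation give ∂̄(e^Λ F) = e^Λ
(∂̄F + Dφ σ⁻¹(1 - σ) F), which is e^Λ Dφ σ⁻¹ times the fractional Cauchy-Riemann operator applied to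
f. So e^Λ F is left monogenic, and in the same way e^M G is right monogenic
(`IsLeftHyperholomorphicAt.monogenic`, `IsRightHyperholomorphicAt.monogenic`). Stokes' theorem for a
product P ψ_k Q (`bInt_mul_mul`) then gives the Cauchy theorem.

The Cauchy formula for a monogenic u on the box is obtained without excising a ball. The kernel is
replaced by the smooth kernel conj(z) / (4π(|z|² + s)^{3/2}), whose Cauchy-Riemann derivative, from
either side, is an approximate identity of mass one. Stokes' theorem and s → 0 give u(x)
(`bInt_kernel_left`, `bInt_kernel_right`). Applied to e^Λ F and divided by e^{Λ(x)}, this says that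
the weighted kernel reproduces F(x).

Now F(x) is a sum over j of I^{1-α_j} f along the j-th segment through y, and only the i-th summand
depends on x_i. Apply to the reproducing formula, in the variable x_i, the operator D^{1-α_i}, that
is, the proportional derivative of I^{α_i}. By the Beta integral, I^α I^{1-α} is integration against
an exponential (`propInt_propInt`), and its proportional derivative returns f
(`hasDerivAt_propInt_propInt`). The other summands are constants and multiply D1. Summed over i,
this is ∑ f plus the remainder.

The analytic work is to move D^{1-α_i} under the boundary integral. The integral I^{α_i} runs over
poles z on a segment that starts on the face x_i = a_i, where the kernel has size |ζ - z|⁻². This is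
integrable over face times segment, which is three-dimensional (`integrable_inv_sqNorm_face`). Near
the end x_i of the segment the kernel is C¹ in the pole, with bounds uniform in ζ
(`exists_bound_faceFamily`). These two facts control the derivative of a fractional integral
(`exists_hasDerivAt_propInt`), and dominated convergence does the rest
(`hasDerivAt_propInt_integral`). All of this is done for the identity scale; the substitution s =
φ_i(t) reduces the general case to it. -/

theorem cq_ext {p q : ℍ[ℂ]} (h0 : p.re = q.re) (h1 : p.imI = q.imI) (h2 : p.imJ = q.imJ)
    (h3 : p.imK = q.imK) : p = q := QuaternionAlgebra.ext h0 h1 h2 h3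

instance complexQuaternionIsScalarTower : IsScalarTower ℂ ℍ[ℂ] ℍ[ℂ] :=
  ⟨fun c p q => by refine cq_ext ?_ ?_ ?_ ?_ <;> simp only [smul_eq_mul] <;> simp <;> ring⟩

instance complexQuaternionSMulCommClass : SMulCommClass ℂ ℍ[ℂ] ℍ[ℂ] :=
  ⟨fun c p q => by refine cq_ext ?_ ?_ ?_ ?_ <;> simp only [smul_eq_mul] <;> simp <;> ring⟩

/-- The four coordinates of a complexified quaternion. -/
def coordsₗ : ℍ[ℂ] →ₗ[ℂ] (Fin 4 → ℂ) where
  toFun q := ![q.re, q.imI, q.imJ, q.imK]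
  map_add' p q := by ext i; fin_cases i <;> simp
  map_smul' c q := by ext i; fin_cases i <;> simp

theorem coordsₗ_injective : Function.Injective coordsₗ := by
  intro p q h
  have h0 := congrFun h 0
  have h1 := congrFun h 1
  have h2 := congrFun h 2
  have h3 := congrFun h 3
  simp only [coordsₗ, LinearMap.coe_mk, AddHom.coe_mk] at h0 h1 h2 h3
  exact cq_ext h0 h1 h2 h3

/-- Any norm serves here, since the space is finite-dimensional and linear and bilinear maps are
continuous; the sup norm of the coordinates is taken. No multiplicativity of the norm is needed. -/
instance complexQuaternionNormedAddCommGroup : NormedAddCommGroup ℍ[ℂ] :=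
  NormedAddCommGroup.induced ℍ[ℂ] (Fin 4 → ℂ) coordsₗ coordsₗ_injective

instance complexQuaternionNormedSpace : NormedSpace ℂ ℍ[ℂ] :=
  NormedSpace.induced ℂ ℍ[ℂ] (Fin 4 → ℂ) coordsₗ

instance complexQuaternionRealNormedSpace : NormedSpace ℝ ℍ[ℂ] :=
  NormedSpace.induced ℝ ℍ[ℂ] (Fin 4 → ℂ) (coordsₗ.restrictScalars ℝ)

instance complexQuaternionFiniteReal : FiniteDimensional ℝ ℍ[ℂ] :=
  FiniteDimensional.of_injective (coordsₗ.restrictScalars ℝ) coordsₗ_injective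

instance complexQuaternionComplete : CompleteSpace ℍ[ℂ] := FiniteDimensional.complete ℝ ℍ[ℂ]

/-- The coordinate functionals. -/
def reL : ℍ[ℂ] →L[ℂ] ℂ := LinearMap.toContinuousLinearMap
  { toFun := fun q => q.re, map_add' := fun _ _ => rfl, map_smul' := fun _ _ => rfl }
def imIL : ℍ[ℂ] →L[ℂ] ℂ := LinearMap.toContinuousLinearMap
  { toFun := fun q => q.imI, map_add' := fun _ _ => rfl, map_smul' := fun _ _ => rfl }
def imJL : ℍ[ℂ] →L[ℂ] ℂ := LinearMap.toContinuousLinearMap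
  { toFun := fun q => q.imJ, map_add' := fun _ _ => rfl, map_smul' := fun _ _ => rfl }
def imKL : ℍ[ℂ] →L[ℂ] ℂ := LinearMap.toContinuousLinearMap
  { toFun := fun q => q.imK, map_add' := fun _ _ => rfl, map_smul' := fun _ _ => rfl }

/-- Multiplication of complexified quaternions as a continuous bilinear map. -/
def mulL : ℍ[ℂ] →L[ℂ] ℍ[ℂ] →L[ℂ] ℍ[ℂ] :=
  LinearMap.toContinuousLinearMap
    ((LinearMap.toContinuousLinearMap : (ℍ[ℂ] →ₗ[ℂ] ℍ[ℂ]) ≃ₗ[ℂ] _).toLinearMap ∘ₗ LinearMap.mul ℂ ℍ[ℂ])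

@[simp] theorem mulL_apply (p q : ℍ[ℂ]) : mulL p q = p * q := rfl

@[simp] theorem cq_re (q : ℍ[ℝ]) : (cq q).re = q.re := rfl
@[simp] theorem cq_imI (q : ℍ[ℝ]) : (cq q).imI = q.imI := rfl
@[simp] theorem cq_imJ (q : ℍ[ℝ]) : (cq q).imJ = q.imJ := rfl
@[simp] theorem cq_imK (q : ℍ[ℝ]) : (cq q).imK = q.imK := rfl
@[simp] theorem reL_apply (q : ℍ[ℂ]) : reL q = q.re := rfl
@[simp] theorem imIL_apply (q : ℍ[ℂ]) : imIL q = q.imI := rfl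
@[simp] theorem imJL_apply (q : ℍ[ℂ]) : imJL q = q.imJ := rfl
@[simp] theorem imKL_apply (q : ℍ[ℂ]) : imKL q = q.imK := rfl

/-- The inclusion of the real quaternions as a continuous real-linear map. -/
def cqL : ℍ[ℝ] →L[ℝ] ℍ[ℂ] := LinearMap.toContinuousLinearMap
  { toFun := cq
    map_add' := fun p q => by refine cq_ext ?_ ?_ ?_ ?_ <;> simp
    map_smul' := fun c q => by refine cq_ext ?_ ?_ ?_ ?_ <;> simp }

theorem cq_add (p q : ℍ[ℝ]) : cq (p + q) = cq p + cq q := cqL.map_add p q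
theorem cq_smul (c : ℝ) (q : ℍ[ℝ]) : cq (c • q) = c • cq q := cqL.map_smul c q
theorem cq_one : cq 1 = 1 := by
  refine cq_ext ?_ ?_ ?_ ?_ <;> simp [cq]
theorem cq_sum {ι : Type*} (s : Finset ι) (f : ι → ℍ[ℝ]) :
    cq (∑ i ∈ s, f i) = ∑ i ∈ s, cq (f i) := map_sum cqL f s
theorem cq_mul (p q : ℍ[ℝ]) : cq (p * q) = cq p * cq q := by
  refine cq_ext ?_ ?_ ?_ ?_ <;> simp
theorem real_smul_eq (c : ℝ) (q : ℍ[ℂ]) : c • q = (c : ℂ) • q := by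
  refine cq_ext ?_ ?_ ?_ ?_ <;> exact Complex.real_smul

instance complexQuaternionRealScalarTower : IsScalarTower ℝ ℂ ℍ[ℂ] :=
  ⟨fun c z q => by rw [real_smul_eq, ← smul_assoc, Complex.real_smul, smul_eq_mul]⟩

instance complexQuaternionRealIsScalarTower : IsScalarTower ℝ ℍ[ℂ] ℍ[ℂ] :=
  ⟨fun c p q => by rw [real_smul_eq, real_smul_eq, smul_assoc]⟩

instance complexQuaternionRealSMulCommClass : SMulCommClass ℝ ℍ[ℂ] ℍ[ℂ] :=
  ⟨fun c p q => by rw [real_smul_eq, real_smul_eq, smul_comm]⟩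

theorem cq_smul_mul (c : ℂ) (p q : ℍ[ℂ]) : (c • p) * q = c • (p * q) := smul_mul_assoc c p q
theorem cq_mul_smul (c : ℂ) (p q : ℍ[ℂ]) : p * (c • q) = c • (p * q) := mul_smul_comm c p q
theorem cq_rsmul_mul (c : ℝ) (p q : ℍ[ℂ]) : (c • p) * q = c • (p * q) := smul_mul_assoc c p q
theorem cq_mul_rsmul (c : ℝ) (p q : ℍ[ℂ]) : p * (c • q) = c • (p * q) := mul_smul_comm c p q

/-- Coordinates are continuous functionals. An operation that commutes with all of these, such as an
integral or a derivative, can therefore be computed on the quaternion-valued function itself. -/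
theorem coordwise_eq {X : Type*} {L : (X → ℂ) → ℂ} {F : X → ℍ[ℂ]} {q : ℍ[ℂ]}
    (h : ∀ ℓ : ℍ[ℂ] →L[ℂ] ℂ, L (fun x => ℓ (F x)) = ℓ q) : coordwise L F = q := by
  refine cq_ext ?_ ?_ ?_ ?_
  · exact h reL
  · exact h imIL
  · exact h imJL
  · exact h imKL

theorem allCoords_iff {X : Type*} {P : (X → ℂ) → Prop} {F : X → ℍ[ℂ]} :
    AllCoords P F ↔ P (fun x => reL (F x)) ∧ P (fun x => imIL (F x)) ∧
      P (fun x => imJL (F x)) ∧ P (fun x => imKL (F x)) := Iff.rfl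

theorem AllCoords.of_forall {X : Type*} {P : (X → ℂ) → Prop} {F : X → ℍ[ℂ]}
    (h : ∀ ℓ : ℍ[ℂ] →L[ℂ] ℂ, P (fun x => ℓ (F x))) : AllCoords P F :=
  ⟨h reL, h imIL, h imJL, h imKL⟩

/-- The units `1, i, j, k` of the complexified quaternions. -/
def quatUnit (n : Fin 4) : ℍ[ℂ] :=
  ⟨if n = 0 then 1 else 0, if n = 1 then 1 else 0, if n = 2 then 1 else 0, if n = 3 then 1 else 0⟩

@[simp] theorem quatUnit_re (n : Fin 4) : (quatUnit n).re = if n = 0 then 1 else 0 := rfl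
@[simp] theorem quatUnit_imI (n : Fin 4) : (quatUnit n).imI = if n = 1 then 1 else 0 := rfl
@[simp] theorem quatUnit_imJ (n : Fin 4) : (quatUnit n).imJ = if n = 2 then 1 else 0 := rfl
@[simp] theorem quatUnit_imK (n : Fin 4) : (quatUnit n).imK = if n = 3 then 1 else 0 := rfl

/-- Reassemble a quaternion from its coordinates. -/
theorem eq_sum_coords (q : ℍ[ℂ]) : q = reL q • quatUnit 0 + imIL q • (quatUnit 1) +
    imJL q • (quatUnit 2) + imKL q • (quatUnit 3) := by
  refine cq_ext ?_ ?_ ?_ ?_ <;> simp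

theorem coordwise_integral {X : Type*} [MeasurableSpace X] {μ : Measure X} {F : X → ℍ[ℂ]}
    (hF : Integrable F μ) : coordwise (fun u => ∫ x, u x ∂μ) F = ∫ x, F x ∂μ :=
  coordwise_eq fun ℓ => ℓ.integral_comp_comm hF

theorem coordwise_deriv {F : ℝ → ℍ[ℂ]} {t : ℝ} {D : ℍ[ℂ]} (hF : HasDerivAt F D t) :
    coordwise (fun u => deriv u t) F = D :=
  coordwise_eq fun ℓ =>
    ((ℓ.restrictScalars ℝ).hasFDerivAt.comp_hasDerivAt t hF).deriv

theorem contDiffOn_of_allCoords {s : Set (Fin 3 → ℝ)} {F : (Fin 3 → ℝ) → ℍ[ℂ]}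
    (h : AllCoords (fun u => ContDiffOn ℝ 1 u s) F) : ContDiffOn ℝ 1 F s := by
  obtain ⟨h0, h1, h2, h3⟩ := allCoords_iff.1 h
  rw [show F = fun x => _ from funext fun x => eq_sum_coords (F x)]
  exact (((h0.smul contDiffOn_const).add (h1.smul contDiffOn_const)).add
    (h2.smul contDiffOn_const)).add (h3.smul contDiffOn_const)

end FracPsi
end

noncomputable section
namespace FracPsi

/-! ### The Cauchy-Riemann kernel and its regularizations -/

/-- The square of the Euclidean norm. -/
def sqNorm (z : Fin 3 → ℝ) : ℝ := ∑ k, z k ^ 2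

theorem sqNorm_nonneg (z : Fin 3 → ℝ) : 0 ≤ sqNorm z := Finset.sum_nonneg fun _ _ => sq_nonneg _

theorem sq_le_sqNorm (z : Fin 3 → ℝ) (k : Fin 3) : z k ^ 2 ≤ sqNorm z :=
  Finset.single_le_sum (f := fun k => z k ^ 2) (fun _ _ => sq_nonneg _) (Finset.mem_univ k)

theorem sqNorm_pos {z : Fin 3 → ℝ} {k : Fin 3} (h : z k ≠ 0) : 0 < sqNorm z :=
  lt_of_lt_of_le (by positivity) (sq_le_sqNorm z k)

theorem norm_sq_le_sqNorm (z : Fin 3 → ℝ) : ‖z‖ ^ 2 ≤ sqNorm z := by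
  have : ‖z‖ ≤ √(sqNorm z) := (pi_norm_le_iff_of_nonneg (Real.sqrt_nonneg _)).2 fun k =>
    Real.abs_le_sqrt (sq_le_sqNorm z k)
  calc ‖z‖ ^ 2 ≤ √(sqNorm z) ^ 2 := by gcongr
    _ = _ := Real.sq_sqrt (sqNorm_nonneg z)

theorem sqNorm_smul (c : ℝ) (z : Fin 3 → ℝ) : sqNorm (c • z) = c ^ 2 * sqNorm z := by
  simp [sqNorm, mul_pow, Finset.mul_sum]

theorem sqNorm_neg (z : Fin 3 → ℝ) : sqNorm (-z) = sqNorm z := by simp [sqNorm]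

theorem contDiff_sqNorm : ContDiff ℝ ⊤ sqNorm := by unfold sqNorm; fun_prop

theorem IsStructuralSet.self_mul_star {ψ : Fin 3 → ℍ[ℝ]} (hψ : IsStructuralSet ψ) (k : Fin 3) :
    ψ k * star (ψ k) = 1 := by
  have h := hψ.2 k k
  rw [if_pos rfl, ← two_mul] at h
  have h2 : (2 : ℍ[ℝ]) ≠ 0 := fun h0 => by
    have := congrArg (fun q : ℍ[ℝ] => q.re) h0
    rw [show (2 : ℍ[ℝ]) = ((2 : ℝ) : ℍ[ℝ]) by norm_cast] at this
    simp at this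
  exact mul_left_cancel₀ h2 (h.trans (mul_one 2).symm)

theorem IsStructuralSet.star_mul_self {ψ : Fin 3 → ℍ[ℝ]} (hψ : IsStructuralSet ψ) (k : Fin 3) :
    star (ψ k) * ψ k = 1 := by
  rw [Quaternion.star_mul_self, ← Quaternion.self_mul_star, hψ.self_mul_star]

/-- The real part of ψ_k conj(ψ_s) is the Euclidean inner product in ℝ⁴, so the structural relations
say that ψ is orthonormal and that `embed ψ` is an isometry for the Euclidean norm. -/
theorem IsStructuralSet.normSq_embed {ψ : Fin 3 → ℍ[ℝ]} (hψ : IsStructuralSet ψ)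
    (z : Fin 3 → ℝ) : Quaternion.normSq (embed ψ z) = sqNorm z := by
  have h : ∀ k s, (ψ k).re * (ψ s).re + (ψ k).imI * (ψ s).imI + (ψ k).imJ * (ψ s).imJ
      + (ψ k).imK * (ψ s).imK = if k = s then 1 else 0 := by
    intro k s
    have := congrArg (fun q : ℍ[ℝ] => q.re) (hψ.2 k s)
    rw [show (2 : ℍ[ℝ]) = ((2 : ℝ) : ℍ[ℝ]) by norm_cast] at this
    split_ifs at this ⊢ <;> simp at this <;> linarith
  have h00 := h 0 0
  have h01 := h 0 1
  have h02 := h 0 2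
  have h11 := h 1 1
  have h12 := h 1 2
  have h22 := h 2 2
  simp only [Fin.isValue, if_true, Fin.reduceEq, if_false] at h00 h01 h02 h11 h12 h22
  rw [Quaternion.normSq_def']
  simp only [embed, sqNorm, Fin.sum_univ_three, Quaternion.re_add, Quaternion.imI_add,
    Quaternion.imJ_add, Quaternion.imK_add, Quaternion.re_smul, Quaternion.imI_smul,
    Quaternion.imJ_smul, Quaternion.imK_smul, smul_eq_mul]
  linear_combination z 0 ^ 2 * h00 + z 1 ^ 2 * h11 + z 2 ^ 2 * h22 + 2 * z 0 * z 1 * h01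
    + 2 * z 0 * z 2 * h02 + 2 * z 1 * z 2 * h12

/-- The kernel `conj(z) / (4 π (|z|² + s)^{3/2})`. -/
def regKernel (ψ : Fin 3 → ℍ[ℝ]) (s : ℝ) (z : Fin 3 → ℝ) : ℍ[ℝ] :=
  ((4 * Real.pi)⁻¹ * (sqNorm z + s) ^ (-(3 / 2) : ℝ)) • star (embed ψ z)

theorem IsStructuralSet.kernel_eq {ψ : Fin 3 → ℍ[ℝ]} (hψ : IsStructuralSet ψ)
    (z : Fin 3 → ℝ) : kernel ψ z = regKernel ψ 0 z := by
  have h : ‖embed ψ z‖ ^ 3 = sqNorm z ^ (3 / 2 : ℝ) := by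
    rw [← hψ.normSq_embed, Quaternion.normSq_eq_norm_mul_self, ← sq, ← Real.rpow_natCast,
      ← Real.rpow_natCast, ← Real.rpow_mul (norm_nonneg _)]
    norm_num
  rw [kernel, regKernel, h, add_zero, Real.rpow_neg (sqNorm_nonneg z), mul_inv]

theorem star_embed (ψ : Fin 3 → ℍ[ℝ]) (z : Fin 3 → ℝ) :
    star (embed ψ z) = embed (fun k => star (ψ k)) z := by
  simp [embed, star_sum]

/-- `embed` as a linear map. -/
def embedL (ψ : Fin 3 → ℍ[ℝ]) : (Fin 3 → ℝ) →L[ℝ] ℍ[ℝ] :=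
  LinearMap.toContinuousLinearMap
    { toFun := embed ψ
      map_add' := fun x y => by simp [embed, add_smul, Finset.sum_add_distrib]
      map_smul' := fun c x => by simp [embed, mul_smul, Finset.smul_sum] }

@[simp] theorem embedL_apply (ψ : Fin 3 → ℍ[ℝ]) (z : Fin 3 → ℝ) : embedL ψ z = embed ψ z := rfl

theorem embed_single (ψ : Fin 3 → ℍ[ℝ]) (k : Fin 3) : embed ψ (Pi.single k 1) = ψ k := by
  rw [embed, Finset.sum_eq_single k] <;> simp +contextual

theorem contDiffAt_regKernel (ψ : Fin 3 → ℍ[ℝ]) {s : ℝ} {z : Fin 3 → ℝ} (h : 0 < sqNorm z + s) :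
    ContDiffAt ℝ ⊤ (regKernel ψ s) z := by
  have h1 : ContDiffAt ℝ ⊤ (fun z => sqNorm z + s) z :=
    (contDiff_sqNorm.contDiffAt).add contDiffAt_const
  have h2 : ContDiff ℝ ⊤ (fun z => star (embed ψ z)) := by
    simp only [star_embed]
    exact (embedL fun k => star (ψ k)).contDiff
  exact (contDiffAt_const.mul (h1.rpow_const_of_ne h.ne')).smul h2.contDiffAt

theorem fderiv_regKernel_single (ψ : Fin 3 → ℍ[ℝ]) {s : ℝ} {z : Fin 3 → ℝ}
    (h : 0 < sqNorm z + s) (k : Fin 3) :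
    fderiv ℝ (regKernel ψ s) z (Pi.single k 1) =
      ((4 * Real.pi)⁻¹ * (sqNorm z + s) ^ (-(3 / 2) : ℝ)) • star (ψ k)
        - ((4 * Real.pi)⁻¹ * (3 * (sqNorm z + s) ^ (-(5 / 2) : ℝ)) * z k) • star (embed ψ z) := by
  have hl : HasDerivAt (fun t : ℝ => z + t • (Pi.single k 1 : Fin 3 → ℝ)) (Pi.single k 1) 0 := by
    simpa using ((hasDerivAt_id (0 : ℝ)).smul_const (Pi.single k 1 : Fin 3 → ℝ)).const_add z
  have hd := ((contDiffAt_regKernel ψ h).differentiableAt (by simp)).hasFDerivAt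
  have hz : z + (0 : ℝ) • (Pi.single k 1 : Fin 3 → ℝ) = z := by simp
  have h1 : HasDerivAt (fun t : ℝ => regKernel ψ s (z + t • (Pi.single k 1 : Fin 3 → ℝ)))
      (fderiv ℝ (regKernel ψ s) z (Pi.single k 1)) 0 := by
    have hd' : HasFDerivAt (regKernel ψ s) (fderiv ℝ (regKernel ψ s) z)
        (z + (0 : ℝ) • (Pi.single k 1 : Fin 3 → ℝ)) := by rwa [hz]
    exact hd'.comp_hasDerivAt (0 : ℝ) hl
  have hN : ∀ t : ℝ, sqNorm (z + t • (Pi.single k 1 : Fin 3 → ℝ)) = sqNorm z + 2 * t * z k + t ^ 2 := by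
    intro t
    fin_cases k <;> simp [sqNorm, Fin.sum_univ_three] <;> ring
  have h2 : HasDerivAt (fun t : ℝ => sqNorm (z + t • (Pi.single k 1 : Fin 3 → ℝ)) + s)
      (2 * z k) 0 := by
    simp only [hN]
    have := (((hasDerivAt_id (0 : ℝ)).const_mul 2).mul_const (z k)).const_add (sqNorm z)
    have := (this.add (hasDerivAt_pow 2 (0 : ℝ))).add_const s
    simpa using this
  have h3 := (h2.rpow_const (p := -(3 / 2)) (Or.inl (by rw [hz]; exact h.ne'))).const_mul
    (4 * Real.pi)⁻¹
  have h4 : HasDerivAt (fun t : ℝ => star (embed ψ (z + t • (Pi.single k 1 : Fin 3 → ℝ))))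
      (star (ψ k)) 0 := by
    simp only [star_embed]
    have := (embedL fun k => star (ψ k)).hasFDerivAt.comp_hasDerivAt (0 : ℝ) hl
    rw [embedL_apply, embed_single] at this
    exact this
  refine h1.unique ((h3.smul h4).congr_deriv ?_)
  rw [hz, show (-(3 / 2) - 1 : ℝ) = -(5 / 2) by norm_num, sub_eq_add_neg, ← neg_smul]
  congr 2
  ring

/-- With N = |z|² + s, the k-th partial derivative is A conj(ψ_k) - B z_k conj(z), where A is
proportional to N^{-3/2} and B to 3 N^{-5/2}. Multiplying by ψ_k and summing leaves the real number
3A - B|z|². Since N^{-3/2} = N^{-5/2}(|z|² + s), only the term with the factor s survives. -/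
theorem IsStructuralSet.cr_regKernel {ψ : Fin 3 → ℍ[ℝ]} (hψ : IsStructuralSet ψ) {s : ℝ}
    {z : Fin 3 → ℝ} (h : 0 < sqNorm z + s) :
    (∑ k, fderiv ℝ (regKernel ψ s) z (Pi.single k 1) * ψ k =
      ((3 / (4 * Real.pi) * (s * (sqNorm z + s) ^ (-(5 / 2) : ℝ)) : ℝ) : ℍ[ℝ])) ∧
    (∑ k, ψ k * fderiv ℝ (regKernel ψ s) z (Pi.single k 1) =
      ((3 / (4 * Real.pi) * (s * (sqNorm z + s) ^ (-(5 / 2) : ℝ)) : ℝ) : ℍ[ℝ])) := by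
  have hpow : (sqNorm z + s) ^ (-(3 / 2) : ℝ) = (sqNorm z + s) ^ (-(5 / 2) : ℝ) * (sqNorm z + s) := by
    rw [← Real.rpow_add_one h.ne']; norm_num
  have key : (3 * ((4 * Real.pi)⁻¹ * (sqNorm z + s) ^ (-(3 / 2) : ℝ)) -
      (4 * Real.pi)⁻¹ * (3 * (sqNorm z + s) ^ (-(5 / 2) : ℝ)) * sqNorm z) =
      3 / (4 * Real.pi) * (s * (sqNorm z + s) ^ (-(5 / 2) : ℝ)) := by
    rw [hpow]; ring
  set A := (4 * Real.pi)⁻¹ * (sqNorm z + s) ^ (-(3 / 2) : ℝ)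
  set B := (4 * Real.pi)⁻¹ * (3 * (sqNorm z + s) ^ (-(5 / 2) : ℝ))
  constructor
  · calc _ = ∑ k, (A • (1 : ℍ[ℝ]) - B • (star (embed ψ z) * (z k • ψ k))) := by
          refine Finset.sum_congr rfl fun k _ => ?_
          rw [fderiv_regKernel_single ψ h, sub_mul, smul_mul_assoc, smul_mul_assoc,
            hψ.star_mul_self, mul_smul_comm, mul_smul B (z k)]
      _ = (3 * A) • (1 : ℍ[ℝ]) - B • (star (embed ψ z) * embed ψ z) := by
          rw [Finset.sum_sub_distrib, ← Finset.smul_sum, ← Finset.smul_sum, ← Finset.mul_sum, ← embed]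
          simp [mul_comm 3 A, mul_smul, ← Nat.cast_smul_eq_nsmul ℝ]
      _ = _ := by
          rw [Quaternion.star_mul_self, hψ.normSq_embed, ← key]
          ext <;> simp
  · calc _ = ∑ k, (A • (1 : ℍ[ℝ]) - B • ((z k • ψ k) * star (embed ψ z))) := by
          refine Finset.sum_congr rfl fun k _ => ?_
          rw [fderiv_regKernel_single ψ h, mul_sub, mul_smul_comm, mul_smul_comm,
            hψ.self_mul_star, smul_mul_assoc, mul_smul B (z k)]
      _ = (3 * A) • (1 : ℍ[ℝ]) - B • (embed ψ z * star (embed ψ z)) := by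
          rw [Finset.sum_sub_distrib, ← Finset.smul_sum, ← Finset.smul_sum, ← Finset.sum_mul, ← embed]
          simp [mul_comm 3 A, mul_smul, ← Nat.cast_smul_eq_nsmul ℝ]
      _ = _ := by
          rw [Quaternion.self_mul_star, hψ.normSq_embed, ← key]
          ext <;> simp

end FracPsi
end

/-! ### The approximate identity, boundary integrals and Stokes' theorem -/

noncomputable section
namespace FracPsi

/-- The approximate identity `3 / (4 π (|z|² + 1)^{5/2})`. -/
def peak (z : Fin 3 → ℝ) : ℝ := 3 / (4 * Real.pi) * (sqNorm z + 1) ^ (-(5 / 2) : ℝ)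

theorem peak_nonneg (z : Fin 3 → ℝ) : 0 ≤ peak z :=
  mul_nonneg (by positivity) (Real.rpow_nonneg (by linarith [sqNorm_nonneg z]) _)

/-- The integrand has the primitive r³(r² + 1)^{-3/2} = (1 + r⁻²)^{-3/2}, which is 0 at the origin
and tends to 1 at infinity. -/
theorem integral_Ioi_radial :
    ∫ r in Ioi (0 : ℝ), r ^ 2 * (3 * (r ^ 2 + 1) ^ (-(5 / 2) : ℝ)) = 1 := by
  have hd : ∀ r : ℝ, HasDerivAt (fun r : ℝ => r ^ 3 * (r ^ 2 + 1) ^ (-(3 / 2) : ℝ))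
      (r ^ 2 * (3 * (r ^ 2 + 1) ^ (-(5 / 2) : ℝ))) r := by
    intro r
    have hp : 0 < r ^ 2 + 1 := by positivity
    have h1 := ((hasDerivAt_pow 2 r).add_const 1).rpow_const (p := -(3 / 2)) (Or.inl hp.ne')
    refine ((hasDerivAt_pow 3 r).mul h1).congr_deriv ?_
    have : (r ^ 2 + 1) ^ (-(3 / 2) : ℝ) = (r ^ 2 + 1) ^ (-(5 / 2) : ℝ) * (r ^ 2 + 1) := by
      rw [← Real.rpow_add_one hp.ne']; norm_num
    rw [this, show (-(3 / 2) - 1 : ℝ) = -(5 / 2) by norm_num]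
    push_cast
    ring
  have hlim : Filter.Tendsto (fun r : ℝ => r ^ 3 * (r ^ 2 + 1) ^ (-(3 / 2) : ℝ)) Filter.atTop
      (nhds 1) := by
    have h1 : Filter.Tendsto (fun r : ℝ => (1 + (r ^ 2)⁻¹) ^ (-(3 / 2) : ℝ)) Filter.atTop
        (nhds ((1 + 0) ^ (-(3 / 2) : ℝ))) := by
      refine Filter.Tendsto.rpow_const ?_ (Or.inl (by norm_num))
      exact ((Filter.tendsto_pow_atTop two_ne_zero).inv_tendsto_atTop).const_add 1
    simp only [add_zero, Real.one_rpow] at h1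
    refine h1.congr' ?_
    filter_upwards [Filter.eventually_gt_atTop 0] with r hr
    have : r ^ 2 + 1 = r ^ 2 * (1 + (r ^ 2)⁻¹) := by field_simp
    rw [this, Real.mul_rpow (by positivity) (by positivity), ← Real.rpow_natCast r 2,
      ← Real.rpow_mul hr.le, ← mul_assoc, ← Real.rpow_natCast r 3, ← Real.rpow_add hr]
    norm_num
  rw [integral_Ioi_of_hasDerivAt_of_nonneg' (fun r _ => hd r) (fun r _ => by positivity) hlim]
  simp

theorem integral_peak : ∫ z, peak z = 1 := by
  -- Polar coordinates need the Euclidean norm, whereas `Fin 3 → ℝ` carries the sup norm.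
  have h := (PiLp.volume_preserving_ofLp (Fin 3)).integral_comp
    (MeasurableEquiv.toLp 2 (Fin 3 → ℝ)).symm.measurableEmbedding peak
  rw [← h]
  have h2 : ∀ x : EuclideanSpace ℝ (Fin 3), peak (WithLp.ofLp x) =
      (fun r : ℝ => 3 / (4 * Real.pi) * (r ^ 2 + 1) ^ (-(5 / 2) : ℝ)) ‖x‖ := by
    intro x
    simp only [peak, sqNorm, EuclideanSpace.norm_sq_eq, Real.norm_eq_abs, sq_abs]
  rw [integral_congr_ae (Filter.Eventually.of_forall h2)]
  refine (integral_fun_norm_addHaar (volume : Measure (EuclideanSpace ℝ (Fin 3)))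
    (fun r : ℝ => 3 / (4 * Real.pi) * (r ^ 2 + 1) ^ (-(5 / 2) : ℝ))).trans ?_
  have h3 : (volume : Measure (EuclideanSpace ℝ (Fin 3))).real (Metric.ball 0 1) =
      Real.pi * 4 / 3 := by
    rw [measureReal_def, EuclideanSpace.volume_ball_fin_three]
    simp
    positivity
  rw [h3, finrank_euclideanSpace_fin]
  have h4 : ∀ y : ℝ, y ^ (3 - 1) • (3 / (4 * Real.pi) * (y ^ 2 + 1) ^ (-(5 / 2) : ℝ)) =
      (4 * Real.pi)⁻¹ * (y ^ 2 * (3 * (y ^ 2 + 1) ^ (-(5 / 2) : ℝ))) := by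
    intro y; simp only [smul_eq_mul]; ring
  simp only [h4]
  rw [integral_const_mul, integral_Ioi_radial]
  have := Real.pi_ne_zero
  simp only [smul_eq_mul, nsmul_eq_mul]
  field_simp
  norm_num

/-- The decay condition under which rescalings of `peak` concentrate. It holds because `peak z` is
at most a constant times ‖z‖⁻⁵. -/
theorem tendsto_peak : Filter.Tendsto (fun z : Fin 3 → ℝ => ‖z‖ ^ Module.finrank ℝ (Fin 3 → ℝ) *
    peak z) (Bornology.cobounded _) (nhds 0) := by
  have h0 : Filter.Tendsto (fun r : ℝ => 3 / (4 * Real.pi) * (r ^ 2)⁻¹) Filter.atTop (nhds 0) := by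
    simpa using ((Filter.tendsto_pow_atTop (α := ℝ) two_ne_zero).inv_tendsto_atTop).const_mul
      (3 / (4 * Real.pi))
  refine squeeze_zero' (Filter.Eventually.of_forall fun z =>
    mul_nonneg (by positivity) (peak_nonneg z)) ?_ (h0.comp tendsto_norm_cobounded_atTop)
  filter_upwards [tendsto_norm_cobounded_atTop.eventually (Filter.eventually_gt_atTop 0)] with z hz
  have h1 : (sqNorm z + 1) ^ (-(5 / 2) : ℝ) ≤ (‖z‖ ^ 5)⁻¹ := by
    calc (sqNorm z + 1) ^ (-(5 / 2) : ℝ) ≤ (‖z‖ ^ 2) ^ (-(5 / 2) : ℝ) :=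
          Real.rpow_le_rpow_of_nonpos (by positivity)
            (by linarith [norm_sq_le_sqNorm z]) (by norm_num)
      _ = _ := by
          rw [← Real.rpow_natCast, ← Real.rpow_mul hz.le, ← Real.rpow_natCast, ← Real.rpow_neg hz.le]
          norm_num
  rw [Module.finrank_fin_fun]
  simp only [peak, Function.comp]
  calc ‖z‖ ^ 3 * (3 / (4 * Real.pi) * (sqNorm z + 1) ^ (-(5 / 2) : ℝ))
      ≤ ‖z‖ ^ 3 * (3 / (4 * Real.pi) * (‖z‖ ^ 5)⁻¹) := by gcongr
    _ = _ := by field_simp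

theorem tendsto_integral_peak {g : (Fin 3 → ℝ) → ℍ[ℂ]} {x : Fin 3 → ℝ} (hg : Integrable g)
    (hx : ContinuousAt g x) :
    Filter.Tendsto (fun c : ℝ => ∫ z, (c ^ 3 * peak (c • (x - z))) • g z) Filter.atTop
      (nhds (g x)) := by
  have := tendsto_integral_comp_smul_smul_of_integrable' peak_nonneg integral_peak tendsto_peak hg hx
  rwa [Module.finrank_fin_fun] at this

/-! ### Integrals over the boundary of the box -/

/-- The integral of `boundaryIntegral`, taken as an integral of quaternion-valued functions. -/
def bInt (a b : Fin 3 → ℝ) (ω : Fin 3 → (Fin 3 → ℝ) → ℍ[ℂ]) : ℍ[ℂ] :=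
  ∑ k : Fin 3, ((∫ w in Icc (a ∘ k.succAbove) (b ∘ k.succAbove), ω k (k.insertNth (b k) w)) -
    ∫ w in Icc (a ∘ k.succAbove) (b ∘ k.succAbove), ω k (k.insertNth (a k) w))

/-- Integrability on each of the faces. -/
def FaceIntegrable (a b : Fin 3 → ℝ) (ω : Fin 3 → (Fin 3 → ℝ) → ℍ[ℂ]) : Prop :=
  ∀ k : Fin 3, ∀ c : ℝ, c = a k ∨ c = b k →
    IntegrableOn (fun w : Fin 2 → ℝ => ω k (k.insertNth c w))
      (Icc (a ∘ k.succAbove) (b ∘ k.succAbove))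

variable {a b : Fin 3 → ℝ} {ω ω' : Fin 3 → (Fin 3 → ℝ) → ℍ[ℂ]}

theorem FaceIntegrable.boundaryIntegral_eq (h : FaceIntegrable a b ω) :
    boundaryIntegral a b ω = bInt a b ω :=
  Finset.sum_congr rfl fun k _ => by
    rw [coordwise_integral (h k _ (Or.inr rfl)), coordwise_integral (h k _ (Or.inl rfl))]

theorem FaceIntegrable.boundaryIntegrable (h : FaceIntegrable a b ω) :
    BoundaryIntegrable a b ω :=
  fun k c hc => AllCoords.of_forall fun ℓ => ℓ.integrable_comp (h k c hc)

theorem FaceIntegrable.add (h : FaceIntegrable a b ω) (h' : FaceIntegrable a b ω') :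
    FaceIntegrable a b fun k x => ω k x + ω' k x :=
  fun k c hc => (h k c hc).add (h' k c hc)

theorem bInt_add (h : FaceIntegrable a b ω) (h' : FaceIntegrable a b ω') :
    bInt a b (fun k x => ω k x + ω' k x) = bInt a b ω + bInt a b ω' := by
  simp only [bInt]
  rw [← Finset.sum_add_distrib]
  refine Finset.sum_congr rfl fun k _ => ?_
  rw [integral_add (h k _ (Or.inr rfl)) (h' k _ (Or.inr rfl)),
    integral_add (h k _ (Or.inl rfl)) (h' k _ (Or.inl rfl))]
  abel

theorem insertNth_mem_Icc (hab : ∀ i, a i < b i) {k : Fin 3} {c : ℝ} (hc : c = a k ∨ c = b k)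
    {w : Fin 2 → ℝ} (hw : w ∈ Icc (a ∘ k.succAbove) (b ∘ k.succAbove)) :
    (k.insertNth c w : Fin 3 → ℝ) ∈ Icc a b := by
  refine Fin.insertNth_mem_Icc.2 ⟨?_, hw⟩
  rcases hc with rfl | rfl
  · exact ⟨le_rfl, (hab k).le⟩
  · exact ⟨(hab k).le, le_rfl⟩

theorem continuous_insertNth (k : Fin 3) (c : ℝ) :
    Continuous fun w : Fin 2 → ℝ => (k.insertNth c w : Fin 3 → ℝ) :=
  continuous_const.finInsertNth k continuous_id

theorem box_subset_Icc : box a b ⊆ Icc a b := fun _ hx =>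
  ⟨fun i => (hx i trivial).1.le, fun i => (hx i trivial).2.le⟩

theorem isOpen_box : IsOpen (box a b) := isOpen_set_pi finite_univ fun _ _ => isOpen_Ioo

theorem faceIntegrable_of_continuousOn (hab : ∀ i, a i < b i)
    (h : ∀ k, ContinuousOn (ω k) (Icc a b)) : FaceIntegrable a b ω := fun k c hc =>
  ((h k).comp (continuous_insertNth k c).continuousOn fun _ hw =>
    insertNth_mem_Icc hab hc hw).integrableOn_compact isCompact_Icc

theorem uniqueDiffOn_Icc_pi (hab : ∀ i, a i < b i) : UniqueDiffOn ℝ (Icc a b) := by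
  rw [← pi_univ_Icc]
  exact UniqueDiffOn.univ_pi fun i => uniqueDiffOn_Icc (hab i)

/-- The product `p c q` as a real-bilinear map in `p` and `q`. -/
def triL (c : ℍ[ℂ]) : ℍ[ℂ] →L[ℝ] ℍ[ℂ] →L[ℝ] ℍ[ℂ] :=
  (ContinuousLinearMap.bilinearRestrictScalars ℝ (mulL.comp (mulL.flip c)))

theorem continuousOn_mul_mul {X : Type*} [TopologicalSpace X] {s : Set X} {P Q : X → ℍ[ℂ]}
    (c : ℍ[ℂ]) (hP : ContinuousOn P s) (hQ : ContinuousOn Q s) :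
    ContinuousOn (fun x => P x * c * Q x) s :=
  ((triL c).continuous.comp_continuousOn hP).clm_apply hQ

theorem Icc_mem_nhds_of_mem_box {x : Fin 3 → ℝ} (hx : x ∈ box a b) : Icc a b ∈ nhds x :=
  Filter.mem_of_superset (isOpen_box.mem_nhds hx) box_subset_Icc

theorem ContDiffOn.hasFDerivAt_of_mem_box {E : Type*} [NormedAddCommGroup E] [NormedSpace ℝ E]
    {P : (Fin 3 → ℝ) → E} (hP : ContDiffOn ℝ 1 P (Icc a b))
    {x : Fin 3 → ℝ} (hx : x ∈ box a b) : HasFDerivAt P (fderiv ℝ P x) x :=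
  ((hP.contDiffAt (Icc_mem_nhds_of_mem_box hx)).differentiableAt (by simp)).hasFDerivAt

/-- Stokes' theorem for the form `P ψ_k Q`. -/
theorem bInt_mul_mul (hab : ∀ i, a i < b i) (c : Fin 3 → ℍ[ℂ]) {P Q : (Fin 3 → ℝ) → ℍ[ℂ]}
    (hP : ContDiffOn ℝ 1 P (Icc a b)) (hQ : ContDiffOn ℝ 1 Q (Icc a b)) :
    bInt a b (fun k x => P x * c k * Q x) =
      ∫ x in box a b, ((∑ k, fderiv ℝ P x (Pi.single k 1) * c k) * Q x +
        P x * ∑ k, c k * fderiv ℝ Q x (Pi.single k 1)) := by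
  have hu := uniqueDiffOn_Icc_pi hab
  have hP' := hP.continuousOn_fderivWithin hu le_rfl
  have hQ' := hQ.continuousOn_fderivWithin hu le_rfl
  -- The divergence theorem asks for an integrable divergence. The expression with `fderivWithin` is
  -- continuous on the closed box, hence integrable, and it agrees with the one in `fderiv` on the
  -- open box, which has full measure.
  have hG : ContinuousOn (fun x => ∑ k, (P x * c k * fderivWithin ℝ Q (Icc a b) x (Pi.single k 1) +
      fderivWithin ℝ P (Icc a b) x (Pi.single k 1) * c k * Q x)) (Icc a b) :=
    continuousOn_finsetSum _ fun k _ =>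
      (continuousOn_mul_mul _ hP.continuousOn (hQ'.clm_apply continuousOn_const)).add
        (continuousOn_mul_mul _ (hP'.clm_apply continuousOn_const) hQ.continuousOn)
  have heq : ∀ x ∈ box a b, ∑ k, (P x * c k * fderivWithin ℝ Q (Icc a b) x (Pi.single k 1) +
      fderivWithin ℝ P (Icc a b) x (Pi.single k 1) * c k * Q x) =
      (∑ k, fderiv ℝ P x (Pi.single k 1) * c k) * Q x +
        P x * ∑ k, c k * fderiv ℝ Q x (Pi.single k 1) := by
    intro x hx
    rw [fderivWithin_of_mem_nhds (Icc_mem_nhds_of_mem_box hx),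
      fderivWithin_of_mem_nhds (Icc_mem_nhds_of_mem_box hx),
      Finset.sum_mul, Finset.mul_sum, ← Finset.sum_add_distrib]
    refine Finset.sum_congr rfl fun k _ => ?_
    rw [mul_assoc (P x), add_comm]
  have hbox : (box a b : Set (Fin 3 → ℝ)) =ᵐ[volume] Icc a b := Measure.univ_pi_Ioo_ae_eq_Icc
  have hbm : MeasurableSet (box a b) := isOpen_box.measurableSet
  set D : Fin 3 → (Fin 3 → ℝ) → (Fin 3 → ℝ) →L[ℝ] ℍ[ℂ] := fun k x =>
    (triL (c k)).precompR (Fin 3 → ℝ) (P x) (fderiv ℝ Q x) +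
      (triL (c k)).precompL (Fin 3 → ℝ) (fderiv ℝ P x) (Q x) with hD
  have hDe : ∀ x, ∑ k, D k x (Pi.single k 1) = (∑ k, fderiv ℝ P x (Pi.single k 1) * c k) * Q x +
        P x * ∑ k, c k * fderiv ℝ Q x (Pi.single k 1) := by
    intro x
    rw [Finset.sum_mul, Finset.mul_sum, ← Finset.sum_add_distrib]
    refine Finset.sum_congr rfl fun k _ => ?_
    rw [← mul_assoc (P x), add_comm]
    rfl
  have hint : IntegrableOn (fun x => ∑ k, D k x (Pi.single k 1)) (Icc a b) := by
    rw [← integrableOn_congr_set_ae hbox]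
    refine ((hG.integrableOn_compact isCompact_Icc).mono_set box_subset_Icc).congr_fun ?_ hbm
    intro x hx
    simp only [hDe]
    exact heq x hx
  have key := integral_divergence_of_hasFDerivAt_off_countable' (a := a) (b := b)
    (fun i => (hab i).le) (fun k x => P x * c k * Q x) D ∅ countable_empty
    (fun k => continuousOn_mul_mul _ hP.continuousOn hQ.continuousOn)
    (fun x hx k => (triL (c k)).hasFDerivAt_of_bilinear
      (ContDiffOn.hasFDerivAt_of_mem_box hP hx.1) (ContDiffOn.hasFDerivAt_of_mem_box hQ hx.1)) hint
  simp only [hDe] at key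
  rw [setIntegral_congr_set hbox, key]
  rfl

end FracPsi
end

/-! ### The Cauchy integral formula on a box -/

noncomputable section
namespace FracPsi

/-- Joint continuity on a compact product gives a constant bound, so dominated convergence applies.
-/
theorem tendsto_setIntegral_of_continuousOn_prod {W E : Type*} [TopologicalSpace W]
    [MeasurableSpace W] [OpensMeasurableSpace W] [TopologicalSpace.PseudoMetrizableSpace W]
    [NormedAddCommGroup E] [NormedSpace ℝ E] {μ : Measure W} [IsFiniteMeasureOnCompacts μ]
    {K : Set W} (hK : IsCompact K) (hKm : MeasurableSet K) {H : ℝ → W → E}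
    (hH : ContinuousOn (fun p : ℝ × W => H p.1 p.2) (Icc 0 1 ×ˢ K)) :
    Filter.Tendsto (fun s => ∫ w in K, H s w ∂μ) (nhdsWithin 0 (Icc 0 1))
      (nhds (∫ w in K, H 0 w ∂μ)) := by
  obtain ⟨M, hM⟩ := (isCompact_Icc.prod hK).exists_bound_of_continuousOn hH
  have hs : ∀ s ∈ Icc (0 : ℝ) 1, ContinuousOn (H s) K := fun s hs =>
    hH.comp (f := fun w => (s, w)) (by fun_prop) fun w hw => ⟨hs, hw⟩
  refine tendsto_integral_filter_of_dominated_convergence (fun _ => M) ?_ ?_ ?_ ?_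
  · filter_upwards [self_mem_nhdsWithin] with s h
    exact (hs s h).aestronglyMeasurable_of_isCompact hK hKm
  · filter_upwards [self_mem_nhdsWithin] with s h
    filter_upwards [ae_restrict_mem hKm] with w hw using hM (s, w) ⟨h, hw⟩
  · exact integrableOn_const hK.measure_lt_top.ne
  · filter_upwards [ae_restrict_mem hKm] with w hw
    have h1 : ContinuousOn (fun s => H s w) (Icc 0 1) :=
      hH.comp (f := fun s => (s, w)) (by fun_prop) fun s hs => ⟨hs, hw⟩
    exact h1 0 ⟨le_rfl, zero_le_one⟩

variable {a b : Fin 3 → ℝ}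

theorem insertNth_ne_of_mem_box {x : Fin 3 → ℝ} (hx : x ∈ box a b) {k : Fin 3} {c : ℝ}
    (hc : c = a k ∨ c = b k) (w : Fin 2 → ℝ) : (k.insertNth c w : Fin 3 → ℝ) ≠ x := by
  intro h
  have h1 : c = x k := by rw [← h]; simp
  have h2 := hx k trivial
  rcases hc with rfl | rfl
  · exact h2.1.ne h1
  · exact h2.2.ne h1.symm

/-- The point x lies inside the box and the integrals see only the faces, so continuity away from x
is enough to let s tend to 0. -/
theorem tendsto_bInt (hab : ∀ i, a i < b i) {x : Fin 3 → ℝ} (hx : x ∈ box a b)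
    {ω : ℝ → Fin 3 → (Fin 3 → ℝ) → ℍ[ℂ]}
    (h : ∀ k, ContinuousOn (fun p : ℝ × (Fin 3 → ℝ) => ω p.1 k p.2)
      (Icc 0 1 ×ˢ (Icc a b \ {x}))) :
    Filter.Tendsto (fun s => bInt a b (ω s)) (nhdsWithin 0 (Icc 0 1)) (nhds (bInt a b (ω 0))) := by
  have key : ∀ k : Fin 3, ∀ c : ℝ, c = a k ∨ c = b k → Filter.Tendsto
      (fun s => ∫ w in Icc (a ∘ k.succAbove) (b ∘ k.succAbove), ω s k (k.insertNth c w))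
      (nhdsWithin 0 (Icc 0 1))
      (nhds (∫ w in Icc (a ∘ k.succAbove) (b ∘ k.succAbove), ω 0 k (k.insertNth c w))) := by
    intro k c hc
    refine tendsto_setIntegral_of_continuousOn_prod isCompact_Icc measurableSet_Icc ?_
    refine (h k).comp (f := fun p : ℝ × (Fin 2 → ℝ) => (p.1, (k.insertNth c p.2 : Fin 3 → ℝ))) ?_ ?_
    · exact (continuous_fst.prodMk ((continuous_insertNth k c).comp continuous_snd)).continuousOn
    · exact fun p hp => ⟨hp.1, insertNth_mem_Icc hab hc hp.2, insertNth_ne_of_mem_box hx hc _⟩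
  exact tendsto_finsetSum _ fun k _ =>
    (key k _ (Or.inr rfl)).sub (key k _ (Or.inl rfl))

theorem continuousAt_regKernel (ψ : Fin 3 → ℍ[ℝ]) {p : ℝ × (Fin 3 → ℝ)}
    (h : sqNorm p.2 + p.1 ≠ 0) :
    ContinuousAt (fun p : ℝ × (Fin 3 → ℝ) => regKernel ψ p.1 p.2) p := by
  have h1 : ContinuousAt (fun p : ℝ × (Fin 3 → ℝ) => sqNorm p.2 + p.1) p := by
    have := contDiff_sqNorm.continuous
    fun_prop
  have h2 : Continuous fun p : ℝ × (Fin 3 → ℝ) => star (embed ψ p.2) := by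
    simp only [star_embed]
    exact (embedL fun k => star (ψ k)).continuous.comp continuous_snd
  exact (continuousAt_const.mul (h1.rpow_const (Or.inl h))).smul h2.continuousAt

theorem sqNorm_sub_pos {x z : Fin 3 → ℝ} (h : z ≠ x) : 0 < sqNorm (z - x) := by
  obtain ⟨k, hk⟩ := Function.ne_iff.1 h
  exact sqNorm_pos (k := k) (by simpa [sub_eq_zero] using hk)

theorem continuousOn_cq_regKernel (ψ : Fin 3 → ℍ[ℝ]) (x : Fin 3 → ℝ) :
    ContinuousOn (fun p : ℝ × (Fin 3 → ℝ) => cq (regKernel ψ p.1 (p.2 - x)))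
      (Icc 0 1 ×ˢ (Icc a b \ {x})) := by
  intro p hp
  have h0 : sqNorm (p.2 - x) + p.1 ≠ 0 := by
    have := sqNorm_sub_pos hp.2.2
    have := hp.1.1
    positivity
  refine ContinuousAt.continuousWithinAt ?_
  refine cqL.continuous.continuousAt.comp ?_
  exact ContinuousAt.comp (g := fun p : ℝ × (Fin 3 → ℝ) => regKernel ψ p.1 p.2)
    (f := fun p : ℝ × (Fin 3 → ℝ) => (p.1, p.2 - x))
    (continuousAt_regKernel ψ h0) (by fun_prop)

/-- With s = c⁻², the Cauchy-Riemann derivative found in `cr_regKernel` is exactly the rescaled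
approximate identity. -/
theorem peak_scale {c : ℝ} (hc : 0 < c) (x z : Fin 3 → ℝ) :
    c ^ 3 * peak (c • (x - z)) =
      3 / (4 * Real.pi) * ((c ^ 2)⁻¹ * (sqNorm (z - x) + (c ^ 2)⁻¹) ^ (-(5 / 2) : ℝ)) := by
  have h1 : sqNorm (c • (x - z)) + 1 = c ^ 2 * (sqNorm (z - x) + (c ^ 2)⁻¹) := by
    rw [sqNorm_smul, ← sqNorm_neg, neg_sub]
    field_simp
  have h2 : 0 ≤ sqNorm (z - x) := sqNorm_nonneg _
  have h3 : (c ^ 2) ^ (-(5 / 2) : ℝ) = (c ^ 5)⁻¹ := by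
    rw [← Real.rpow_natCast, ← Real.rpow_mul hc.le, ← Real.rpow_natCast, ← Real.rpow_neg hc.le]
    norm_num
  rw [peak, h1, Real.mul_rpow (by positivity) (by positivity), h3]
  field_simp

theorem tendsto_inv_sq_nhdsWithin :
    Filter.Tendsto (fun c : ℝ => (c ^ 2)⁻¹) Filter.atTop (nhdsWithin 0 (Icc 0 1)) := by
  refine tendsto_nhdsWithin_iff.2 ⟨(Filter.tendsto_pow_atTop two_ne_zero).inv_tendsto_atTop, ?_⟩
  filter_upwards [Filter.eventually_ge_atTop 1] with c hc
  exact ⟨by positivity, inv_le_one_of_one_le₀ (one_le_pow₀ hc)⟩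

theorem hasFDerivAt_cq_regKernel (ψ : Fin 3 → ℍ[ℝ]) {s : ℝ} {z x : Fin 3 → ℝ}
    (h : 0 < sqNorm (z - x) + s) :
    HasFDerivAt (fun z => cq (regKernel ψ s (z - x)))
      (cqL.comp (fderiv ℝ (regKernel ψ s) (z - x))) z := by
  have h1 : HasFDerivAt (regKernel ψ s) (fderiv ℝ (regKernel ψ s) (z - x)) (z - x) :=
    ((contDiffAt_regKernel ψ h).differentiableAt (by simp)).hasFDerivAt
  have h2 := h1.comp z ((hasFDerivAt_id z).sub_const x)
  have h3 := cqL.hasFDerivAt.comp z h2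
  exact h3.congr_fderiv (ContinuousLinearMap.ext fun v => rfl)

theorem contDiff_cq_regKernel (ψ : Fin 3 → ℍ[ℝ]) {s : ℝ} (hs : 0 < s) (x : Fin 3 → ℝ) :
    ContDiff ℝ 1 (fun z => cq (regKernel ψ s (z - x))) := by
  have h1 : ContDiff ℝ 1 (regKernel ψ s) := contDiff_iff_contDiffAt.2 fun z =>
    (contDiffAt_regKernel ψ (by linarith [sqNorm_nonneg z])).of_le (by simp)
  exact cqL.contDiff.comp (h1.comp (contDiff_id.sub contDiff_const))

theorem cq_coe_mul (r : ℝ) (q : ℍ[ℂ]) : cq (r : ℍ[ℝ]) * q = r • q := by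
  have : (r : ℍ[ℝ]) = r • (1 : ℍ[ℝ]) := by ext <;> simp
  rw [this, cq_smul, cq_one, cq_rsmul_mul, one_mul]

theorem cq_mul_coe (r : ℝ) (q : ℍ[ℂ]) : q * cq (r : ℍ[ℝ]) = r • q := by
  have : (r : ℍ[ℝ]) = r • (1 : ℍ[ℝ]) := by ext <;> simp
  rw [this, cq_smul, cq_one, cq_mul_rsmul, mul_one]

theorem IsStructuralSet.cr_cq_regKernel {ψ : Fin 3 → ℍ[ℝ]} (hψ : IsStructuralSet ψ) {c : ℝ}
    (hc : 0 < c) (x z : Fin 3 → ℝ) :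
    (∑ k, fderiv ℝ (fun z => cq (regKernel ψ (c ^ 2)⁻¹ (z - x))) z (Pi.single k 1) * cq (ψ k) =
      cq ((c ^ 3 * peak (c • (x - z)) : ℝ) : ℍ[ℝ])) ∧
    (∑ k, cq (ψ k) * fderiv ℝ (fun z => cq (regKernel ψ (c ^ 2)⁻¹ (z - x))) z (Pi.single k 1) =
      cq ((c ^ 3 * peak (c • (x - z)) : ℝ) : ℍ[ℝ])) := by
  have hs : 0 < sqNorm (z - x) + (c ^ 2)⁻¹ := by
    have := sqNorm_nonneg (z - x)
    positivity
  obtain ⟨h1, h2⟩ := hψ.cr_regKernel hs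
  rw [(hasFDerivAt_cq_regKernel ψ hs).fderiv, peak_scale hc, ← h1]
  constructor
  · rw [cq_sum]
    exact Finset.sum_congr rfl fun k _ => (cq_mul _ _).symm
  · rw [h1, ← h2, cq_sum]
    exact Finset.sum_congr rfl fun k _ => (cq_mul _ _).symm

theorem tendsto_setIntegral_peak {u : (Fin 3 → ℝ) → ℍ[ℂ]}
    (hu : ContinuousOn u (Icc a b)) {x : Fin 3 → ℝ} (hx : x ∈ box a b) :
    Filter.Tendsto (fun c : ℝ => ∫ z in box a b, (c ^ 3 * peak (c • (x - z))) • u z) Filter.atTop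
      (nhds (u x)) := by
  have hbm : MeasurableSet (box a b) := isOpen_box.measurableSet
  have h := tendsto_integral_peak (g := (box a b).indicator u) (x := x)
    (((hu.integrableOn_compact isCompact_Icc).mono_set box_subset_Icc).integrable_indicator hbm)
    ((hu.continuousAt (Icc_mem_nhds_of_mem_box hx)).congr
      (Filter.eventuallyEq_of_mem (isOpen_box.mem_nhds hx) fun z hz =>
        (indicator_of_mem hz u).symm))
  rw [indicator_of_mem hx] at h
  refine h.congr fun c => ?_
  rw [← integral_indicator hbm]
  refine integral_congr_ae (Filter.Eventually.of_forall fun z => ?_)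
  exact (indicator_smul_apply _ (fun z => c ^ 3 * peak (c • (x - z))) u z).symm

/-- The Cauchy integral formula on a box for left monogenic functions. -/
theorem bInt_kernel_left (hab : ∀ i, a i < b i) {ψ : Fin 3 → ℍ[ℝ]} (hψ : IsStructuralSet ψ)
    {u : (Fin 3 → ℝ) → ℍ[ℂ]} (hu : ContDiffOn ℝ 1 u (Icc a b))
    (hmono : ∀ x ∈ box a b, ∑ k, cq (ψ k) * fderiv ℝ u x (Pi.single k 1) = 0)
    {x : Fin 3 → ℝ} (hx : x ∈ box a b) :
    bInt a b (fun k ζ => cq (kernel ψ (ζ - x)) * cq (ψ k) * u ζ) = u x := by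
  have h1 := (tendsto_bInt hab hx (ω := fun s k ζ => cq (regKernel ψ s (ζ - x)) * cq (ψ k) * u ζ)
    fun k => continuousOn_mul_mul _ (continuousOn_cq_regKernel ψ x)
      (hu.continuousOn.comp continuousOn_snd fun p hp => hp.2.1)).comp tendsto_inv_sq_nhdsWithin
  simp only [hψ.kernel_eq]
  -- The boundary integrals with parameter s = c⁻² have a second limit: by Stokes' theorem and
  -- monogenicity they equal the integral of u against the rescaled `peak`, which tends to u(x).
  refine tendsto_nhds_unique h1 ((tendsto_setIntegral_peak hu.continuousOn hx).congr' ?_)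
  filter_upwards [Filter.eventually_gt_atTop 0] with c hc
  simp only [Function.comp]
  rw [bInt_mul_mul hab (fun k => cq (ψ k)) (contDiff_cq_regKernel ψ (by positivity) x).contDiffOn hu]
  refine setIntegral_congr_fun isOpen_box.measurableSet fun z hz => ?_
  simp only [hmono z hz, (hψ.cr_cq_regKernel hc x z).1]
  rw [mul_zero, add_zero, cq_coe_mul]

/-- The Cauchy integral formula on a box for right monogenic functions. -/
theorem bInt_kernel_right (hab : ∀ i, a i < b i) {ψ : Fin 3 → ℍ[ℝ]} (hψ : IsStructuralSet ψ)
    {u : (Fin 3 → ℝ) → ℍ[ℂ]} (hu : ContDiffOn ℝ 1 u (Icc a b))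
    (hmono : ∀ x ∈ box a b, ∑ k, fderiv ℝ u x (Pi.single k 1) * cq (ψ k) = 0)
    {x : Fin 3 → ℝ} (hx : x ∈ box a b) :
    bInt a b (fun k ζ => u ζ * cq (ψ k) * cq (kernel ψ (ζ - x))) = u x := by
  have h1 := (tendsto_bInt hab hx (ω := fun s k ζ => u ζ * cq (ψ k) * cq (regKernel ψ s (ζ - x)))
    fun k => continuousOn_mul_mul _ (hu.continuousOn.comp continuousOn_snd fun p hp => hp.2.1)
      (continuousOn_cq_regKernel ψ x)).comp tendsto_inv_sq_nhdsWithin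
  simp only [hψ.kernel_eq]
  refine tendsto_nhds_unique h1 ((tendsto_setIntegral_peak hu.continuousOn hx).congr' ?_)
  filter_upwards [Filter.eventually_gt_atTop 0] with c hc
  simp only [Function.comp]
  rw [bInt_mul_mul hab (fun k => cq (ψ k)) hu (contDiff_cq_regKernel ψ (by positivity) x).contDiffOn]
  refine setIntegral_congr_fun isOpen_box.measurableSet fun z hz => ?_
  simp only [hmono z hz, (hψ.cr_cq_regKernel hc x z).2]
  rw [zero_mul, zero_add, cq_mul_coe]

end FracPsi
end

noncomputable section
namespace FracPsi

/-! ### From hyperholomorphic to monogenic functions -/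

variable {a b : Fin 3 → ℝ}

theorem hasDerivAt_line {E : Type*} [NormedAddCommGroup E] [NormedSpace ℝ E]
    {F : (Fin 3 → ℝ) → E} {x : Fin 3 → ℝ} {F' : (Fin 3 → ℝ) →L[ℝ] E} (h : HasFDerivAt F F' x)
    (k : Fin 3) : HasDerivAt (line F x k) (F' (Pi.single k 1)) (x k) := by
  have h' : HasFDerivAt F F' (Function.update x k (x k)) := by rwa [Function.update_eq_self]
  exact h'.comp_hasDerivAt (x k) (hasDerivAt_update x k (x k))

theorem partialQ_eq {F₀ F : (Fin 3 → ℝ) → ℍ[ℂ]} (hF : IsC1Extension a b F₀ F) {x : Fin 3 → ℝ}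
    (hx : x ∈ box a b) (k : Fin 3) : partialQ k F₀ x = fderiv ℝ F x (Pi.single k 1) := by
  refine coordwise_deriv ?_
  have h1 := hasDerivAt_line
    (ContDiffOn.hasFDerivAt_of_mem_box (contDiffOn_of_allCoords hF.1) hx) k
  refine h1.congr_of_eventuallyEq ?_
  have h2 : ContinuousAt (fun t => Function.update x k t) (x k) :=
    (hasDerivAt_update x k (x k)).continuousAt
  have h3 : box a b ∈ nhds (Function.update x k (x k)) := by
    rw [Function.update_eq_self]
    exact isOpen_box.mem_nhds hx
  filter_upwards [h2 h3] with t ht using (hF.2 ht).symm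

theorem update_mem_box {y : Fin 3 → ℝ} (hy : y ∈ box a b) {i : Fin 3} {t : ℝ}
    (ht : t ∈ Ioo (a i) (b i)) : Function.update y i t ∈ box a b := by
  intro j _
  rcases eq_or_ne j i with rfl | h
  · simpa using ht
  · simpa [h] using hy j trivial

theorem update_mem_Icc {y : Fin 3 → ℝ} (hy : y ∈ Icc a b) {i : Fin 3} {t : ℝ}
    (ht : t ∈ Icc (a i) (b i)) : Function.update y i t ∈ Icc a b := by
  rw [← pi_univ_Icc] at hy ⊢
  intro j _
  rcases eq_or_ne j i with rfl | h
  · simpa using ht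
  · simpa [h] using hy j trivial

theorem sumDeriv_pos {y : Fin 3 → ℝ} {φ : (Fin 3 → ℝ) → ℝ} (hφ : IsScale a b y φ)
    {x : Fin 3 → ℝ} (hx : x ∈ box a b) : 0 < sumDeriv φ x y := by
  refine Finset.sum_pos (fun i _ => ?_) Finset.univ_nonempty
  have h := hφ.2 i (x i) (Ioo_subset_Icc_self (hx i trivial))
  rwa [derivWithin_of_mem_nhds (Icc_mem_nhds (hx i trivial).1 (hx i trivial).2)] at h

theorem IsStructuralSet.embed_ne_zero {ψ : Fin 3 → ℍ[ℝ]} (hψ : IsStructuralSet ψ)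
    {σ : Fin 3 → ℝ} (hσ : ∀ i, 0 < σ i) : embed ψ σ ≠ 0 := by
  intro h
  have h1 := hψ.normSq_embed σ
  rw [h, map_zero] at h1
  exact (sqNorm_pos (hσ 0).ne').ne h1

/-- The exponential of the total weight times a function. -/
def weighted (l : Fin 3 → (Fin 3 → ℝ) → ℝ) (F : (Fin 3 → ℝ) → ℍ[ℂ]) (z : Fin 3 → ℝ) : ℍ[ℂ] :=
  Real.exp (∑ j, l j z) • F z

theorem contDiffOn_weighted {l : Fin 3 → (Fin 3 → ℝ) → ℝ} {F : (Fin 3 → ℝ) → ℍ[ℂ]}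
    (hl : ∀ k, ContDiffOn ℝ 1 (l k) (Icc a b)) (hF : ContDiffOn ℝ 1 F (Icc a b)) :
    ContDiffOn ℝ 1 (weighted l F) (Icc a b) :=
  ((ContDiffOn.sum fun j _ => hl j).exp).smul hF

theorem fderiv_weighted {l : Fin 3 → (Fin 3 → ℝ) → ℝ} {F : (Fin 3 → ℝ) → ℍ[ℂ]}
    (hl : ∀ k, ContDiffOn ℝ 1 (l k) (Icc a b)) (hF : ContDiffOn ℝ 1 F (Icc a b))
    {x : Fin 3 → ℝ} (hx : x ∈ box a b) (k : Fin 3) :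
    fderiv ℝ (weighted l F) x (Pi.single k 1) = Real.exp (∑ j, l j x) •
      (fderiv ℝ F x (Pi.single k 1) + deriv (line (fun z => ∑ j, l j z) x k) (x k) • F x) := by
  have hL : HasFDerivAt (fun z => ∑ j, l j z) (fderiv ℝ (fun z => ∑ j, l j z) x) x :=
    ContDiffOn.hasFDerivAt_of_mem_box (ContDiffOn.sum fun j _ => hl j) hx
  have hF' := ContDiffOn.hasFDerivAt_of_mem_box hF hx
  rw [(hasDerivAt_line hL k).deriv]
  have h := hL.exp.smul hF'
  have h2 : fderiv ℝ (weighted l F) x = _ := h.fderiv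
  rw [h2]
  simp only [add_apply, smul_apply,
    ContinuousLinearMap.smulRight_apply, smul_add, smul_eq_mul, mul_smul]

variable {ψ : Fin 3 → ℍ[ℝ]} {α : Fin 3 → ℂ} {σ y : Fin 3 → ℝ} {φ : (Fin 3 → ℝ) → ℝ}
  {l : Fin 3 → (Fin 3 → ℝ) → ℝ} {f : (Fin 3 → ℝ) → ℍ[ℝ]} {F : (Fin 3 → ℝ) → ℍ[ℂ]}

/-- The weight equation is tailored to the product rule: ∂̄F + (∂̄Λ)F is Dφ σ⁻¹ times the fractional
operator applied to f. -/
theorem IsLeftHyperholomorphicAt.monogenic (hψ : IsStructuralSet ψ) (hσ : ∀ i, 0 < σ i)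
    (hφ : IsScale a b y φ) (hl : IsWeight ψ a b σ φ y l)
    (hf : IsLeftHyperholomorphicAt ψ a b α σ φ y f)
    (hF : IsC1Extension a b (boxFracInt a (fun i => 1 - α i) σ φ f y) F)
    {x : Fin 3 → ℝ} (hx : x ∈ box a b) :
    ∑ k, cq (ψ k) * fderiv ℝ (weighted l F) x (Pi.single k 1) = 0 := by
  have hD : (sumDeriv φ x y : ℂ) ≠ 0 := by exact_mod_cast (sumDeriv_pos hφ hx).ne'
  have hσ0 := hψ.embed_ne_zero hσ
  have h1 := hf.2.2 x hx
  have hcr : crLeft ψ (boxFracInt a (fun i => 1 - α i) σ φ f y) x =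
      ∑ k, cq (ψ k) * fderiv ℝ F x (Pi.single k 1) :=
    Finset.sum_congr rfl fun k _ => by rw [partialQ_eq hF hx]
  rw [fracCRLeft, hcr, ← hF.2 hx] at h1
  set A := ∑ k, cq (ψ k) * fderiv ℝ F x (Pi.single k 1)
  -- Multiplying the hyperholomorphy equation by Dφ and, from the left, by σ⁻¹ turns its first
  -- coefficient into ∂̄Λ and its second into 1.
  have h2 := congrArg (fun q => (sumDeriv φ x y : ℂ) • (cq (embed ψ σ)⁻¹ * q)) h1
  simp only [mul_zero, smul_zero, mul_add, ← mul_assoc, ← cq_mul, inv_mul_cancel₀ hσ0, cq_one,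
    one_mul, smul_add] at h2
  rw [smul_inv_smul₀ hD, ← cq_smul_mul, ← real_smul_eq, ← cq_smul, ← hl.2 x hx, add_comm] at h2
  have h3 : ∑ k, cq (ψ k) * fderiv ℝ (weighted l F) x (Pi.single k 1) =
      Real.exp (∑ j, l j x) • (A + cq (∑ k, deriv (line (fun z => ∑ j, l j z) x k) (x k) • ψ k) *
        F x) := by
    rw [cq_sum, Finset.sum_mul, ← Finset.sum_add_distrib, Finset.smul_sum]
    refine Finset.sum_congr rfl fun k _ => ?_
    rw [fderiv_weighted hl.1 (contDiffOn_of_allCoords hF.1) hx, cq_mul_rsmul, mul_add,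
      cq_mul_rsmul, cq_smul, cq_rsmul_mul]
  rw [h3, h2, smul_zero]

theorem IsRightHyperholomorphicAt.monogenic (hψ : IsStructuralSet ψ) (hσ : ∀ i, 0 < σ i)
    (hφ : IsScale a b y φ) (hl : IsWeight ψ a b σ φ y l)
    (hf : IsRightHyperholomorphicAt ψ a b α σ φ y f)
    (hF : IsC1Extension a b (boxFracInt a (fun i => 1 - α i) σ φ f y) F)
    {x : Fin 3 → ℝ} (hx : x ∈ box a b) :
    ∑ k, fderiv ℝ (weighted l F) x (Pi.single k 1) * cq (ψ k) = 0 := by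
  have hD : (sumDeriv φ x y : ℂ) ≠ 0 := by exact_mod_cast (sumDeriv_pos hφ hx).ne'
  have hσ0 := hψ.embed_ne_zero hσ
  have hl2 := hl.2 x hx
  -- The right operator needs (1 - σ)σ⁻¹, while `IsWeight` has the factors in the other order; they
  -- commute.
  have hcomm : (embed ψ σ)⁻¹ * (1 - embed ψ σ) = (1 - embed ψ σ) * (embed ψ σ)⁻¹ := by
    rw [mul_sub, sub_mul, inv_mul_cancel₀ hσ0, mul_inv_cancel₀ hσ0, mul_one, one_mul]
  rw [hcomm] at hl2
  have h1 := hf.2.2 x hx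
  have hcr : crRight ψ (boxFracInt a (fun i => 1 - α i) σ φ f y) x =
      ∑ k, fderiv ℝ F x (Pi.single k 1) * cq (ψ k) :=
    Finset.sum_congr rfl fun k _ => by rw [partialQ_eq hF hx]
  rw [fracCRRight, hcr, ← hF.2 hx] at h1
  set A := ∑ k, fderiv ℝ F x (Pi.single k 1) * cq (ψ k)
  have h2 := congrArg (fun q => (sumDeriv φ x y : ℂ) • (q * cq (embed ψ σ)⁻¹)) h1
  simp only [zero_mul, smul_zero, add_mul, mul_assoc, ← cq_mul, mul_inv_cancel₀ hσ0, cq_one,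
    mul_one, smul_add] at h2
  rw [smul_inv_smul₀ hD, ← cq_mul_smul, ← real_smul_eq, ← cq_smul, ← hl2, add_comm] at h2
  have h3 : ∑ k, fderiv ℝ (weighted l F) x (Pi.single k 1) * cq (ψ k) =
      Real.exp (∑ j, l j x) • (A + F x *
        cq (∑ k, deriv (line (fun z => ∑ j, l j z) x k) (x k) • ψ k)) := by
    rw [cq_sum, Finset.mul_sum, ← Finset.sum_add_distrib, Finset.smul_sum]
    refine Finset.sum_congr rfl fun k _ => ?_
    rw [fderiv_weighted hl.1 (contDiffOn_of_allCoords hF.1) hx, cq_rsmul_mul, add_mul,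
      cq_rsmul_mul, cq_smul, cq_mul_rsmul]
  rw [h3, h2, smul_zero]

/-- The Cauchy theorem for weighted functions. -/
theorem boundaryIntegral_weighted (hab : ∀ i, a i < b i) {m : Fin 3 → (Fin 3 → ℝ) → ℝ}
    {G : (Fin 3 → ℝ) → ℍ[ℂ]}
    (hl : ∀ k, ContDiffOn ℝ 1 (l k) (Icc a b)) (hm : ∀ k, ContDiffOn ℝ 1 (m k) (Icc a b))
    (hF : ContDiffOn ℝ 1 F (Icc a b)) (hG : ContDiffOn ℝ 1 G (Icc a b))
    (hFm : ∀ x ∈ box a b, ∑ k, cq (ψ k) * fderiv ℝ (weighted l F) x (Pi.single k 1) = 0)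
    (hGm : ∀ x ∈ box a b, ∑ k, fderiv ℝ (weighted m G) x (Pi.single k 1) * cq (ψ k) = 0) :
    boundaryIntegral a b (fun k x =>
        (Real.exp (∑ j, (m j x + l j x)) : ℂ) • (G x * cq (ψ k) * F x)) = 0 := by
  have hu := contDiffOn_weighted hl hF
  have hv := contDiffOn_weighted hm hG
  have h0 : (fun (k : Fin 3) (x : Fin 3 → ℝ) =>
      (Real.exp (∑ j, (m j x + l j x)) : ℂ) • (G x * cq (ψ k) * F x)) =
      fun k x => weighted m G x * cq (ψ k) * weighted l F x := by
    funext k x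
    rw [weighted, weighted, ← real_smul_eq, cq_rsmul_mul, cq_mul_rsmul, cq_rsmul_mul, smul_smul,
      ← Real.exp_add, Finset.sum_add_distrib, add_comm]
  rw [h0, (faceIntegrable_of_continuousOn hab fun k =>
    continuousOn_mul_mul _ hv.continuousOn hu.continuousOn).boundaryIntegral_eq,
    bInt_mul_mul hab _ hv hu]
  refine setIntegral_eq_zero_of_forall_eq_zero fun x hx => ?_
  rw [hFm x hx, hGm x hx, zero_mul, mul_zero, add_zero]

/-- The Cauchy formula for weighted functions, left version. -/
theorem bInt_weighted_left (hab : ∀ i, a i < b i) (hψ : IsStructuralSet ψ)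
    (hl : ∀ k, ContDiffOn ℝ 1 (l k) (Icc a b)) (hF : ContDiffOn ℝ 1 F (Icc a b))
    (hFm : ∀ x ∈ box a b, ∑ k, cq (ψ k) * fderiv ℝ (weighted l F) x (Pi.single k 1) = 0)
    {x : Fin 3 → ℝ} (hx : x ∈ box a b) :
    bInt a b (fun k ζ => cq (Real.exp (∑ k, (l k ζ - l k x)) • kernel ψ (ζ - x)) * cq (ψ k) * F ζ)
      = F x := by
  -- The factor e^{-Λ(x)} does not depend on ζ, so it moves under the integral and completes the
  -- weight of the kernel.
  have h := congrArg (fun q => Real.exp (-∑ k, l k x) • q)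
    (bInt_kernel_left hab hψ (contDiffOn_weighted hl hF) hFm hx)
  simp only [weighted, smul_smul, ← Real.exp_add, neg_add_cancel, Real.exp_zero, one_smul] at h
  rw [← h]
  simp only [bInt, Finset.smul_sum, smul_sub, ← integral_smul]
  have e : ∀ k ζ, cq (Real.exp (∑ k, (l k ζ - l k x)) • kernel ψ (ζ - x)) * cq (ψ k) * F ζ =
      Real.exp (-∑ k, l k x) • (cq (kernel ψ (ζ - x)) * cq (ψ k) * Real.exp (∑ k, l k ζ) • F ζ) := by
    intro k ζ
    rw [cq_smul, cq_rsmul_mul, cq_rsmul_mul, cq_mul_rsmul, smul_smul, ← Real.exp_add,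
      Finset.sum_sub_distrib]
    congr 2
    ring
  simp only [e]

/-- The Cauchy formula for weighted functions, right version. -/
theorem bInt_weighted_right (hab : ∀ i, a i < b i) (hψ : IsStructuralSet ψ)
    (hl : ∀ k, ContDiffOn ℝ 1 (l k) (Icc a b)) (hF : ContDiffOn ℝ 1 F (Icc a b))
    (hFm : ∀ x ∈ box a b, ∑ k, fderiv ℝ (weighted l F) x (Pi.single k 1) * cq (ψ k) = 0)
    {x : Fin 3 → ℝ} (hx : x ∈ box a b) :
    bInt a b (fun k ζ => F ζ * cq (ψ k) * cq (Real.exp (∑ k, (l k ζ - l k x)) • kernel ψ (ζ - x)))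
      = F x := by
  have h := congrArg (fun q => Real.exp (-∑ k, l k x) • q)
    (bInt_kernel_right hab hψ (contDiffOn_weighted hl hF) hFm hx)
  simp only [weighted, smul_smul, ← Real.exp_add, neg_add_cancel, Real.exp_zero, one_smul] at h
  rw [← h]
  simp only [bInt, Finset.smul_sum, smul_sub, ← integral_smul]
  have e : ∀ k ζ, F ζ * cq (ψ k) * cq (Real.exp (∑ k, (l k ζ - l k x)) • kernel ψ (ζ - x)) =
      Real.exp (-∑ k, l k x) • (Real.exp (∑ k, l k ζ) • F ζ * cq (ψ k) * cq (kernel ψ (ζ - x))) := by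
    intro k ζ
    rw [cq_smul, cq_mul_rsmul, cq_rsmul_mul, cq_rsmul_mul, smul_smul, ← Real.exp_add,
      Finset.sum_sub_distrib]
    congr 2
    ring
  simp only [e]

end FracPsi
end

noncomputable section
namespace FracPsi

/-! ### Proportional fractional integrals with respect to the identity -/

/-- The kernel of the proportional fractional integral. -/
def propKernel (γ : ℂ) (r : ℝ) (s : ℝ) : ℂ :=
  1 / ((r : ℂ) ^ γ * Complex.Gamma γ) * ((Real.exp ((r - 1) / r * s) : ℂ) * (s : ℂ) ^ (γ - 1))

/-- The proportional fractional integral with respect to the identity. -/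
def propInt {E : Type*} [NormedAddCommGroup E] [NormedSpace ℝ E] [NormedSpace ℂ E]
    (A : ℝ) (γ : ℂ) (r : ℝ) (h : ℝ → E) (t : ℝ) : E :=
  ∫ s in A..t, propKernel γ r (t - s) • h s

theorem intervalIntegrable_propKernel {γ : ℂ} (hγ : 0 < γ.re) (r a b : ℝ) :
    IntervalIntegrable (propKernel γ r) volume a b := by
  refine IntervalIntegrable.const_mul ?_ _
  refine IntervalIntegrable.continuousOn_mul
    (intervalIntegral.intervalIntegrable_cpow' (by simpa using hγ)) ?_
  exact Continuous.continuousOn (by fun_prop)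

theorem contDiffOn_propKernel (γ : ℂ) (r : ℝ) : ContDiffOn ℝ 1 (propKernel γ r) (Ioi 0) := by
  have h : ∀ s ∈ Ioi (0 : ℝ), propKernel γ r s = 1 / ((r : ℂ) ^ γ * Complex.Gamma γ) *
      ((Real.exp ((r - 1) / r * s) : ℂ) * Complex.exp ((Real.log s : ℂ) * (γ - 1))) := by
    intro s hs
    have hs : 0 < s := hs
    have hs0 : (s : ℂ) ≠ 0 := by exact_mod_cast hs.ne'
    rw [propKernel, Complex.cpow_def_of_ne_zero hs0, Complex.ofReal_log hs.le]
  refine ContDiffOn.congr ?_ h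
  have h1 : ContDiffOn ℝ 1 (fun s : ℝ => (Real.log s : ℂ)) (Ioi 0) :=
    Complex.ofRealCLM.contDiff.comp_contDiffOn
      (Real.contDiffOn_log.mono fun s (hs : 0 < s) => hs.ne')
  have h2 : ContDiff ℝ 1 (fun s : ℝ => (Real.exp ((r - 1) / r * s) : ℂ)) :=
    Complex.ofRealCLM.contDiff.comp (Real.contDiff_exp.comp (contDiff_const.mul contDiff_id))
  exact contDiffOn_const.mul (h2.contDiffOn.mul ((h1.mul contDiffOn_const).cexp))

theorem hasDerivAt_propKernel (γ : ℂ) (r : ℝ) {s : ℝ} (hs : 0 < s) :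
    HasDerivAt (propKernel γ r) (deriv (propKernel γ r) s) s :=
  (((contDiffOn_propKernel γ r).differentiableOn (by simp)).differentiableAt
    (Ioi_mem_nhds hs)).hasDerivAt

theorem continuousOn_deriv_propKernel (γ : ℂ) (r : ℝ) :
    ContinuousOn (deriv (propKernel γ r)) (Ioi 0) :=
  (contDiffOn_propKernel γ r).continuousOn_deriv_of_isOpen isOpen_Ioi le_rfl

theorem measurable_propKernel (γ : ℂ) (r : ℝ) : Measurable (propKernel γ r) := by
  unfold propKernel
  fun_prop

variable {E : Type*} [NormedAddCommGroup E] [NormedSpace ℝ E] [NormedSpace ℂ E]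
  [IsScalarTower ℝ ℂ E]

/-- Derivative of the fractional integral of a function that vanishes near the base point and is
continuously differentiable. -/
theorem hasDerivAt_propInt_of_contDiff {γ : ℂ} (hγ : 0 < γ.re) (r : ℝ) {A d : ℝ} (hAd : A < d) :
    ∃ C, 0 ≤ C ∧ ∀ (v : ℝ → E) (M : ℝ), ContDiff ℝ 1 v → tsupport v ⊆ Ioo A d →
      (∀ s, ‖deriv v s‖ ≤ M) → ∀ t ∈ Ioo A d,
        IntervalIntegrable (fun s => propKernel γ r (t - s) • v s) volume A t ∧
        ∃ D, HasDerivAt (propInt A γ r v) D t ∧ ‖D‖ ≤ C * M := by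
  -- Cutting the kernel off outside (0, d - A] makes it integrable on ℝ. As v vanishes to the left
  -- of A, the fractional integral becomes a convolution k ∗ v on (A, d), and the derivative falls
  -- on v. The constant is the L¹ norm of k.
  set k : ℝ → ℂ := (Ioc 0 (d - A)).indicator (propKernel γ r) with hk
  have hki : Integrable k := by
    rw [integrable_indicator_iff measurableSet_Ioc,
      ← intervalIntegrable_iff_integrableOn_Ioc_of_le (by linarith)]
    exact intervalIntegrable_propKernel hγ r _ _
  refine ⟨∫ s, ‖k s‖, integral_nonneg fun _ => norm_nonneg _, fun v M hv hsupp hM t ht => ?_⟩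
  have hcs : HasCompactSupport v :=
    HasCompactSupport.intro (K := Icc A d) isCompact_Icc fun x hx =>
      image_eq_zero_of_notMem_tsupport fun h => hx (Ioo_subset_Icc_self (hsupp h))
  have hv0 : ∀ x, x ≤ A → v x = 0 := fun x hx =>
    image_eq_zero_of_notMem_tsupport fun h => absurd (hsupp h).1 (not_lt.2 hx)
  set L : ℂ →L[ℝ] E →L[ℝ] E := ContinuousLinearMap.lsmul ℝ ℂ
  have hii : ∀ t, IntervalIntegrable (fun s => propKernel γ r (t - s) • v s) volume A t := by
    intro t
    have h1 := (intervalIntegrable_propKernel hγ r (t - A) (t - t)).comp_sub_left t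
    simp only [sub_sub_cancel] at h1
    exact h1.smul_continuousOn hv.continuous.continuousOn
  have heq : ∀ t ∈ Ioo A d, propInt A γ r v t = (convolution k v L volume) t := by
    intro t ht
    have h1 : propInt A γ r v t = ∫ s in (t - t)..(t - A), propKernel γ r s • v (t - s) := by
      rw [← intervalIntegral.integral_comp_sub_left (fun s => propKernel γ r s • v (t - s)) t]
      simp only [sub_sub_cancel, propInt]
    rw [h1, sub_self, intervalIntegral.integral_of_le (by linarith [ht.1]),
      ← integral_indicator measurableSet_Ioc]
    refine integral_congr_ae (Filter.Eventually.of_forall fun s => ?_)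
    change _ = k s • v (t - s)
    rw [hk]
    by_cases h1 : s ∈ Ioc 0 (t - A)
    · have h2 : s ∈ Ioc 0 (d - A) := ⟨h1.1, h1.2.trans (by linarith [ht.2])⟩
      rw [indicator_of_mem h1, indicator_of_mem h2]
    · rw [indicator_of_notMem h1]
      by_cases h2 : s ∈ Ioc 0 (d - A)
      · have : t - A < s := by
          by_contra h3
          exact h1 ⟨h2.1, not_lt.1 h3⟩
        rw [hv0 _ (by linarith), smul_zero]
      · rw [indicator_of_notMem h2, zero_smul]
  refine ⟨hii t, (convolution k (deriv v) L volume) t, ?_, ?_⟩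
  · refine (hcs.hasDerivAt_convolution_right L hki.locallyIntegrable hv t).congr_of_eventuallyEq ?_
    filter_upwards [isOpen_Ioo.mem_nhds ht] with t ht using heq t ht
  · rw [← integral_mul_const]
    refine norm_integral_le_of_norm_le (hki.norm.mul_const M) (Filter.Eventually.of_forall fun s => ?_)
    change ‖k s • deriv v (t - s)‖ ≤ _
    rw [norm_smul]
    gcongr
    exact hM _

/-- Derivative of the part of the fractional integral away from the singularity. -/
theorem hasDerivAt_integral_propKernel (γ : ℂ) (r : ℝ) {A c t₀ ε : ℝ} (hε : 0 < ε)
    (hAc : A ≤ c) (hc : c + 2 * ε ≤ t₀) :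
    ∃ C, 0 ≤ C ∧ ∀ u : ℝ → E, IntegrableOn u (Ioc A c) → ∀ t ∈ Metric.ball t₀ ε,
      IntervalIntegrable (fun s => propKernel γ r (t - s) • u s) volume A c ∧
      ∃ D, HasDerivAt (fun t => ∫ s in A..c, propKernel γ r (t - s) • u s) D t ∧
        ‖D‖ ≤ C * ∫ s in Ioc A c, ‖u s‖ := by
  -- For t within ε of t₀ and s ≤ c ≤ t₀ - 2ε, the difference t - s stays in this compact subset of
  -- (0, ∞), where the kernel and its derivative are bounded.
  have hsub : Icc ε (t₀ + ε - A) ⊆ Ioi 0 := fun s hs => hε.trans_le hs.1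
  obtain ⟨C, hC⟩ := isCompact_Icc.exists_bound_of_continuousOn
    ((continuousOn_deriv_propKernel γ r).mono hsub)
  obtain ⟨C', hC'⟩ := isCompact_Icc.exists_bound_of_continuousOn
    ((contDiffOn_propKernel γ r).continuousOn.mono hsub)
  have hmem : ∀ t ∈ Metric.ball t₀ ε, ∀ s ∈ Ioc A c, t - s ∈ Icc ε (t₀ + ε - A) := by
    intro t ht s hs
    rw [Metric.mem_ball, Real.dist_eq, abs_lt] at ht
    exact ⟨by linarith [hs.2], by linarith [hs.1]⟩
  have hC0 : 0 ≤ C := (norm_nonneg _).trans (hC ε ⟨le_rfl, by linarith⟩)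
  refine ⟨C, hC0, fun u hu t ht => ?_⟩
  have hκm : ∀ t, AEStronglyMeasurable (fun s => propKernel γ r (t - s)) (volume.restrict (Ioc A c)) :=
    fun t => ((measurable_propKernel γ r).comp (measurable_const.sub measurable_id)).aestronglyMeasurable
  have hint : ∀ t ∈ Metric.ball t₀ ε, IntegrableOn (fun s => propKernel γ r (t - s) • u s) (Ioc A c) := by
    intro t ht
    refine (hu.norm.const_mul C').mono' ((hκm t).smul hu.1) ?_
    filter_upwards [ae_restrict_mem measurableSet_Ioc] with s hs
    rw [norm_smul]
    gcongr
    exact hC' _ (hmem t ht s hs)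
  have hd : ∀ s ∈ Ioc A c, ∀ t ∈ Metric.ball t₀ ε,
      HasDerivAt (fun t => propKernel γ r (t - s) • u s) (deriv (propKernel γ r) (t - s) • u s) t := by
    intro s hs t ht
    have h1 := (hasDerivAt_propKernel γ r (hsub (hmem t ht s hs))).comp_sub_const t s
    exact h1.smul_const (u s)
  have hκ'm : AEStronglyMeasurable (fun s => deriv (propKernel γ r) (t - s) • u s)
      (volume.restrict (Ioc A c)) := by
    refine AEStronglyMeasurable.smul ?_ hu.1
    refine ((measurable_deriv (propKernel γ r)).comp
      (measurable_const.sub measurable_id)).aestronglyMeasurable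
  have key := hasDerivAt_integral_of_dominated_loc_of_deriv_le
    (μ := volume.restrict (Ioc A c)) (F := fun t s => propKernel γ r (t - s) • u s)
    (F' := fun t s => deriv (propKernel γ r) (t - s) • u s) (bound := fun s => C * ‖u s‖)
    (Metric.isOpen_ball.mem_nhds ht)
    (Filter.Eventually.of_forall fun t => (hκm t).smul hu.1) (hint t ht) hκ'm
    (by
      filter_upwards [ae_restrict_mem measurableSet_Ioc] with s hs t ht
      rw [norm_smul]
      gcongr
      exact hC _ (hmem t ht s hs))
    (hu.norm.const_mul C)
    (by
      filter_upwards [ae_restrict_mem measurableSet_Ioc] with s hs t ht using hd s hs t ht)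
  refine ⟨(intervalIntegrable_iff_integrableOn_Ioc_of_le hAc).2 (hint t ht), _,
    by simpa only [intervalIntegral.integral_of_le hAc] using key.2, ?_⟩
  rw [← integral_const_mul]
  refine norm_integral_le_of_norm_le (hu.norm.const_mul C) ?_
  filter_upwards [ae_restrict_mem measurableSet_Ioc] with s hs
  rw [norm_smul]
  gcongr
  exact hC _ (hmem t ht s hs)

end FracPsi
end

/-! ### Local differentiability of fractional integrals, with uniform bounds -/

noncomputable section
namespace FracPsi

variable {E : Type*} [NormedAddCommGroup E] [NormedSpace ℝ E] [NormedSpace ℂ E]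
  [IsScalarTower ℝ ℂ E]

/-- The fractional integral of an integrable function that is continuously differentiable with
bounds near `t₀` is differentiable near `t₀`, with a bound that depends only on these data. -/
theorem exists_hasDerivAt_propInt {γ : ℂ} (hγ : 0 < γ.re) (r : ℝ) {A c t₀ d : ℝ} (hAc : A ≤ c)
    (hc : c < t₀) (hd : t₀ < d) :
    ∃ C ε, 0 ≤ C ∧ 0 < ε ∧ ∀ (h : ℝ → E) (M : ℝ), IntegrableOn h (Ioo A d) →
      ContDiffOn ℝ 1 h (Ioo c d) → (∀ s ∈ Ioo c d, ‖h s‖ ≤ M ∧ ‖deriv h s‖ ≤ M) →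
      ∀ t ∈ Metric.ball t₀ ε,
        IntervalIntegrable (fun s => propKernel γ r (t - s) • h s) volume A t ∧
        ∃ D, HasDerivAt (propInt A γ r h) D t ∧ ‖D‖ ≤ C * (M + ∫ s in Ioo A d, ‖h s‖) := by
  -- A bump function χ, equal to 1 within δ/2 of t₀ and supported within 3δ/4, splits h = χh + (1 -
  -- χ)h. The first part is C¹ on the whole line; the second vanishes near t₀, so the singularity of
  -- the kernel does not meet it.
  set δ := min (t₀ - c) (d - t₀)
  have hδ : 0 < δ := lt_min (by linarith) (by linarith)
  have hδ1 : δ ≤ t₀ - c := min_le_left _ _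
  have hδ2 : δ ≤ d - t₀ := min_le_right _ _
  let χ : ContDiffBump t₀ := ⟨δ / 2, 3 * δ / 4, by positivity, by linarith⟩
  have hχd : ContDiff ℝ 1 (χ : ℝ → ℝ) := χ.contDiff
  have hχsupp : tsupport χ = Metric.closedBall t₀ (3 * δ / 4) := χ.tsupport_eq
  have hball : Metric.closedBall t₀ (3 * δ / 4) ⊆ Ioo c d := by
    intro s hs
    rw [Metric.mem_closedBall, Real.dist_eq, abs_le] at hs
    exact ⟨by linarith, by linarith⟩
  have hχcs : HasCompactSupport (χ : ℝ → ℝ) := χ.hasCompactSupport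
  obtain ⟨B, hB⟩ := hχcs.deriv.exists_bound_of_continuous (hχd.continuous_deriv le_rfl)
  have hB0 : 0 ≤ B := (norm_nonneg _).trans (hB 0)
  obtain ⟨C₁, hC₁, H₁⟩ := hasDerivAt_propInt_of_contDiff (E := E) hγ r (A := A) (d := d) (by linarith)
  -- For t within δ/8 of t₀, the interval between t₀ - δ/4 and t lies where χ = 1, so (1 - χ)h
  -- contributes only up to t₀ - δ/4, and δ/4 = 2 · δ/8 is the distance required.
  obtain ⟨C₂, hC₂, H₂⟩ := hasDerivAt_integral_propKernel (E := E) γ r (A := A) (c := t₀ - δ / 4)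
    (t₀ := t₀) (ε := δ / 8) (by positivity) (by linarith) (by linarith)
  refine ⟨C₁ * (B + 1) + C₂, δ / 8, by positivity, by positivity, fun h M hi hcd hM t ht => ?_⟩
  have hM0 : 0 ≤ M := (norm_nonneg _).trans (hM t₀ ⟨hc, hd⟩).1
  set v : ℝ → E := fun s => χ s • h s with hv
  set u : ℝ → E := fun s => (1 - χ s) • h s with hu
  have hsuppv : tsupport v ⊆ Ioo c d :=
    (closure_mono (Function.support_smul_subset_left _ _)).trans (hχsupp.trans_subset hball)
  have hvd : ContDiff ℝ 1 v := by
    refine contDiff_iff_contDiffAt.2 fun s => ?_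
    by_cases hs : s ∈ tsupport v
    · exact hχd.contDiffAt.smul (hcd.contDiffAt (isOpen_Ioo.mem_nhds (hsuppv hs)))
    · refine (contDiffAt_const (c := (0 : E))).congr_of_eventuallyEq ?_
      exact notMem_tsupport_iff_eventuallyEq.1 hs
  have hvM : ∀ s, ‖deriv v s‖ ≤ (B + 1) * M := by
    intro s
    by_cases hs : s ∈ tsupport v
    · have hs' := hsuppv hs
      have h1 : HasDerivAt h (deriv h s) s :=
        ((hcd.contDiffAt (isOpen_Ioo.mem_nhds hs')).differentiableAt (by simp)).hasDerivAt
      have h2 : HasDerivAt χ (deriv χ s) s := (hχd.differentiable (by simp) s).hasDerivAt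
      rw [show deriv v s = _ from (h2.smul h1).deriv]
      refine (norm_add_le _ _).trans ?_
      rw [norm_smul, norm_smul, Real.norm_of_nonneg χ.nonneg]
      have h3 := χ.le_one (x := s)
      have h4 := hM s hs'
      have h5 := hB s
      have h6 := mul_le_mul h3 h4.2 (norm_nonneg _) zero_le_one
      have h7 := mul_le_mul h5 h4.1 (norm_nonneg _) hB0
      linarith
    · rw [show deriv v s = 0 by
        rw [(notMem_tsupport_iff_eventuallyEq.1 hs).deriv_eq]; exact deriv_const s 0, norm_zero]
      positivity
  have hsubset : Ioc A (t₀ - δ / 4) ⊆ Ioo A d := fun s hs => ⟨hs.1, by linarith [hs.2]⟩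
  have hχ1 : ∀ s, ‖1 - χ s‖ ≤ 1 := fun s => by
    rw [Real.norm_of_nonneg (by linarith [χ.le_one (x := s)])]
    linarith [χ.nonneg (x := s)]
  have hule : ∀ s, ‖u s‖ ≤ ‖h s‖ := fun s => by
    rw [hu, norm_smul]
    exact mul_le_of_le_one_left (norm_nonneg _) (hχ1 s)
  have hui : IntegrableOn u (Ioc A (t₀ - δ / 4)) := by
    have h1 := hi.mono_set hsubset
    refine h1.norm.mono' (AEStronglyMeasurable.smul ?_ h1.1) (Filter.Eventually.of_forall hule)
    exact (continuous_const.sub hχd.continuous).aestronglyMeasurable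
  have hu0 : ∀ t ∈ Metric.ball t₀ (δ / 8), ∀ s ∈ uIcc (t₀ - δ / 4) t, u s = 0 := by
    intro t ht s hs
    rw [Metric.mem_ball, Real.dist_eq, abs_lt] at ht
    rw [uIcc_of_le (by linarith)] at hs
    have : χ s = 1 := χ.one_of_mem_closedBall (by
      rw [Metric.mem_closedBall, Real.dist_eq, abs_le]
      change -(δ / 2) ≤ s - t₀ ∧ s - t₀ ≤ δ / 2
      exact ⟨by linarith [hs.1], by linarith [hs.2]⟩)
    rw [hu]
    simp [this]
  have hIoo : ∀ t ∈ Metric.ball t₀ (δ / 8), t ∈ Ioo A d := by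
    intro t ht
    rw [Metric.mem_ball, Real.dist_eq, abs_lt] at ht
    exact ⟨by linarith, by linarith⟩
  have hsuppA : tsupport v ⊆ Ioo A d := hsuppv.trans (Ioo_subset_Ioo_left hAc)
  have hsplit : ∀ s, h s = v s + u s := fun s => by
    rw [hv, hu, ← add_smul, add_sub_cancel, one_smul]
  have hiv := fun t ht => (H₁ v _ hvd hsuppA hvM t (hIoo t ht)).1
  have hiu : ∀ t ∈ Metric.ball t₀ (δ / 8), IntervalIntegrable
      (fun s => propKernel γ r (t - s) • u s) volume (t₀ - δ / 4) t := fun t ht => by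
    refine (IntervalIntegrable.congr (f := fun _ => (0 : E)) (fun s hs => ?_) intervalIntegrable_const)
    simp only
    rw [hu0 t ht s (uIoc_subset_uIcc hs), smul_zero]
  have hiu' := fun t ht => (H₂ u hui t ht).1.trans (hiu t ht)
  have hfun : ∀ t, (fun s => propKernel γ r (t - s) • h s) = fun s =>
      propKernel γ r (t - s) • v s + propKernel γ r (t - s) • u s := fun t => by
    funext s
    rw [← smul_add, ← hsplit]
  have heq : ∀ t ∈ Metric.ball t₀ (δ / 8), propInt A γ r h t = propInt A γ r v t +
      ∫ s in A..(t₀ - δ / 4), propKernel γ r (t - s) • u s := by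
    intro t ht
    have h0 : ∫ s in (t₀ - δ / 4)..t, propKernel γ r (t - s) • u s = 0 := by
      rw [intervalIntegral.integral_congr (g := fun _ => (0 : E))]
      · simp
      · intro s hs
        simp only
        rw [hu0 t ht s hs, smul_zero]
    rw [propInt, hfun t, intervalIntegral.integral_add (hiv t ht) (hiu' t ht), propInt,
      ← intervalIntegral.integral_add_adjacent_intervals (H₂ u hui t ht).1 (hiu t ht), h0, add_zero]
  obtain ⟨D₁, hD₁, hD₁'⟩ := (H₁ v _ hvd hsuppA hvM t (hIoo t ht)).2
  obtain ⟨D₂, hD₂, hD₂'⟩ := (H₂ u hui t ht).2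
  refine ⟨?_, D₁ + D₂, ?_, ?_⟩
  · rw [hfun t]
    exact (hiv t ht).add (hiu' t ht)
  · refine (hD₁.add hD₂).congr_of_eventuallyEq ?_
    filter_upwards [Metric.isOpen_ball.mem_nhds ht] with t ht using heq t ht
  · have h1 : ∫ s in Ioc A (t₀ - δ / 4), ‖u s‖ ≤ ∫ s in Ioo A d, ‖h s‖ :=
      (integral_mono hui.norm (hi.mono_set hsubset).norm hule).trans
        (setIntegral_mono_set hi.norm (Filter.Eventually.of_forall fun _ => norm_nonneg _)
          hsubset.eventuallyLE)
    have h2 : 0 ≤ ∫ s in Ioo A d, ‖h s‖ := integral_nonneg fun _ => norm_nonneg _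
    calc ‖D₁ + D₂‖ ≤ ‖D₁‖ + ‖D₂‖ := norm_add_le _ _
      _ ≤ C₁ * ((B + 1) * M) + C₂ * ∫ s in Ioo A d, ‖h s‖ := by
          refine add_le_add hD₁' (hD₂'.trans ?_)
          gcongr
      -- Adding the two nonnegative cross terms lets the bound factor as a constant times a sum.
      _ ≤ C₁ * ((B + 1) * M) + C₂ * (∫ s in Ioo A d, ‖h s‖) +
            (C₁ * (B + 1) * (∫ s in Ioo A d, ‖h s‖) + C₂ * M) :=
          le_add_of_nonneg_right (by positivity)
      _ = _ := by ring

end FracPsi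
end

/-! ### Fractional integrals of families depending on a parameter -/

noncomputable section
namespace FracPsi

variable {E : Type*} [NormedAddCommGroup E] [NormedSpace ℝ E] [NormedSpace ℂ E]
  [IsScalarTower ℝ ℂ E] {W : Type*} [MeasurableSpace W] {μ : Measure W}

/-- Fubini for the fractional integral of a family of functions. -/
theorem integrable_propKernel_smul {E' : Type*} [NormedAddCommGroup E'] [NormedSpace ℂ E'] [IsFiniteMeasure μ]
    {γ : ℂ} (hγ : 0 < γ.re) (r : ℝ)
    {A c d M t : ℝ} (hct : c < t) (htd : t < d) (hAc : A ≤ c) {g : W → ℝ → E'}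
    (hg : Integrable (Function.uncurry g) (μ.prod (volume.restrict (Ioo A d))))
    (hgM : ∀ᵐ w ∂μ, ∀ s ∈ Ioo c d, ‖g w s‖ ≤ M) :
    Integrable (fun p : W × ℝ => propKernel γ r (t - p.2) • g p.1 p.2)
      (μ.prod (volume.restrict (Ioc A t))) := by
  -- The two regions are complementary. For s ≤ c the kernel is bounded by C and g is integrable;
  -- for s > c the function g is bounded by M and the kernel is integrable.
  obtain ⟨C, hC⟩ := (isCompact_Icc (a := t - c) (b := t - A)).exists_bound_of_continuousOn
    ((contDiffOn_propKernel γ r).continuousOn.mono fun s hs =>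
      show 0 < s from (sub_pos.2 hct).trans_le hs.1)
  have hg' : Integrable (Function.uncurry g) (μ.prod (volume.restrict (Ioc A t))) :=
    hg.mono_measure (Measure.prod_mono le_rfl (Measure.restrict_mono
      (show Ioc A t ⊆ Ioo A d from fun s hs => ⟨hs.1, hs.2.trans_lt htd⟩) le_rfl))
  have hκ : Integrable (fun s => propKernel γ r (t - s)) (volume.restrict (Ioc A t)) := by
    have h1 := (intervalIntegrable_propKernel hγ r (t - A) (t - t)).comp_sub_left t
    simp only [sub_sub_cancel] at h1
    exact (intervalIntegrable_iff_integrableOn_Ioc_of_le (by linarith)).1 h1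
  have hκ' : Integrable (fun p : W × ℝ => ‖propKernel γ r (t - p.2)‖ * M)
      (μ.prod (volume.restrict (Ioc A t))) := (hκ.norm.mul_const M).comp_snd μ
  refine ((hg'.norm.const_mul C).add hκ').mono' (AEStronglyMeasurable.smul ?_ hg'.1) ?_
  · exact ((measurable_propKernel γ r).comp
      (measurable_const.sub measurable_snd)).aestronglyMeasurable
  · have h1 : ∀ᵐ p ∂(μ.prod (volume.restrict (Ioc A t))), ∀ s ∈ Ioo c d, ‖g p.1 s‖ ≤ M :=
      Measure.quasiMeasurePreserving_fst.ae hgM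
    have h2 : ∀ᵐ p ∂(μ.prod (volume.restrict (Ioc A t))), p.2 ∈ Ioc A t :=
      Measure.quasiMeasurePreserving_snd.ae (ae_restrict_mem measurableSet_Ioc)
    have hM : ∀ᵐ p ∂(μ.prod (volume.restrict (Ioc A t))), 0 ≤ M := by
      filter_upwards [h1] with p hp using (norm_nonneg _).trans (hp t ⟨hct, htd⟩)
    filter_upwards [h1, h2, hM] with p hp1 hp2 hM
    rw [norm_smul]
    change _ ≤ C * ‖g p.1 p.2‖ + ‖propKernel γ r (t - p.2)‖ * M
    have hC0 : 0 ≤ C := (norm_nonneg _).trans (hC (t - c) ⟨le_rfl, by linarith⟩)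
    rcases le_or_gt p.2 c with h | h
    · refine le_add_of_le_of_nonneg ?_ (by positivity)
      gcongr
      exact hC _ ⟨by linarith, by linarith [hp2.1]⟩
    · refine le_add_of_nonneg_of_le (by positivity) ?_
      gcongr
      exact hp1 _ ⟨h, hp2.2.trans_lt htd⟩

theorem integrable_propInt [IsFiniteMeasure μ] {γ : ℂ} (hγ : 0 < γ.re) (r : ℝ)
    {A c d M t : ℝ} (hct : c < t) (htd : t < d) (hAc : A ≤ c) {g : W → ℝ → E}
    (hg : Integrable (Function.uncurry g) (μ.prod (volume.restrict (Ioo A d))))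
    (hgM : ∀ᵐ w ∂μ, ∀ s ∈ Ioo c d, ‖g w s‖ ≤ M) :
    Integrable (fun w => propInt A γ r (g w) t) μ ∧
      ∫ w, propInt A γ r (g w) t ∂μ = propInt A γ r (fun s => ∫ w, g w s ∂μ) t := by
  have h := integrable_propKernel_smul hγ r hct htd hAc hg hgM
  have hAt : A ≤ t := by linarith
  simp only [propInt, intervalIntegral.integral_of_le hAt]
  refine ⟨h.integral_prod_left, ?_⟩
  rw [integral_integral_swap h]
  simp only [integral_smul]

/-- Differentiation of fractional integrals under the integral sign. -/
theorem hasDerivAt_propInt_integral [IsFiniteMeasure μ] {γ : ℂ} (hγ : 0 < γ.re) (r : ℝ)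
    {A c d M t₀ : ℝ} (hc : c < t₀) (hd : t₀ < d) (hAc : A ≤ c) {g : W → ℝ → E}
    (hg : Integrable (Function.uncurry g) (μ.prod (volume.restrict (Ioo A d))))
    (hgd : ∀ᵐ w ∂μ, ContDiffOn ℝ 1 (g w) (Ioo c d))
    (hgM : ∀ᵐ w ∂μ, ∀ s ∈ Ioo c d, ‖g w s‖ ≤ M ∧ ‖deriv (g w) s‖ ≤ M) :
    (∀ᵐ w ∂μ, DifferentiableAt ℝ (propInt A γ r (g w)) t₀) ∧
    Integrable (fun w => deriv (propInt A γ r (g w)) t₀) μ ∧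
    HasDerivAt (propInt A γ r (fun s => ∫ w, g w s ∂μ))
      (∫ w, deriv (propInt A γ r (g w)) t₀ ∂μ) t₀ := by
  -- Here C and ε₀ are chosen before the function, so they serve all members of the family at once.
  obtain ⟨C, ε₀, hC, hε₀, H⟩ := exists_hasDerivAt_propInt (E := E) hγ r hAc hc hd
  set ε := min ε₀ (min (t₀ - c) (d - t₀))
  have hε : 0 < ε := lt_min hε₀ (lt_min (by linarith) (by linarith))
  have hεc : ε ≤ t₀ - c := (min_le_right _ _).trans (min_le_left _ _)
  have hεd : ε ≤ d - t₀ := (min_le_right _ _).trans (min_le_right _ _)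
  have hmem : ∀ t ∈ Metric.ball t₀ ε, c < t ∧ t < d := by
    intro t ht
    rw [Metric.mem_ball, Real.dist_eq, abs_lt] at ht
    exact ⟨by linarith, by linarith⟩
  have hgM' : ∀ᵐ w ∂μ, ∀ s ∈ Ioo c d, ‖g w s‖ ≤ M := by
    filter_upwards [hgM] with w hw s hs using (hw s hs).1
  have hI := fun t ht => integrable_propInt hγ r (hmem t ht).1 (hmem t ht).2 hAc hg hgM'
  have hD : ∀ᵐ w ∂μ, ∀ t ∈ Metric.ball t₀ ε,
      HasDerivAt (propInt A γ r (g w)) (deriv (propInt A γ r (g w)) t) t ∧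
      ‖deriv (propInt A γ r (g w)) t‖ ≤ C * (M + ∫ s in Ioo A d, ‖g w s‖) := by
    filter_upwards [hgd, hgM, hg.prod_right_ae] with w h1 h2 h3 t ht
    obtain ⟨D, hD, hD'⟩ := (H (g w) M h3 h1 h2 t (Metric.ball_subset_ball (min_le_left _ _) ht)).2
    rw [hD.deriv]
    exact ⟨hD, hD'⟩
  have h0 : t₀ ∈ Metric.ball t₀ ε := Metric.mem_ball_self hε
  -- The denominator n + 2 keeps every increment strictly below ε, also for n = 0.
  have hseq : ∀ n : ℕ, 0 < ε / (n + 2) ∧ t₀ + ε / (n + 2) ∈ Metric.ball t₀ ε := by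
    intro n
    have h1 : 0 < ε / (n + 2) := by positivity
    refine ⟨h1, ?_⟩
    rw [Metric.mem_ball, Real.dist_eq, add_sub_cancel_left, abs_of_pos h1]
    exact div_lt_self hε (by linarith [(Nat.cast_nonneg n : (0 : ℝ) ≤ n)])
  have hlim : Filter.Tendsto (fun n : ℕ => ε / (n + 2)) Filter.atTop (nhdsWithin 0 {0}ᶜ) := by
    refine tendsto_nhdsWithin_iff.2 ⟨?_, Filter.Eventually.of_forall fun n => (hseq n).1.ne'⟩
    exact Filter.Tendsto.div_atTop tendsto_const_nhds
      (Filter.tendsto_atTop_add_const_right _ _ tendsto_natCast_atTop_atTop)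
  -- The derivative at t₀ is measurable in w as an almost everywhere limit of difference quotients.
  have hmeas : AEStronglyMeasurable (fun w => deriv (propInt A γ r (g w)) t₀) μ := by
    refine aestronglyMeasurable_of_tendsto_ae Filter.atTop
      (f := fun (n : ℕ) w => (ε / (n + 2))⁻¹ •
        (propInt A γ r (g w) (t₀ + ε / (n + 2)) - propInt A γ r (g w) t₀)) (fun n => ?_) ?_
    · exact ((hI _ (hseq n).2).1.sub (hI _ h0).1).1.const_smul _
    · filter_upwards [hD] with w hw
      exact (hasDerivAt_iff_tendsto_slope_zero.1 (hw t₀ h0).1).comp hlim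
  have key := hasDerivAt_integral_of_dominated_loc_of_deriv_le
    (μ := μ) (F := fun t w => propInt A γ r (g w) t)
    (F' := fun t w => deriv (propInt A γ r (g w)) t)
    (bound := fun w => C * (M + ∫ s in Ioo A d, ‖g w s‖)) (Metric.ball_mem_nhds t₀ hε)
    (by filter_upwards [Metric.ball_mem_nhds t₀ hε] with t ht using (hI t ht).1.1)
    (hI t₀ h0).1 hmeas (by filter_upwards [hD] with w hw t ht using (hw t ht).2)
    (((integrable_const M).add hg.norm.integral_prod_left).const_mul C)
    (by filter_upwards [hD] with w hw t ht using (hw t ht).1)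
  refine ⟨?_, key.1, key.2.congr_of_eventuallyEq ?_⟩
  · filter_upwards [hD] with w hw using (hw t₀ h0).1.differentiableAt
  · filter_upwards [Metric.ball_mem_nhds t₀ hε] with t ht using (hI t ht).2.symm

end FracPsi
end

noncomputable section
namespace FracPsi

/-! ### The semigroup property and the inversion of the fractional integral -/

/-- The modulus of a Beta integrand with complex exponents is the Beta integrand of their real
parts. -/
theorem integral_norm_beta {u v : ℂ} {a : ℝ} (ha : 0 < a) :
    ∫ x in (0 : ℝ)..a, ‖(x : ℂ) ^ (u - 1) * ((a : ℂ) - x) ^ (v - 1)‖ ≤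
      ‖(a : ℂ) ^ ((u.re : ℂ) + v.re - 1) * Complex.betaIntegral u.re v.re‖ := by
  rw [← Complex.betaIntegral_scaled _ _ ha]
  have h : ∫ x in (0 : ℝ)..a, (x : ℂ) ^ ((u.re : ℂ) - 1) * ((a : ℂ) - x) ^ ((v.re : ℂ) - 1) =
      ((∫ x in (0 : ℝ)..a, ‖(x : ℂ) ^ (u - 1) * ((a : ℂ) - x) ^ (v - 1)‖ : ℝ) : ℂ) := by
    rw [← intervalIntegral.integral_ofReal, intervalIntegral.integral_of_le ha.le,
      intervalIntegral.integral_of_le ha.le, integral_Ioc_eq_integral_Ioo,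
      integral_Ioc_eq_integral_Ioo]
    refine setIntegral_congr_fun measurableSet_Ioo fun x hx => ?_
    have h1 : 0 < a - x := by linarith [hx.2]
    rw [← Complex.ofReal_sub, norm_mul, Complex.norm_cpow_eq_rpow_re_of_pos hx.1,
      Complex.norm_cpow_eq_rpow_re_of_pos h1, Complex.ofReal_mul, Complex.ofReal_cpow hx.1.le,
      Complex.ofReal_cpow h1.le]
    simp
  rw [h, Complex.norm_real]
  exact le_abs_self _

/-- The exponentials combine to a function of x + y and r^α r^{1-α} = r. In the composition x + y =
t - τ is fixed, so only a Beta integrand remains under the integral. -/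
theorem propKernel_mul_eq (α : ℂ) {r : ℝ} (hr : 0 < r) (x y : ℝ) :
    propKernel α r x * propKernel (1 - α) r y =
      1 / (r * (Complex.Gamma α * Complex.Gamma (1 - α))) *
        (Real.exp ((r - 1) / r * (x + y)) : ℂ) *
        ((y : ℂ) ^ ((1 - α) - 1) * (x : ℂ) ^ (α - 1)) := by
  have hr' : (r : ℂ) ≠ 0 := by exact_mod_cast hr.ne'
  have h1 : (r : ℂ) = (r : ℂ) ^ α * (r : ℂ) ^ (1 - α) := by
    rw [← Complex.cpow_add _ _ hr', add_sub_cancel, Complex.cpow_one]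
  rw [mul_add, Real.exp_add, Complex.ofReal_mul]
  conv_rhs => rw [h1]
  rw [propKernel, propKernel]
  simp only [one_div, mul_inv]
  ring

variable {α : ℂ} {r : ℝ}

/-- The Beta integral with parameters 1 - α and α equals Γ(1-α)Γ(α), as Γ(1) = 1, and this cancels
the normalizing constants of the two kernels. -/
theorem integral_propKernel_mul (hα : 0 < α.re) (hα' : α.re < 1) (hr : 0 < r) {τ t : ℝ}
    (h : τ < t) :
    ∫ s in τ..t, propKernel α r (t - s) * propKernel (1 - α) r (s - τ) =
      1 / r * (Real.exp ((r - 1) / r * (t - τ)) : ℂ) := by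
  have hβ : 0 < (1 - α).re := by simpa using hα'
  have h1 : ∫ s in τ..t, propKernel α r (t - s) * propKernel (1 - α) r (s - τ) =
      ∫ x in (0 : ℝ)..(t - τ), propKernel α r (t - τ - x) * propKernel (1 - α) r x := by
    have := intervalIntegral.integral_comp_sub_right (a := τ) (b := t)
      (fun x => propKernel α r (t - τ - x) * propKernel (1 - α) r x) τ
    rw [sub_self] at this
    rw [← this]
    simp only [sub_sub_sub_cancel_right]
  rw [h1]
  simp only [propKernel_mul_eq α hr, sub_add_cancel, Complex.ofReal_sub t τ,
    Complex.ofReal_sub (t - τ)]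
  rw [intervalIntegral.integral_const_mul, ← Complex.ofReal_sub,
    Complex.betaIntegral_scaled _ _ (sub_pos.2 h)]
  have h2 := Complex.Gamma_mul_Gamma_eq_betaIntegral hβ hα
  rw [sub_add_cancel, Complex.Gamma_one, one_mul] at h2
  rw [← h2, sub_add_cancel, sub_self, Complex.cpow_zero, one_mul]
  have h3 := Complex.Gamma_ne_zero_of_re_pos hα
  have h4 := Complex.Gamma_ne_zero_of_re_pos hβ
  have hr' : (r : ℂ) ≠ 0 := by exact_mod_cast hr.ne'
  field_simp

theorem intervalIntegrable_propKernel_mul (hα : 0 < α.re) (hα' : α.re < 1) (hr : 0 < r) {τ t : ℝ}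
    (h : τ < t) :
    IntervalIntegrable (fun s => propKernel α r (t - s) * propKernel (1 - α) r (s - τ))
      volume τ t := by
  -- The integral of a non-integrable function is 0 by convention, while the value just computed is
  -- not 0.
  refine intervalIntegral.intervalIntegrable_of_integral_ne_zero ?_
  rw [integral_propKernel_mul hα hα' hr h]
  have hr' : (r : ℂ) ≠ 0 := by exact_mod_cast hr.ne'
  refine mul_ne_zero (one_div_ne_zero hr') ?_
  exact_mod_cast (Real.exp_pos _).ne'

/-- The real parts of the exponents 1 - α and α add to 1, so the scaled Beta integral carries the
power (t - τ)⁰ and its bound does not blow up as τ → t. -/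
theorem exists_integral_norm_propKernel_mul_le (α : ℂ) (hr : 0 < r) (A t : ℝ) :
    ∃ C, ∀ τ ∈ Ioo A t,
      ∫ s in τ..t, ‖propKernel α r (t - s) * propKernel (1 - α) r (s - τ)‖ ≤ C := by
  obtain ⟨B, hB⟩ := (isCompact_Icc (a := A) (b := t)).exists_bound_of_continuousOn
    (f := fun τ => (1 / (r * (Complex.Gamma α * Complex.Gamma (1 - α))) : ℂ) *
        (Real.exp ((r - 1) / r * (t - τ)) : ℂ))
    (Continuous.continuousOn (by fun_prop))
  refine ⟨B * ‖Complex.betaIntegral (1 - α).re α.re‖, fun τ hτ => ?_⟩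
  have h1 : ∫ s in τ..t, ‖propKernel α r (t - s) * propKernel (1 - α) r (s - τ)‖ =
      ∫ x in (0 : ℝ)..(t - τ), ‖propKernel α r (t - τ - x) * propKernel (1 - α) r x‖ := by
    have := intervalIntegral.integral_comp_sub_right (a := τ) (b := t)
      (fun x => ‖propKernel α r (t - τ - x) * propKernel (1 - α) r x‖) τ
    rw [sub_self] at this
    rw [← this]
    simp only [sub_sub_sub_cancel_right]
  rw [h1]
  simp only [propKernel_mul_eq α hr, sub_add_cancel, Complex.ofReal_sub t τ,
    Complex.ofReal_sub (t - τ)]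
  have h0 := hB τ (Ioo_subset_Icc_self hτ)
  set K : ℂ := 1 / (r * (Complex.Gamma α * Complex.Gamma (1 - α))) *
        (Real.exp ((r - 1) / r * (t - τ)) : ℂ)
  simp only [norm_mul K]
  rw [intervalIntegral.integral_const_mul, ← Complex.ofReal_sub]
  have h2 := integral_norm_beta (u := 1 - α) (v := α) (sub_pos.2 hτ.2)
  have h3 : (((1 - α).re : ℝ) : ℂ) + (α.re : ℝ) - 1 = 0 := by
    rw [Complex.sub_re, Complex.one_re]; push_cast; ring
  rw [h3, Complex.cpow_zero, one_mul] at h2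
  have h5 : 0 ≤ ∫ x in (0 : ℝ)..(t - τ),
      ‖(x : ℂ) ^ (1 - α - 1) * (((t - τ : ℝ) : ℂ) - x) ^ (α - 1)‖ :=
    intervalIntegral.integral_nonneg (sub_pos.2 hτ.2).le fun _ _ => norm_nonneg _
  exact mul_le_mul h0 h2 h5 ((norm_nonneg _).trans h0)

end FracPsi
end

noncomputable section
namespace FracPsi

variable {E : Type*} [NormedAddCommGroup E] [NormedSpace ℝ E] [NormedSpace ℂ E]
  {α : ℂ} {r : ℝ}

/-- Interchange the order of integration over the triangle A < τ < s < t; the inner integral is then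
`integral_propKernel_mul`. Fubini is justified because the inner integral of norms is at most a
constant times ‖f τ‖. -/
theorem propInt_propInt (hα : 0 < α.re) (hα' : α.re < 1) (hr : 0 < r) [CompleteSpace E]
    {A t : ℝ} (hAt : A < t) {f : ℝ → E} (hf : IntegrableOn f (Ioo A t)) :
    propInt A α r (propInt A (1 - α) r f) t =
      ∫ s in A..t, (1 / r * (Real.exp ((r - 1) / r * (t - s)) : ℂ)) • f s := by
  set ν : Measure ℝ := volume.restrict (Ioo A t) with hν
  set q : ℝ → ℝ → ℂ := fun τ s => propKernel α r (t - s) * propKernel (1 - α) r (s - τ) with hq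
  set K : ℝ → ℝ → E := fun τ s => if τ < s then q τ s • f τ else 0 with hK
  have hKm : AEStronglyMeasurable (Function.uncurry K) (ν.prod ν) := by
    have h1 : Function.uncurry K = {p : ℝ × ℝ | p.1 < p.2}.indicator
        (fun p => q p.1 p.2 • f p.1) := by
      funext p
      simp only [Function.uncurry, hK, indicator, mem_ofPred_eq]
    rw [h1]
    refine AEStronglyMeasurable.indicator ?_ (measurableSet_lt measurable_fst measurable_snd)
    refine AEStronglyMeasurable.smul (Measurable.aestronglyMeasurable ?_) hf.1.comp_fst
    exact ((measurable_propKernel α r).comp (measurable_const.sub measurable_snd)).mul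
      ((measurable_propKernel _ r).comp (measurable_snd.sub measurable_fst))
  have hset1 : ∀ τ ∈ Ioo A t, Ioo A t ∩ Ioi τ = Ioo τ t := fun τ hτ => by
    ext s
    simp only [mem_inter_iff, mem_Ioo, mem_Ioi]
    exact ⟨fun h => ⟨h.2, h.1.2⟩, fun h => ⟨⟨hτ.1.trans h.1, h.2⟩, h.1⟩⟩
  have hset2 : ∀ s ∈ Ioo A t, Ioo A t ∩ Iio s = Ioo A s := fun s hs => by
    ext τ
    simp only [mem_inter_iff, mem_Ioo, mem_Iio]
    exact ⟨fun h => ⟨h.1.1, h.2⟩, fun h => ⟨⟨h.1, h.2.trans hs.2⟩, h.2⟩⟩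
  have hK1 : ∀ τ, K τ = (Ioi τ).indicator fun s => q τ s • f τ := fun τ => by
    funext s
    simp only [hK, indicator, mem_Ioi]
  have hK2 : ∀ s, (fun τ => K τ s) = (Iio s).indicator fun τ => q τ s • f τ := fun s => by
    funext τ
    simp only [hK, indicator, mem_Iio]
  have hK3 : ∀ τ, (fun s => ‖K τ s‖) = (Ioi τ).indicator fun s => ‖q τ s‖ * ‖f τ‖ := fun τ => by
    funext s
    simp only [hK, indicator, mem_Ioi]
    split_ifs
    · rw [norm_smul]
    · rw [norm_zero]
  have hqi : ∀ τ ∈ Ioo A t, IntegrableOn (q τ) (Ioo τ t) := fun τ hτ =>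
    (intervalIntegrable_iff_integrableOn_Ioo_of_le hτ.2.le).1
      (intervalIntegrable_propKernel_mul hα hα' hr hτ.2)
  obtain ⟨C, hC⟩ := exists_integral_norm_propKernel_mul_le α hr A t
  have hKi : Integrable (Function.uncurry K) (ν.prod ν) := by
    rw [integrable_prod_iff hKm]
    constructor
    · filter_upwards [ae_restrict_mem measurableSet_Ioo] with τ hτ
      change Integrable (K τ) ν
      rw [hK1, integrable_indicator_iff measurableSet_Ioi, IntegrableOn,
        Measure.restrict_restrict measurableSet_Ioi, inter_comm, hset1 τ hτ]
      exact (hqi τ hτ).smul_const (f τ)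
    · refine (hf.norm.const_mul C).mono' hKm.norm.integral_prod_right' ?_
      filter_upwards [ae_restrict_mem measurableSet_Ioo] with τ hτ
      change ‖∫ s, ‖K τ s‖ ∂ν‖ ≤ C * ‖f τ‖
      rw [Real.norm_of_nonneg (integral_nonneg fun _ => norm_nonneg _), hK3,
        setIntegral_indicator measurableSet_Ioi, hset1 τ hτ, integral_mul_const]
      gcongr
      have := hC τ hτ
      rwa [intervalIntegral.integral_of_le hτ.2.le, integral_Ioc_eq_integral_Ioo] at this
  calc propInt A α r (propInt A (1 - α) r f) t = ∫ s, ∫ τ, K τ s ∂ν ∂ν := by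
        rw [propInt, intervalIntegral.integral_of_le hAt.le, integral_Ioc_eq_integral_Ioo]
        refine setIntegral_congr_fun measurableSet_Ioo fun s hs => ?_
        rw [hK2, setIntegral_indicator measurableSet_Iio, hset2 s hs]
        rw [propInt, intervalIntegral.integral_of_le hs.1.le, integral_Ioc_eq_integral_Ioo,
          ← integral_smul]
        simp only [hq, mul_smul]
    _ = ∫ τ, ∫ s, K τ s ∂ν ∂ν := (integral_integral_swap hKi).symm
    _ = _ := by
        rw [intervalIntegral.integral_of_le hAt.le, integral_Ioc_eq_integral_Ioo]
        refine setIntegral_congr_fun measurableSet_Ioo fun τ hτ => ?_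
        rw [hK1, setIntegral_indicator measurableSet_Ioi, hset1 τ hτ, integral_smul_const,
          ← integral_Ioc_eq_integral_Ioo, ← intervalIntegral.integral_of_le hτ.2.le,
          integral_propKernel_mul hα hα' hr hτ.2]

/-- The proportional derivative of the fractional integral of order `α` inverts the fractional
integral of order `1 - α`. -/
theorem hasDerivAt_propInt_propInt [IsScalarTower ℝ ℂ E] (hα : 0 < α.re) (hα' : α.re < 1)
    (hr : 0 < r) [CompleteSpace E] {A d t₀ : ℝ} (ht₀ : t₀ ∈ Ioo A d) {f : ℝ → E}
    (hf : IntegrableOn f (Ioo A d)) (hfc : ContinuousOn f (Ioo A d)) :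
    ∃ D, HasDerivAt (propInt A α r (propInt A (1 - α) r f)) D t₀ ∧
      (1 - r : ℂ) • propInt A α r (propInt A (1 - α) r f) t₀ + (r : ℂ) • D = f t₀ := by
  have hr' : (r : ℂ) ≠ 0 := by exact_mod_cast hr.ne'
  set c : ℝ := (r - 1) / r
  -- Factoring the exponential as e^{ct} e^{-cs} frees the integrand of t, so the fundamental
  -- theorem of calculus applies to I.
  set I : ℝ → E := fun t => ∫ s in A..t, (Real.exp (-(c * s)) : ℂ) • f s with hI
  have heq : ∀ t ∈ Ioo A d, propInt A α r (propInt A (1 - α) r f) t =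
      (1 / r * (Real.exp (c * t) : ℂ)) • I t := by
    intro t ht
    rw [propInt_propInt hα hα' hr ht.1 (hf.mono_set (Ioo_subset_Ioo_right ht.2.le)), hI,
      ← intervalIntegral.integral_smul]
    congr 1
    funext s
    rw [smul_smul, mul_assoc, ← Complex.ofReal_mul, ← Real.exp_add]
    congr 4
    ring
  have hi : IntegrableOn (fun s => (Real.exp (-(c * s)) : ℂ) • f s) (Ioc A t₀) := by
    have h1 : IntervalIntegrable f volume A t₀ :=
      (intervalIntegrable_iff_integrableOn_Ioo_of_le ht₀.1.le).2
        (hf.mono_set (Ioo_subset_Ioo_right ht₀.2.le))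
    refine (intervalIntegrable_iff_integrableOn_Ioc_of_le ht₀.1.le).1
      (h1.continuousOn_smul (Continuous.continuousOn ?_))
    fun_prop
  have hcont : ContinuousOn (fun s => (Real.exp (-(c * s)) : ℂ) • f s) (Ioo A d) :=
    ContinuousOn.smul (Continuous.continuousOn (by fun_prop)) hfc
  have hI' : HasDerivAt I ((Real.exp (-(c * t₀)) : ℂ) • f t₀) t₀ :=
    intervalIntegral.integral_hasDerivAt_right
      ((intervalIntegrable_iff_integrableOn_Ioc_of_le ht₀.1.le).2 hi)
      (hcont.stronglyMeasurableAtFilter isOpen_Ioo t₀ ht₀) (hcont.continuousAt (isOpen_Ioo.mem_nhds ht₀))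
  have he : HasDerivAt (fun t : ℝ => (1 / r * (Real.exp (c * t) : ℂ)))
      (1 / r * ((Real.exp (c * t₀) * c : ℝ) : ℂ)) t₀ := by
    have h1 : HasDerivAt (fun t : ℝ => Real.exp (c * t)) (Real.exp (c * t₀) * c) t₀ := by
      simpa using ((hasDerivAt_id t₀).const_mul c).exp
    exact h1.ofReal_comp.const_mul _
  have hprod := he.smul hI'
  refine ⟨_, hprod.congr_of_eventuallyEq ?_, ?_⟩
  · filter_upwards [isOpen_Ioo.mem_nhds ht₀] with t ht using heq t ht
  · rw [heq t₀ ht₀]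
    have h1 : (Real.exp (c * t₀) : ℂ) * (Real.exp (-(c * t₀)) : ℂ) = 1 := by
      rw [← Complex.ofReal_mul, ← Real.exp_add]; simp
    have hc : (c : ℂ) = (r - 1) / r := by simp [c]
    simp only [smul_add, smul_smul]
    rw [mul_assoc (1 / (r : ℂ)), h1, mul_one, mul_one_div_cancel hr', one_smul, add_left_comm,
      ← add_smul]
    -- The derivative of the factor e^{ct} cancels the zeroth-order term, because rc = r - 1.
    have h2 : (1 - r : ℂ) * (1 / r * (Real.exp (c * t₀) : ℂ)) +
        r * (1 / r * ((Real.exp (c * t₀) * c : ℝ) : ℂ)) = 0 := by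
      rw [Complex.ofReal_mul, hc]
      field_simp
      ring
    rw [h2, zero_smul, add_zero]

end FracPsi
end

noncomputable section
namespace FracPsi

/-! ### Reduction of general scales to the identity -/

/-- A scale on a compact interval extends to a `C¹` diffeomorphism of the real line. -/
theorem exists_orderIso_extension {φ : ℝ → ℝ} {a b : ℝ} (hab : a < b)
    (hφ : ContDiffOn ℝ 1 φ (Icc a b)) (hpos : ∀ t ∈ Icc a b, 0 < derivWithin φ (Icc a b) t) :
    ∃ e : ℝ ≃o ℝ, EqOn φ e (Icc a b) ∧ ContDiff ℝ 1 e ∧ ∀ t, 0 < deriv e t := by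
  have hdc : ContinuousOn (derivWithin φ (Icc a b)) (Icc a b) :=
    hφ.continuousOn_derivWithin (uniqueDiffOn_Icc hab) le_rfl
  -- The derivative is continued by its end values and then integrated. Its minimum on [a, b] is
  -- positive and bounds D from below everywhere, which makes the primitive strictly increasing and
  -- onto ℝ.
  set D : ℝ → ℝ := IccExtend hab.le ((Icc a b).domRestrict (derivWithin φ (Icc a b))) with hD
  have hDc : Continuous D := hdc.domRestrict.Icc_extend'
  have hDeq : ∀ t ∈ Icc a b, D t = derivWithin φ (Icc a b) t := fun t ht => by
    rw [hD, IccExtend_of_mem _ _ ht]; rfl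
  obtain ⟨x, hx, hxm⟩ := isCompact_Icc.exists_isMinOn (nonempty_Icc.2 hab.le) hdc
  set m := derivWithin φ (Icc a b) x
  have hm : 0 < m := hpos x hx
  have hDm : ∀ t, m ≤ D t := fun t => hxm (projIcc a b hab.le t).2
  set Φ : ℝ → ℝ := fun t => φ a + ∫ s in a..t, D s with hΦ
  have hΦd : ∀ t, HasDerivAt Φ (D t) t := fun t =>
    (intervalIntegral.integral_hasDerivAt_right (hDc.intervalIntegrable _ _)
      hDc.aestronglyMeasurable.stronglyMeasurableAtFilter hDc.continuousAt).const_add _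
  have hΦ' : deriv Φ = D := funext fun t => (hΦd t).deriv
  have hdiff : Differentiable ℝ Φ := fun t => (hΦd t).differentiableAt
  have hmono : StrictMono Φ := strictMono_of_deriv_pos fun t => by
    rw [hΦ']; exact hm.trans_le (hDm t)
  have hgrow : ∀ s t, s ≤ t → m * (t - s) ≤ Φ t - Φ s :=
    fun s t hst =>
    mul_sub_le_image_sub_of_le_deriv hdiff (fun u => by rw [hΦ']; exact hDm u) hst
  have htop : Filter.Tendsto Φ Filter.atTop Filter.atTop := by
    refine Filter.tendsto_atTop_mono' _ (f₁ := fun t => m * t + Φ 0) ?_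
      (Filter.tendsto_atTop_add_const_right _ _ (Filter.tendsto_id.const_mul_atTop hm))
    filter_upwards [Filter.eventually_ge_atTop 0] with t ht
    have := hgrow 0 t ht
    linarith
  have hbot : Filter.Tendsto Φ Filter.atBot Filter.atBot := by
    refine Filter.tendsto_atBot_mono' _ (f₁ := fun t => m * t + Φ 0) ?_
      (Filter.tendsto_atBot_add_const_right _ _ (Filter.tendsto_id.const_mul_atBot hm))
    filter_upwards [Filter.eventually_le_atBot 0] with t ht
    have := hgrow t 0 ht
    linarith
  refine ⟨hmono.orderIsoOfSurjective Φ (hdiff.continuous.surjective htop hbot), ?_, ?_, ?_⟩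
  · intro t ht
    change φ t = φ a + ∫ s in a..t, D s
    rw [intervalIntegral.integral_eq_sub_of_hasDerivAt_of_le (f := φ) ht.1
      (hφ.continuousOn.mono (Icc_subset_Icc_right ht.2)) ?_ (hDc.intervalIntegrable _ _)]
    · ring
    · intro s hs
      have hs' : s ∈ Ioo a b := ⟨hs.1, hs.2.trans_le ht.2⟩
      rw [hDeq s (Ioo_subset_Icc_self hs')]
      exact ((hφ.differentiableOn (by simp)) s
        (Ioo_subset_Icc_self hs')).hasDerivWithinAt.hasDerivAt (Icc_mem_nhds hs'.1 hs'.2)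
  · change ContDiff ℝ 1 Φ
    exact contDiff_one_iff_deriv.2 ⟨hdiff, by rw [hΦ']; exact hDc⟩
  · intro t
    change 0 < deriv Φ t
    rw [hΦ']
    exact hm.trans_le (hDm t)

theorem contDiff_orderIso_symm {e : ℝ ≃o ℝ} (he : ContDiff ℝ 1 e) (hpos : ∀ t, 0 < deriv e t) :
    ContDiff ℝ 1 e.symm := by
  have hc : Continuous e.symm := e.symm.continuous
  have hd : ∀ s, HasDerivAt e.symm (deriv e (e.symm s))⁻¹ s := fun s =>
    HasDerivAt.of_local_left_inverse hc.continuousAt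
      ((he.differentiable (by simp)) (e.symm s)).hasDerivAt (hpos _).ne'
      (Filter.Eventually.of_forall fun y => e.apply_symm_apply y)
  refine contDiff_one_iff_deriv.2 ⟨fun s => (hd s).differentiableAt, ?_⟩
  rw [funext fun s => (hd s).deriv]
  exact ((he.continuous_deriv le_rfl).comp hc).inv₀ fun s => (hpos _).ne'

section scale

variable {φ : ℝ → ℝ} {a b : ℝ} {e : ℝ ≃o ℝ} {γ : ℂ} {r t : ℝ}

theorem deriv_eq_of_eqOn_Icc (hφe : EqOn φ e (Icc a b)) (ht : t ∈ Ioo a b) :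
    deriv φ t = deriv e t :=
  Filter.EventuallyEq.deriv_eq
    (Filter.eventuallyEq_of_mem (Icc_mem_nhds ht.1 ht.2) hφe)

/-- Substitute s = e(τ). At interior points φ and e have the same derivative, and it is absorbed by
the change of variables. -/
theorem fracInt_eq_propInt (hφe : EqOn φ e (Icc a b)) (he : ContDiff ℝ 1 e)
    (hpos : ∀ t, 0 < deriv e t) (h : ℝ → ℂ) (ht : t ∈ Ioo a b) :
    fracInt a γ r φ h t = propInt (e a) γ r (fun s => h (e.symm s)) (e t) := by
  have himg : Ioo (e a) (e t) = e '' Ioo a t := (e.image_Ioo a t).symm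
  rw [propInt, intervalIntegral.integral_of_le (e.monotone ht.1.le), integral_Ioc_eq_integral_Ioo,
    himg, integral_image_eq_integral_abs_deriv_smul measurableSet_Ioo
      (fun x _ => ((he.differentiable (by simp)) x).hasDerivAt.hasDerivWithinAt)
      e.injective.injOn, fracInt, intervalIntegral.integral_of_le ht.1.le,
    integral_Ioc_eq_integral_Ioo, ← integral_const_mul]
  refine setIntegral_congr_fun measurableSet_Ioo fun τ hτ => ?_
  have hτ' : τ ∈ Ioo a b := ⟨hτ.1, hτ.2.trans ht.2⟩
  rw [deriv_eq_of_eqOn_Icc hφe hτ', hφe (Ioo_subset_Icc_self hτ'), hφe (Ioo_subset_Icc_self ht),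
    abs_of_pos (hpos τ), e.symm_apply_apply, propKernel, Complex.real_smul, smul_eq_mul]
  ring

/-- By the chain rule the derivative in t carries the factor e'(t), which the division by φ'(t) in
`propDeriv` removes. -/
theorem fracDeriv_eq (hφe : EqOn φ e (Icc a b)) (he : ContDiff ℝ 1 e)
    (hpos : ∀ t, 0 < deriv e t) {h : ℝ → ℂ} (ht : t ∈ Ioo a b) {D : ℂ}
    (hD : HasDerivAt (propInt (e a) (1 - γ) r (fun s => h (e.symm s))) D (e t)) :
    fracDeriv a γ r φ h t =
      (1 - r) * propInt (e a) (1 - γ) r (fun s => h (e.symm s)) (e t) + r * D := by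
  have h1 : HasDerivAt (fracInt a (1 - γ) r φ h) (deriv e t • D) t := by
    have h2 := hD.scomp t ((he.differentiable (by simp)) t).hasDerivAt
    refine h2.congr_of_eventuallyEq ?_
    filter_upwards [isOpen_Ioo.mem_nhds ht] with s hs using fracInt_eq_propInt hφe he hpos h hs
  have h3 : ((deriv e t : ℝ) : ℂ) ≠ 0 := by exact_mod_cast (hpos t).ne'
  rw [fracDeriv, propDeriv, h1.deriv, fracInt_eq_propInt hφe he hpos h ht,
    deriv_eq_of_eqOn_Icc hφe ht, Complex.real_smul, mul_div_cancel_left₀ _ h3]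

theorem propInt_clm {E F : Type*} [NormedAddCommGroup E] [NormedSpace ℝ E] [NormedSpace ℂ E]
    [NormedAddCommGroup F] [NormedSpace ℝ F] [NormedSpace ℂ F] [IsScalarTower ℝ ℂ E]
    [IsScalarTower ℝ ℂ F] [CompleteSpace E] [CompleteSpace F] (ℓ : E →L[ℂ] F) {A : ℝ} {h : ℝ → E}
    (hi : IntervalIntegrable (fun s => propKernel γ r (t - s) • h s) volume A t) :
    propInt A γ r (fun s => ℓ (h s)) t = ℓ (propInt A γ r h t) := by
  rw [propInt, propInt]
  have := (ℓ.restrictScalars ℝ).intervalIntegral_comp_comm hi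
  rw [ContinuousLinearMap.coe_restrictScalars'] at this
  rw [← this]
  simp only [map_smul]

theorem fracIntQ_eq (hφe : EqOn φ e (Icc a b)) (he : ContDiff ℝ 1 e)
    (hpos : ∀ t, 0 < deriv e t) {h : ℝ → ℍ[ℂ]} (ht : t ∈ Ioo a b)
    (hi : IntervalIntegrable (fun s => propKernel γ r (e t - s) • h (e.symm s)) volume (e a) (e t)) :
    fracIntQ a γ r φ h t = propInt (e a) γ r (fun s => h (e.symm s)) (e t) :=
  coordwise_eq fun ℓ => by rw [fracInt_eq_propInt hφe he hpos _ ht, propInt_clm ℓ hi]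

theorem fracDerivQ_eq (hφe : EqOn φ e (Icc a b)) (he : ContDiff ℝ 1 e)
    (hpos : ∀ t, 0 < deriv e t) {h : ℝ → ℍ[ℂ]} (ht : t ∈ Ioo a b) {D : ℍ[ℂ]}
    (hi : ∀ᶠ u in nhds (e t), IntervalIntegrable
      (fun s => propKernel (1 - γ) r (u - s) • h (e.symm s)) volume (e a) u)
    (hD : HasDerivAt (propInt (e a) (1 - γ) r (fun s => h (e.symm s))) D (e t)) :
    fracDerivQ a γ r φ h t =
      (1 - r : ℂ) • propInt (e a) (1 - γ) r (fun s => h (e.symm s)) (e t) + (r : ℂ) • D :=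
  coordwise_eq fun ℓ => by
    have h1 : HasDerivAt (propInt (e a) (1 - γ) r (fun s => ℓ (h (e.symm s)))) (ℓ D) (e t) := by
      refine ((ℓ.restrictScalars ℝ).hasFDerivAt.comp_hasDerivAt (e t) hD).congr_of_eventuallyEq ?_
      filter_upwards [hi] with u hu using propInt_clm ℓ hu
    rw [fracDeriv_eq hφe he hpos ht h1, propInt_clm ℓ hi.self_of_nhds]
    simp

end scale

end FracPsi
end

noncomputable section
namespace FracPsi

/-! ### The kernel on the faces of the box -/

variable {a b : Fin 3 → ℝ}

theorem exists_norm_cq_kernel_le {ψ : Fin 3 → ℍ[ℝ]} (hψ : IsStructuralSet ψ) :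
    ∃ C, 0 ≤ C ∧ ∀ z, ‖cq (kernel ψ z)‖ ≤ C * (sqNorm z)⁻¹ := by
  refine ⟨‖cqL‖ * (4 * Real.pi)⁻¹, by positivity, fun z => ?_⟩
  have h1 : ‖embed ψ z‖ ^ 2 = sqNorm z := by
    rw [← hψ.normSq_embed, Quaternion.normSq_eq_norm_mul_self, sq]
  have h2 : ‖kernel ψ z‖ ≤ (4 * Real.pi)⁻¹ * (sqNorm z)⁻¹ := by
    rw [kernel, norm_smul, norm_star, norm_inv, Real.norm_of_nonneg (by positivity), ← h1]
    rcases eq_or_ne ‖embed ψ z‖ 0 with h | h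
    · rw [h]; simp
    · refine le_of_eq ?_
      field_simp
  calc ‖cq (kernel ψ z)‖ ≤ ‖cqL‖ * ‖kernel ψ z‖ := cqL.le_opNorm _
    _ ≤ ‖cqL‖ * ((4 * Real.pi)⁻¹ * (sqNorm z)⁻¹) := by gcongr
    _ = _ := (mul_assoc _ _ _).symm

theorem contDiffAt_cq_kernel {ψ : Fin 3 → ℍ[ℝ]} (hψ : IsStructuralSet ψ) {z : Fin 3 → ℝ}
    (hz : z ≠ 0) : ContDiffAt ℝ 1 (fun z => cq (kernel ψ z)) z := by
  have h : 0 < sqNorm z + 0 := by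
    have := sqNorm_sub_pos hz
    simpa using this
  have h1 : ContDiffAt ℝ 1 (regKernel ψ 0) z := (contDiffAt_regKernel ψ h).of_le (by simp)
  simp only [hψ.kernel_eq]
  exact cqL.contDiff.contDiffAt.comp z h1

theorem intervalIntegrable_abs_rpow (p q : ℝ) :
    IntervalIntegrable (fun x : ℝ => |x| ^ (-(2 / 3) : ℝ)) volume p q := by
  have h := (intervalIntegral.intervalIntegrable_cpow' (a := p) (b := q)
    (r := ((-(2 / 3) : ℝ) : ℂ)) (by rw [Complex.ofReal_re]; norm_num)).norm
  refine h.congr fun x _ => ?_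
  simp only [Complex.norm_cpow_real, Complex.norm_real, Real.norm_eq_abs]

theorem integrableOn_abs_sub_rpow (p q x : ℝ) :
    IntegrableOn (fun s : ℝ => |s - x| ^ (-(2 / 3) : ℝ)) (Icc p q) := by
  rcases le_or_gt p q with h | h
  · rw [integrableOn_Icc_iff_integrableOn_Ioc, ← intervalIntegrable_iff_integrableOn_Ioc_of_le h]
    have h1 := (intervalIntegrable_abs_rpow (p - x) (q - x)).comp_sub_right x
    simpa using h1
  · rw [Icc_eq_empty (not_le.2 h)]
    exact integrableOn_empty

theorem integrableOn_prod_abs_sub_rpow (p q x : Fin 2 → ℝ) :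
    IntegrableOn (fun w : Fin 2 → ℝ => ∏ j, |w j - x j| ^ (-(2 / 3) : ℝ)) (Icc p q) := by
  rw [IntegrableOn, ← pi_univ_Icc, volume_pi, Measure.restrict_pi_pi]
  exact Integrable.fintype_prod (f := fun j s => |s - x j| ^ (-(2 / 3) : ℝ))
    fun j => integrableOn_abs_sub_rpow _ _ _

/-- Split N⁻¹ into three factors N^{-1/3} and bound each by one coordinate. This majorizes |z|⁻² by
a product of one-variable powers of exponent -2/3 > -1, each locally integrable. -/
theorem inv_le_rpow_mul_prod {N p : ℝ} {q : Fin 2 → ℝ} (hp : 0 < p) (hq : ∀ j, 0 < q j)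
    (hpN : p ^ 2 ≤ N) (hqN : ∀ j, q j ^ 2 ≤ N) :
    N⁻¹ ≤ (∏ j, q j ^ (-(2 / 3) : ℝ)) * p ^ (-(2 / 3) : ℝ) := by
  have hN : 0 < N := lt_of_lt_of_le (by positivity) hpN
  have key : ∀ t, 0 < t → t ^ 2 ≤ N → N ^ (-(1 / 3) : ℝ) ≤ t ^ (-(2 / 3) : ℝ) := by
    intro t ht htN
    calc N ^ (-(1 / 3) : ℝ) ≤ (t ^ 2) ^ (-(1 / 3) : ℝ) :=
          Real.rpow_le_rpow_of_nonpos (by positivity) htN (by norm_num)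
      _ = _ := by
          rw [← Real.rpow_natCast, ← Real.rpow_mul ht.le]; norm_num
  have h1 : N⁻¹ = (N ^ (-(1 / 3) : ℝ) * N ^ (-(1 / 3) : ℝ)) * N ^ (-(1 / 3) : ℝ) := by
    rw [← Real.rpow_add hN, ← Real.rpow_add hN, ← Real.rpow_neg_one]; norm_num
  rw [h1, Fin.prod_univ_two]
  have h0 : 0 ≤ N ^ (-(1 / 3) : ℝ) := Real.rpow_nonneg hN.le _
  have hq' : ∀ j, 0 ≤ q j ^ (-(2 / 3) : ℝ) := fun j => Real.rpow_nonneg (hq j).le _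
  exact mul_le_mul (mul_le_mul (key _ (hq 0) (hqN 0)) (key _ (hq 1) (hqN 1)) h0 (hq' 0))
    (key _ hp hpN) h0 (mul_nonneg (hq' 0) (hq' 1))

section face

variable {x : Fin 3 → ℝ} {i : Fin 3} {e : ℝ ≃o ℝ}

theorem continuous_update_symm (x : Fin 3 → ℝ) (i : Fin 3) (e : ℝ ≃o ℝ) :
    Continuous fun s => Function.update x i (e.symm s) :=
  continuous_const.update i e.symm.continuous

theorem continuous_face_sub (x : Fin 3 → ℝ) (i k : Fin 3) (c : ℝ) (e : ℝ ≃o ℝ) :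
    Continuous fun p : (Fin 2 → ℝ) × ℝ =>
      (k.insertNth c p.1 : Fin 3 → ℝ) - Function.update x i (e.symm p.2) :=
  ((continuous_insertNth k c).comp continuous_fst).sub
    ((continuous_update_symm x i e).comp continuous_snd)

theorem symm_mem_Ioo {s p q : ℝ} (hs : s ∈ Ioo (e p) (e q)) : e.symm s ∈ Ioo p q :=
  ⟨e.lt_symm_apply.2 hs.1, e.symm_apply_lt.2 hs.2⟩

theorem symm_mem_Icc {s p q : ℝ} (hs : s ∈ Icc (e p) (e q)) : e.symm s ∈ Icc p q :=
  ⟨e.le_symm_apply.2 hs.1, e.symm_apply_le.2 hs.2⟩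

theorem ae_mem_prod {p q : Fin 2 → ℝ} {A B : ℝ} :
    ∀ᵐ z ∂((volume.restrict (Icc p q)).prod (volume.restrict (Ioo A B))),
      z.1 ∈ Icc p q ∧ z.2 ∈ Ioo A B := by
  rw [Measure.prod_restrict]
  exact ae_restrict_mem (measurableSet_Icc.prod measurableSet_Ioo)

/-- The poles approach only the face x_i = a_i, and only at the lower end of the segment; there
`inv_le_rpow_mul_prod` gives an integrable majorant. The opposite face is kept away by d < b_i, and
on the remaining faces the k-th coordinate of the difference is a nonzero constant. -/
theorem integrable_inv_sqNorm_face (hx : x ∈ box a b) (he : ContDiff ℝ 1 e)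
    {d : ℝ} (hxd : x i < d) (hdb : d < b i) {k : Fin 3} {c : ℝ} (hc : c = a k ∨ c = b k) :
    Integrable (fun p : (Fin 2 → ℝ) × ℝ =>
        (sqNorm ((k.insertNth c p.1 : Fin 3 → ℝ) - Function.update x i (e.symm p.2)))⁻¹)
      ((volume.restrict (Icc (a ∘ k.succAbove) (b ∘ k.succAbove))).prod
        (volume.restrict (Ioo (e (a i)) (e d)))) := by
  have hmeas : AEStronglyMeasurable (fun p : (Fin 2 → ℝ) × ℝ =>
        (sqNorm ((k.insertNth c p.1 : Fin 3 → ℝ) - Function.update x i (e.symm p.2)))⁻¹)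
      ((volume.restrict (Icc (a ∘ k.succAbove) (b ∘ k.succAbove))).prod
        (volume.restrict (Ioo (e (a i)) (e d)))) :=
    ((contDiff_sqNorm.continuous.comp
      (continuous_face_sub x i k c e)).measurable.inv).aestronglyMeasurable
  have hbdd : ∀ δ : ℝ, 0 < δ → (∀ s ∈ Ioo (e (a i)) (e d), ∀ w : Fin 2 → ℝ,
      δ ≤ sqNorm ((k.insertNth c w : Fin 3 → ℝ) - Function.update x i (e.symm s))) →
      Integrable (fun p : (Fin 2 → ℝ) × ℝ =>
        (sqNorm ((k.insertNth c p.1 : Fin 3 → ℝ) - Function.update x i (e.symm p.2)))⁻¹)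
      ((volume.restrict (Icc (a ∘ k.succAbove) (b ∘ k.succAbove))).prod
        (volume.restrict (Ioo (e (a i)) (e d)))) := by
    intro δ hδ h
    have : IsFiniteMeasure (volume.restrict (Icc (a ∘ k.succAbove) (b ∘ k.succAbove))) :=
      ⟨by rw [Measure.restrict_apply_univ]; exact isCompact_Icc.measure_lt_top⟩
    refine (integrable_const δ⁻¹).mono' hmeas ?_
    filter_upwards [ae_mem_prod] with p hp
    rw [Real.norm_of_nonneg (inv_nonneg.2 (sqNorm_nonneg _))]
    exact inv_anti₀ hδ (h _ hp.2 _)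
  have hxk := hx k trivial
  by_cases hki : k = i
  · subst hki
    rcases hc with rfl | rfl
    · obtain ⟨L, hL⟩ := (isCompact_Icc (a := a k) (b := d)).exists_bound_of_continuousOn
        (he.continuous_deriv le_rfl).continuousOn
      -- The segment is parametrized by s = e(t). The Lipschitz bound for e converts the distance t
      -- - a_k to the face into a multiple of s - e(a_k); the added 1 keeps the constant positive.
      have hlip : ∀ s ∈ Ioo (e (a k)) (e d), s - e (a k) ≤ (|L| + 1) * (e.symm s - a k) := by
        intro s hs
        have hs' := symm_mem_Ioo hs
        have h1 := (convex_Icc (a k) d).norm_image_sub_le_of_norm_deriv_le (f := e)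
          (fun t _ => (he.differentiable (by simp)) t) hL
          (left_mem_Icc.2 (hs'.1.trans hs'.2).le) (Ioo_subset_Icc_self hs')
        rw [e.apply_symm_apply, Real.norm_of_nonneg (by linarith [hs.1]),
          Real.norm_of_nonneg (by linarith [hs'.1])] at h1
        refine h1.trans (mul_le_mul_of_nonneg_right ?_ (by linarith [hs'.1]))
        linarith [le_abs_self L]
      set m := (|L| + 1)
      have hm : 0 < m := by positivity
      have hprod := (integrableOn_prod_abs_sub_rpow (a ∘ k.succAbove) (b ∘ k.succAbove)
        (x ∘ k.succAbove)).mul_prod (((integrableOn_abs_sub_rpow (e (a k)) (e d) (e (a k))).mono_set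
          Ioo_subset_Icc_self).const_mul ((m⁻¹) ^ (-(2 / 3) : ℝ)))
      refine hprod.mono' hmeas ?_
      -- At w_j = x_j the majorant is worthless, since a negative real power of 0 is 0 by
      -- convention. These w form a null set.
      have hne : ∀ j, ∀ᵐ p ∂((volume.restrict (Icc (a ∘ k.succAbove) (b ∘ k.succAbove))).prod
          (volume.restrict (Ioo (e (a k)) (e d)))), p.1 j ≠ (x ∘ k.succAbove) j := fun j =>
        Measure.quasiMeasurePreserving_fst.ae (ae_restrict_of_ae
          (Measure.ae_eval_ne (μ := fun _ : Fin 2 => (volume : Measure ℝ)) j _))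
      filter_upwards [ae_mem_prod, hne 0, hne 1] with p hp h0 h1
      rw [Real.norm_of_nonneg (inv_nonneg.2 (sqNorm_nonneg _))]
      have hs' := symm_mem_Ioo hp.2
      have hsA : 0 < p.2 - e (a k) := by linarith [hp.2.1]
      rw [abs_of_pos hsA, ← Real.mul_rpow (by positivity) hsA.le]
      refine inv_le_rpow_mul_prod (by positivity) (fun j => ?_) ?_ (fun j => ?_)
      · have : p.1 j ≠ (x ∘ k.succAbove) j := by fin_cases j <;> assumption
        exact abs_pos.2 (sub_ne_zero.2 this)
      · refine le_trans ?_ (sq_le_sqNorm _ k)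
        rw [Pi.sub_apply, Fin.insertNth_apply_same, Function.update_self, sub_sq_comm (a k)]
        have h2 : m⁻¹ * (p.2 - e (a k)) ≤ e.symm p.2 - a k :=
          (inv_mul_le_iff₀ hm).2 (hlip _ hp.2)
        gcongr
      · rw [sq_abs]
        refine le_of_eq_of_le ?_ (sq_le_sqNorm _ (k.succAbove j))
        rw [Pi.sub_apply, Fin.insertNth_apply_succAbove,
          Function.update_of_ne (Fin.succAbove_ne k j), Function.comp]
    · refine hbdd ((b k - d) ^ 2) (by have := sub_pos.2 hdb; positivity) fun s hs w => ?_
      refine le_trans ?_ (sq_le_sqNorm _ k)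
      rw [Pi.sub_apply, Fin.insertNth_apply_same, Function.update_self]
      have := (symm_mem_Ioo hs).2
      have := sub_pos.2 hdb
      gcongr
  · have hck : c - x k ≠ 0 := by
      rcases hc with rfl | rfl
      · exact (sub_neg.2 hxk.1).ne
      · exact (sub_pos.2 hxk.2).ne'
    refine hbdd ((c - x k) ^ 2) (by positivity) fun s hs w => ?_
    refine le_of_eq_of_le ?_ (sq_le_sqNorm _ k)
    rw [Pi.sub_apply, Fin.insertNth_apply_same, Function.update_of_ne hki]

end face

end FracPsi
end

/-! ### The kernel as a family in the pole, indexed by the points of a face -/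

noncomputable section
namespace FracPsi

variable {a b x : Fin 3 → ℝ} {i k : Fin 3} {e : ℝ ≃o ℝ} {c : ℝ} {ψ : Fin 3 → ℍ[ℝ]}

/-- The kernel with pole on a segment parallel to an axis, as a family of functions of the pole
indexed by the points of a face. -/
def faceFamily (ψ : Fin 3 → ℍ[ℝ]) (x : Fin 3 → ℝ) (i : Fin 3) (e : ℝ ≃o ℝ) (k : Fin 3) (c : ℝ)
    (S : (Fin 2 → ℝ) → ℍ[ℂ] →L[ℂ] ℍ[ℂ]) (ε : ℝ → ℝ) (w : Fin 2 → ℝ) (s : ℝ) : ℍ[ℂ] :=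
  S w (ε s • cq (kernel ψ ((k.insertNth c w : Fin 3 → ℝ) - Function.update x i (e.symm s))))

theorem face_sub_ne_zero (hx : x ∈ box a b) (hc : c = a k ∨ c = b k) (w : Fin 2 → ℝ) {s : ℝ}
    (hs : s ∈ Ioo (e (a i)) (e (b i))) :
    (k.insertNth c w : Fin 3 → ℝ) - Function.update x i (e.symm s) ≠ 0 :=
  sub_ne_zero.2 (insertNth_ne_of_mem_box (update_mem_box hx (symm_mem_Ioo hs)) hc w)

theorem continuousOn_cq_kernel_face (hψ : IsStructuralSet ψ) (hx : x ∈ box a b)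
    (hc : c = a k ∨ c = b k) :
    ContinuousOn (fun p : (Fin 2 → ℝ) × ℝ =>
        cq (kernel ψ ((k.insertNth c p.1 : Fin 3 → ℝ) - Function.update x i (e.symm p.2))))
      (univ ×ˢ Ioo (e (a i)) (e (b i))) := by
  have h : ContDiffOn ℝ 1 (fun z => cq (kernel ψ z)) {0}ᶜ := fun z hz =>
    (contDiffAt_cq_kernel hψ hz).contDiffWithinAt
  exact h.continuousOn.comp
    (continuous_face_sub x i k c e).continuousOn fun p hp => face_sub_ne_zero hx hc p.1 hp.2

theorem continuousOn_fderiv_cq_kernel_face (hψ : IsStructuralSet ψ) (hx : x ∈ box a b)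
    (hc : c = a k ∨ c = b k) :
    ContinuousOn (fun p : (Fin 2 → ℝ) × ℝ => fderiv ℝ (fun z => cq (kernel ψ z))
        ((k.insertNth c p.1 : Fin 3 → ℝ) - Function.update x i (e.symm p.2)))
      (univ ×ˢ Ioo (e (a i)) (e (b i))) := by
  have h : ContDiffOn ℝ 1 (fun z => cq (kernel ψ z)) {0}ᶜ := fun z hz =>
    (contDiffAt_cq_kernel hψ hz).contDiffWithinAt
  exact (h.continuousOn_fderiv_of_isOpen isOpen_compl_singleton le_rfl).comp
    (continuous_face_sub x i k c e).continuousOn fun p hp => face_sub_ne_zero hx hc p.1 hp.2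

variable {S : (Fin 2 → ℝ) → ℍ[ℂ] →L[ℂ] ℍ[ℂ]} {ε : ℝ → ℝ}

theorem continuousOn_faceFamily (hψ : IsStructuralSet ψ) (hx : x ∈ box a b)
    (hc : c = a k ∨ c = b k) (hS : ContinuousOn S (Icc (a ∘ k.succAbove) (b ∘ k.succAbove)))
    (hε : ContinuousOn ε (Ioo (e (a i)) (e (b i)))) :
    ContinuousOn (Function.uncurry (faceFamily ψ x i e k c S ε))
      (Icc (a ∘ k.succAbove) (b ∘ k.succAbove) ×ˢ Ioo (e (a i)) (e (b i))) := by
  refine ContinuousOn.clm_apply (hS.comp continuousOn_fst fun p hp => hp.1) ?_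
  exact (hε.comp continuousOn_snd fun p hp => hp.2).smul
    ((continuousOn_cq_kernel_face hψ hx hc).mono (prod_mono_left (subset_univ _)))

theorem hasDerivAt_faceFamily (hψ : IsStructuralSet ψ) (hx : x ∈ box a b)
    (hc : c = a k ∨ c = b k) (he : ContDiff ℝ 1 e.symm)
    (hε : ContDiffOn ℝ 1 ε (Ioo (e (a i)) (e (b i)))) (w : Fin 2 → ℝ) {s : ℝ}
    (hs : s ∈ Ioo (e (a i)) (e (b i))) :
    HasDerivAt (faceFamily ψ x i e k c S ε w)
      (S w (ε s • (fderiv ℝ (fun z => cq (kernel ψ z))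
        ((k.insertNth c w : Fin 3 → ℝ) - Function.update x i (e.symm s))
          (-(deriv e.symm s • Pi.single i 1))) + deriv ε s •
        cq (kernel ψ ((k.insertNth c w : Fin 3 → ℝ) - Function.update x i (e.symm s))))) s := by
  have h1 : HasDerivAt (fun s => Function.update x i (e.symm s))
      (deriv e.symm s • (Pi.single i 1 : Fin 3 → ℝ)) s :=
    (hasDerivAt_update x i (e.symm s)).scomp s ((he.differentiable (by simp)) s).hasDerivAt
  have h2 := h1.const_sub (k.insertNth c w : Fin 3 → ℝ)
  have h3 := ((contDiffAt_cq_kernel hψ (face_sub_ne_zero hx hc w hs)).differentiableAt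
    (by simp)).hasFDerivAt.comp_hasDerivAt s h2
  have h4 : HasDerivAt ε (deriv ε s) s :=
    ((hε.contDiffAt (isOpen_Ioo.mem_nhds hs)).differentiableAt (by simp)).hasDerivAt
  exact ((S w).restrictScalars ℝ).hasFDerivAt.comp_hasDerivAt s (h4.smul h3)

theorem contDiffOn_faceFamily (hψ : IsStructuralSet ψ) (hx : x ∈ box a b)
    (hc : c = a k ∨ c = b k) (he : ContDiff ℝ 1 e.symm)
    (hε : ContDiffOn ℝ 1 ε (Ioo (e (a i)) (e (b i)))) (w : Fin 2 → ℝ) :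
    ContDiffOn ℝ 1 (faceFamily ψ x i e k c S ε w) (Ioo (e (a i)) (e (b i))) := by
  refine ((S w).restrictScalars ℝ).contDiff.comp_contDiffOn (hε.smul fun s hs => ?_)
  have h1 : ContDiff ℝ 1 (fun s => Function.update x i (e.symm s)) :=
    (contDiff_update 1 x i).comp he
  exact ((contDiffAt_cq_kernel hψ (face_sub_ne_zero hx hc w hs)).comp s
    (contDiff_const.sub h1).contDiffAt).contDiffWithinAt

/-- For s in the compact interval [p, q] the pole stays in the open box, away from the face. The
function and its derivative in s are then continuous on a compact product, which gives one bound for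
all w. -/
theorem exists_bound_faceFamily (hψ : IsStructuralSet ψ) (hx : x ∈ box a b)
    (hc : c = a k ∨ c = b k) (he : ContDiff ℝ 1 e.symm)
    (hS : ContinuousOn S (Icc (a ∘ k.succAbove) (b ∘ k.succAbove)))
    (hε : ContDiffOn ℝ 1 ε (Ioo (e (a i)) (e (b i)))) {p q : ℝ} (hp : e (a i) < p)
    (hq : q < e (b i)) :
    ∃ M, ∀ w ∈ Icc (a ∘ k.succAbove) (b ∘ k.succAbove), ∀ s ∈ Ioo p q,
      ‖faceFamily ψ x i e k c S ε w s‖ ≤ M ∧ ‖deriv (faceFamily ψ x i e k c S ε w) s‖ ≤ M := by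
  have hsub : Icc p q ⊆ Ioo (e (a i)) (e (b i)) := fun s hs =>
    ⟨hp.trans_le hs.1, hs.2.trans_lt hq⟩
  have hsub' : Icc (a ∘ k.succAbove) (b ∘ k.succAbove) ×ˢ Icc p q ⊆
      Icc (a ∘ k.succAbove) (b ∘ k.succAbove) ×ˢ Ioo (e (a i)) (e (b i)) := prod_mono_right hsub
  have hsub'' : Icc (a ∘ k.succAbove) (b ∘ k.succAbove) ×ˢ Icc p q ⊆
      univ ×ˢ Ioo (e (a i)) (e (b i)) := prod_mono (subset_univ _) hsub
  have hcpt : IsCompact (Icc (a ∘ k.succAbove) (b ∘ k.succAbove) ×ˢ Icc p q) :=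
    isCompact_Icc.prod isCompact_Icc
  obtain ⟨M₀, hM₀⟩ := hcpt.exists_bound_of_continuousOn
    ((continuousOn_faceFamily hψ hx hc hS hε.continuousOn).mono hsub')
  have hder : ContinuousOn (fun z : (Fin 2 → ℝ) × ℝ => (S z.1 (ε z.2 •
        (fderiv ℝ (fun z => cq (kernel ψ z))
        ((k.insertNth c z.1 : Fin 3 → ℝ) - Function.update x i (e.symm z.2))
          (-(deriv e.symm z.2 • Pi.single i 1))) + deriv ε z.2 •
        cq (kernel ψ ((k.insertNth c z.1 : Fin 3 → ℝ) - Function.update x i (e.symm z.2))))))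
      (Icc (a ∘ k.succAbove) (b ∘ k.succAbove) ×ˢ Icc p q) := by
    have hε0 := hε.continuousOn.comp (continuousOn_snd (s := Icc (a ∘ k.succAbove)
      (b ∘ k.succAbove) ×ˢ Icc p q)) fun z hz => hsub hz.2
    have hε1 := (hε.continuousOn_deriv_of_isOpen isOpen_Ioo le_rfl).comp
      (continuousOn_snd (s := Icc (a ∘ k.succAbove) (b ∘ k.succAbove) ×ˢ Icc p q))
      fun z hz => hsub hz.2
    have he1 : Continuous fun z : (Fin 2 → ℝ) × ℝ =>
        (-(deriv e.symm z.2 • (Pi.single i 1 : Fin 3 → ℝ))) :=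
      (((he.continuous_deriv le_rfl).comp continuous_snd).smul continuous_const).neg
    refine ContinuousOn.clm_apply (hS.comp continuousOn_fst fun z hz => hz.1) ?_
    exact (hε0.smul (((continuousOn_fderiv_cq_kernel_face hψ hx hc).mono hsub'').clm_apply
      he1.continuousOn)).add (hε1.smul ((continuousOn_cq_kernel_face hψ hx hc).mono hsub''))
  obtain ⟨M₁, hM₁⟩ := hcpt.exists_bound_of_continuousOn hder
  refine ⟨max M₀ M₁, fun w hw s hs => ⟨?_, ?_⟩⟩
  · exact (hM₀ (w, s) ⟨hw, Ioo_subset_Icc_self hs⟩).trans (le_max_left _ _)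
  · rw [(hasDerivAt_faceFamily hψ hx hc he hε w (hsub (Ioo_subset_Icc_self hs))).deriv]
    exact (hM₁ (w, s) ⟨hw, Ioo_subset_Icc_self hs⟩).trans (le_max_right _ _)

theorem integrable_faceFamily (hψ : IsStructuralSet ψ) (hx : x ∈ box a b)
    (hc : c = a k ∨ c = b k) (he : ContDiff ℝ 1 e)
    (hS : ContinuousOn S (Icc (a ∘ k.succAbove) (b ∘ k.succAbove)))
    (hε : ContinuousOn ε (Ioo (e (a i)) (e (b i)))) {B : ℝ}
    (hB : ∀ s ∈ Ioo (e (a i)) (e (b i)), |ε s| ≤ B) {d : ℝ} (hxd : x i < d) (hdb : d < b i) :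
    Integrable (Function.uncurry (faceFamily ψ x i e k c S ε))
      ((volume.restrict (Icc (a ∘ k.succAbove) (b ∘ k.succAbove))).prod
        (volume.restrict (Ioo (e (a i)) (e d)))) := by
  obtain ⟨C, hC0, hC⟩ := exists_norm_cq_kernel_le hψ
  obtain ⟨M, hM⟩ := isCompact_Icc.exists_bound_of_continuousOn hS
  have hsub : Ioo (e (a i)) (e d) ⊆ Ioo (e (a i)) (e (b i)) :=
    Ioo_subset_Ioo_right (e.monotone hdb.le)
  refine ((integrable_inv_sqNorm_face hx he hxd hdb hc).const_mul (M * (B * C))).mono' ?_ ?_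
  · rw [Measure.prod_restrict]
    exact ((continuousOn_faceFamily hψ hx hc hS hε).mono
      (prod_mono_right hsub)).aestronglyMeasurable (measurableSet_Icc.prod measurableSet_Ioo)
  · filter_upwards [ae_mem_prod] with p hp
    have h1 := hM p.1 hp.1
    have h2 := hB p.2 (hsub hp.2)
    have hM0 := (norm_nonneg _).trans h1
    have hB0 := (abs_nonneg _).trans h2
    refine ((S p.1).le_opNorm _).trans ?_
    rw [norm_smul, mul_assoc M]
    refine mul_le_mul h1 ?_ (by positivity) hM0
    rw [mul_assoc]
    exact mul_le_mul h2 (hC _) (norm_nonneg _) hB0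

end FracPsi
end

/-! ### A calculus for existing proportional derivatives -/

noncomputable section
namespace FracPsi

/-- The proportional derivative at `t` of the proportional integral of `h` of order `γ` exists
and has the value `v`. -/
def HasPropDeriv {E : Type*} [NormedAddCommGroup E] [NormedSpace ℝ E] [NormedSpace ℂ E]
    (A : ℝ) (γ : ℂ) (r : ℝ) (h : ℝ → E) (v : E) (t : ℝ) : Prop :=
  (∀ᶠ u in nhds t, IntervalIntegrable (fun s => propKernel γ r (u - s) • h s) volume A u) ∧
    ∃ D, HasDerivAt (propInt A γ r h) D t ∧
      v = (1 - r : ℂ) • propInt A γ r h t + (r : ℂ) • D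

namespace HasPropDeriv

variable {E : Type*} [NormedAddCommGroup E] [NormedSpace ℝ E] [NormedSpace ℂ E]
  {A r t : ℝ} {γ : ℂ} {h h' : ℝ → E} {v v' : E}

theorem unique (H : HasPropDeriv A γ r h v t) (H' : HasPropDeriv A γ r h v' t) : v = v' := by
  obtain ⟨-, D, hD, rfl⟩ := H
  obtain ⟨-, D', hD', rfl⟩ := H'
  rw [hD.unique hD']

/-- Near t the fractional integral uses only values on (A, d), so behaviour at the base point and
beyond d is irrelevant. -/
theorem congr (H : HasPropDeriv A γ r h v t) {d : ℝ} (hA : A < t) (hd : t < d)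
    (hh : EqOn h h' (Ioo A d)) : HasPropDeriv A γ r h' v t := by
  obtain ⟨hi, D, hD, rfl⟩ := H
  have hn : ∀ᶠ u in nhds t, u ∈ Ioo A d := Ioo_mem_nhds hA hd
  have hsub : ∀ {u}, u ∈ Ioo A d → ∀ s ∈ Ioc A u, h s = h' s := fun hu s hs =>
    hh ⟨hs.1, hs.2.trans_lt hu.2⟩
  have heq : ∀ u ∈ Ioo A d, propInt A γ r h' u = propInt A γ r h u := fun u hu => by
    simp only [propInt, intervalIntegral.integral_of_le hu.1.le]
    exact setIntegral_congr_fun measurableSet_Ioc fun s hs => by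
      simp only [hsub hu s hs]
  refine ⟨?_, D, hD.congr_of_eventuallyEq (hn.mono heq), by rw [heq t ⟨hA, hd⟩]⟩
  filter_upwards [hi, hn] with u hu hu'
  refine hu.congr fun s hs => ?_
  rw [uIoc_of_le hu'.1.le] at hs
  simp only [hsub hu' s hs]

theorem clm [IsScalarTower ℝ ℂ E] [CompleteSpace E] {E' : Type*} [NormedAddCommGroup E']
    [NormedSpace ℝ E'] [NormedSpace ℂ E'] [IsScalarTower ℝ ℂ E'] [CompleteSpace E']
    (H : HasPropDeriv A γ r h v t) (ℓ : E →L[ℂ] E') :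
    HasPropDeriv A γ r (fun s => ℓ (h s)) (ℓ v) t := by
  obtain ⟨hi, D, hD, rfl⟩ := H
  have heq := hi.mono fun u hu => propInt_clm ℓ hu
  refine ⟨hi.mono fun u hu => ?_, ℓ D,
    ((ℓ.restrictScalars ℝ).hasFDerivAt.comp_hasDerivAt t hD).congr_of_eventuallyEq heq, ?_⟩
  · simp only [← map_smul]
    exact ⟨(ℓ.restrictScalars ℝ).integrable_comp hu.1, (ℓ.restrictScalars ℝ).integrable_comp hu.2⟩
  · rw [heq.self_of_nhds, map_add, map_smul, map_smul]

theorem add (H : HasPropDeriv A γ r h v t) (H' : HasPropDeriv A γ r h' v' t) :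
    HasPropDeriv A γ r (fun s => h s + h' s) (v + v') t := by
  obtain ⟨hi, D, hD, rfl⟩ := H
  obtain ⟨hi', D', hD', rfl⟩ := H'
  have heq : ∀ᶠ u in nhds t, propInt A γ r (fun s => h s + h' s) u =
      propInt A γ r h u + propInt A γ r h' u := by
    filter_upwards [hi, hi'] with u hu hu'
    simp only [propInt, smul_add]
    exact intervalIntegral.integral_add hu hu'
  refine ⟨?_, D + D', (hD.add hD').congr_of_eventuallyEq heq, ?_⟩
  · filter_upwards [hi, hi'] with u hu hu'
    simp only [smul_add]
    exact hu.add hu'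
  · rw [heq.self_of_nhds]
    module

theorem neg (H : HasPropDeriv A γ r h v t) : HasPropDeriv A γ r (fun s => -h s) (-v) t := by
  obtain ⟨hi, D, hD, rfl⟩ := H
  have heq : ∀ u, propInt A γ r (fun s => -h s) u = -propInt A γ r h u := fun u => by
    simp [propInt]
  refine ⟨?_, -D, by rw [funext heq]; exact hD.neg, ?_⟩
  · filter_upwards [hi] with u hu
    simp only [smul_neg]
    exact hu.neg
  · rw [heq]
    module

theorem sub (H : HasPropDeriv A γ r h v t) (H' : HasPropDeriv A γ r h' v' t) :
    HasPropDeriv A γ r (fun s => h s - h' s) (v - v') t := by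
  simpa only [sub_eq_add_neg] using H.add H'.neg

theorem sum {ι : Type*} (S : Finset ι) {h : ι → ℝ → E} {v : ι → E}
    (H : ∀ j ∈ S, HasPropDeriv A γ r (h j) (v j) t) :
    HasPropDeriv A γ r (fun s => ∑ j ∈ S, h j s) (∑ j ∈ S, v j) t := by
  induction S using Finset.cons_induction with
  | empty =>
    have h0 : propInt A γ r (fun _ => (0 : E)) = fun _ => 0 := by
      ext u
      simp [propInt]
    refine ⟨by simp, 0, ?_, by simp [h0]⟩
    simpa [h0] using hasDerivAt_const t (0 : E)
  | cons j S hj ih =>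
    simp only [Finset.sum_cons]
    exact (H j (Finset.mem_cons_self j S)).add
      (ih fun i hi => H i (Finset.mem_cons_of_mem hi))

theorem fracDerivQ_eq {φ : ℝ → ℝ} {a b : ℝ} {e : ℝ ≃o ℝ} {t : ℝ} {h : ℝ → ℍ[ℂ]} {v : ℍ[ℂ]}
    (H : HasPropDeriv (e a) γ r (fun s => h (e.symm s)) v (e t))
    (hφe : EqOn φ e (Icc a b)) (he : ContDiff ℝ 1 e)
    (hpos : ∀ t, 0 < deriv e t) (ht : t ∈ Ioo a b) :
    fracDerivQ a (1 - γ) r φ h t = v := by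
  obtain ⟨hi, D, hD, rfl⟩ := H
  -- The derivative of order 1 - γ is built on the integral of order 1 - (1 - γ) = γ.
  rw [← sub_sub_cancel 1 γ] at hi hD
  rw [FracPsi.fracDerivQ_eq hφe he hpos ht hi hD, sub_sub_cancel]

end HasPropDeriv

variable {E : Type*} [NormedAddCommGroup E] [NormedSpace ℝ E] [NormedSpace ℂ E]
  {A c d t r : ℝ} {γ : ℂ}

theorem exists_hasPropDeriv (hγ : 0 < γ.re) (r : ℝ) (hAc : A ≤ c) (hc : c < t) (hd : t < d)
    {h : ℝ → E} {M : ℝ} (hi : IntegrableOn h (Ioo A d)) (hh : ContDiffOn ℝ 1 h (Ioo c d))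
    (hM : ∀ s ∈ Ioo c d, ‖h s‖ ≤ M ∧ ‖deriv h s‖ ≤ M) :
    HasPropDeriv A γ r h ((1 - r : ℂ) • propInt A γ r h t +
      (r : ℂ) • deriv (propInt A γ r h) t) t := by
  obtain ⟨C, ε, -, hε, H⟩ := exists_hasDerivAt_propInt (E := E) hγ r hAc hc hd
  obtain ⟨D, hD, -⟩ := (H h M hi hh hM t (Metric.mem_ball_self hε)).2
  refine ⟨?_, _, hD, by rw [hD.deriv]⟩
  filter_upwards [Metric.ball_mem_nhds t hε] with u hu
  exact (H h M hi hh hM u hu).1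

theorem exists_hasPropDeriv_integral {W : Type*} [MeasurableSpace W] {μ : Measure W}
    [IsFiniteMeasure μ] [IsScalarTower ℝ ℂ E] [CompleteSpace E] (hγ : 0 < γ.re) (r : ℝ) {M : ℝ}
    (hAc : A ≤ c) (hc : c < t) (hd : t < d) {g : W → ℝ → E}
    (hg : Integrable (Function.uncurry g) (μ.prod (volume.restrict (Ioo A d))))
    (hgd : ∀ᵐ w ∂μ, ContDiffOn ℝ 1 (g w) (Ioo c d))
    (hgM : ∀ᵐ w ∂μ, ∀ s ∈ Ioo c d, ‖g w s‖ ≤ M ∧ ‖deriv (g w) s‖ ≤ M) :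
    ∃ v : W → E, (∀ᵐ w ∂μ, HasPropDeriv A γ r (g w) (v w) t) ∧ Integrable v μ ∧
      HasPropDeriv A γ r (fun s => ∫ w, g w s ∂μ) (∫ w, v w ∂μ) t := by
  have hgM' : ∀ᵐ w ∂μ, ∀ s ∈ Ioo c d, ‖g w s‖ ≤ M :=
    hgM.mono fun w hw s hs => (hw s hs).1
  obtain ⟨h1, h2⟩ := integrable_propInt hγ r hc hd hAc hg hgM'
  obtain ⟨-, h3, h4⟩ := hasDerivAt_propInt_integral hγ r hc hd hAc hg hgd hgM
  refine ⟨fun w => (1 - r : ℂ) • propInt A γ r (g w) t + (r : ℂ) • deriv (propInt A γ r (g w)) t,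
    ?_, (h1.smul _).add (h3.smul _), ?_, _, h4, ?_⟩
  · filter_upwards [hgd, hgM, hg.prod_right_ae] with w hw hw' hi
    exact exists_hasPropDeriv hγ r hAc hc hd hi hw hw'
  · filter_upwards [Ioo_mem_nhds hc hd] with u hu
    rw [intervalIntegrable_iff_integrableOn_Ioc_of_le (hAc.trans hu.1.le)]
    have h5 := (integrable_propKernel_smul hγ r hu.1 hu.2 hAc hg hgM').integral_prod_right
    simp only [integral_smul] at h5
    exact h5
  · refine (integral_add (h1.smul (1 - r : ℂ)) (h3.smul (r : ℂ))).trans ?_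
    simp only [Pi.smul_apply, integral_smul, h2]

end FracPsi
end

/-! ### Proportional derivatives of boundary integrals with weighted kernel -/

noncomputable section
namespace FracPsi

variable {a b x : Fin 3 → ℝ} {i : Fin 3} {e : ℝ ≃o ℝ} {ψ : Fin 3 → ℍ[ℝ]}
  {l : Fin 3 → (Fin 3 → ℝ) → ℝ}

/-- The Cauchy kernel with exponential weight. -/
def weightedKernel (ψ : Fin 3 → ℍ[ℝ]) (l : Fin 3 → (Fin 3 → ℝ) → ℝ) (ζ z : Fin 3 → ℝ) : ℍ[ℂ] :=
  cq (Real.exp (∑ k, (l k ζ - l k z)) • kernel ψ (ζ - z))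

/-- The weight e^{Λ(ζ) - Λ(z)} splits into a factor in ζ, put into the operator S, and a scalar in
the pole z, put into ε. -/
theorem faceFamily_eq_weightedKernel (k : Fin 3) (c : ℝ)
    (T : (Fin 3 → ℝ) → ℍ[ℂ] →L[ℂ] ℍ[ℂ]) (w : Fin 2 → ℝ) (s : ℝ) :
    faceFamily ψ x i e k c
      (fun w => Real.exp (∑ j, l j (k.insertNth c w)) • T (k.insertNth c w))
      (fun s => Real.exp (-∑ j, l j (Function.update x i (e.symm s)))) w s =
    T (k.insertNth c w) (weightedKernel ψ l (k.insertNth c w) (Function.update x i (e.symm s))) := by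
  have hT : ∀ (u : ℝ) (q : ℍ[ℂ]), T (k.insertNth c w) (u • q) = u • T (k.insertNth c w) q :=
    fun u q => ((T (k.insertNth c w)).restrictScalars ℝ).map_smul u q
  simp only [faceFamily, weightedKernel, cq_smul, _root_.smul_apply, hT, smul_smul,
    ← Real.exp_add, ← sub_eq_add_neg, Finset.sum_sub_distrib]

variable {γ : ℂ} {r : ℝ}

theorem exists_weight_bounds (he : ContDiff ℝ 1 e.symm) (hx : x ∈ box a b)
    (hl : ∀ k, ContDiffOn ℝ 1 (l k) (Icc a b)) :
    ContDiffOn ℝ 1 (fun s => Real.exp (-∑ j, l j (Function.update x i (e.symm s))))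
      (Ioo (e (a i)) (e (b i))) ∧ ∃ B, ∀ s ∈ Ioo (e (a i)) (e (b i)),
        |Real.exp (-∑ j, l j (Function.update x i (e.symm s)))| ≤ B := by
  have h : ContDiffOn ℝ 1 (fun s => Real.exp (-∑ j, l j (Function.update x i (e.symm s))))
      (Icc (e (a i)) (e (b i))) := by
    refine Real.contDiff_exp.comp_contDiffOn (ContDiffOn.neg (ContDiffOn.sum fun j _ => ?_))
    exact (hl j).comp ((contDiff_update 1 x i).comp he).contDiffOn fun s hs =>
      update_mem_Icc (box_subset_Icc hx) (symm_mem_Icc hs)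
  obtain ⟨B, hB⟩ := isCompact_Icc.exists_bound_of_continuousOn h.continuousOn
  exact ⟨h.mono Ioo_subset_Icc_self, B, fun s hs => hB s (Ioo_subset_Icc_self hs)⟩

/-- The operator T stands for multiplication by the boundary data from either side, so that one
argument covers the left and the right formula. -/
theorem exists_hasPropDeriv_face (hab : ∀ i, a i < b i) (hψ : IsStructuralSet ψ)
    (hl : ∀ k, ContDiffOn ℝ 1 (l k) (Icc a b)) (hx : x ∈ box a b) (hγ : 0 < γ.re) (r : ℝ)
    (he : ContDiff ℝ 1 e) (he' : ContDiff ℝ 1 e.symm) (k : Fin 3) {c : ℝ}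
    (hc : c = a k ∨ c = b k) (T : (Fin 3 → ℝ) → ℍ[ℂ] →L[ℂ] ℍ[ℂ])
    (hT : ContinuousOn T (Icc a b)) :
    ∃ v : (Fin 2 → ℝ) → ℍ[ℂ],
      (∀ᵐ w ∂(volume.restrict (Icc (a ∘ k.succAbove) (b ∘ k.succAbove))),
        HasPropDeriv (e (a i)) γ r (fun s => T (k.insertNth c w) (weightedKernel ψ l
          (k.insertNth c w) (Function.update x i (e.symm s)))) (v w) (e (x i))) ∧
      IntegrableOn v (Icc (a ∘ k.succAbove) (b ∘ k.succAbove)) ∧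
      HasPropDeriv (e (a i)) γ r
        (fun s => ∫ w in Icc (a ∘ k.succAbove) (b ∘ k.succAbove), T (k.insertNth c w)
          (weightedKernel ψ l (k.insertNth c w) (Function.update x i (e.symm s))))
        (∫ w in Icc (a ∘ k.succAbove) (b ∘ k.succAbove), v w) (e (x i)) := by
  have hxi : x i ∈ Ioo (a i) (b i) := hx i (mem_univ i)
  -- On (p, q) around x_i the uniform C¹ bounds hold; on (a_i, q) only integrability is available,
  -- and this suffices.
  obtain ⟨p, hp, hpx⟩ := exists_between hxi.1
  obtain ⟨q, hxq, hq⟩ := exists_between hxi.2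
  obtain ⟨hε, B, hB⟩ := exists_weight_bounds (i := i) he' hx hl
  have hS : ContinuousOn
      (fun w : Fin 2 → ℝ => Real.exp (∑ j, l j (k.insertNth c w)) • T (k.insertNth c w))
      (Icc (a ∘ k.succAbove) (b ∘ k.succAbove)) := by
    have hm : MapsTo (fun w : Fin 2 → ℝ => (k.insertNth c w : Fin 3 → ℝ))
      (Icc (a ∘ k.succAbove) (b ∘ k.succAbove)) (Icc a b) := fun w hw => insertNth_mem_Icc hab hc hw
    have hi := (continuous_insertNth k c).continuousOn
      (s := Icc (a ∘ k.succAbove) (b ∘ k.succAbove))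
    refine ContinuousOn.smul (Real.continuous_exp.comp_continuousOn
      (continuousOn_finsetSum _ fun j _ => ((hl j).continuousOn.comp hi hm))) (hT.comp hi hm)
  obtain ⟨M, hM⟩ := exists_bound_faceFamily (i := i) hψ hx hc he' hS hε (e.strictMono hp)
    (e.strictMono hq)
  have hpq : Ioo (e p) (e q) ⊆ Ioo (e (a i)) (e (b i)) :=
    Ioo_subset_Ioo (e.monotone hp.le) (e.monotone hq.le)
  have : IsFiniteMeasure (volume.restrict (Icc (a ∘ k.succAbove) (b ∘ k.succAbove))) :=
    ⟨by rw [Measure.restrict_apply_univ]; exact isCompact_Icc.measure_lt_top⟩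
  have key := exists_hasPropDeriv_integral hγ r (e.monotone hp.le) (e.strictMono hpx)
    (e.strictMono hxq) (integrable_faceFamily hψ hx hc he hS hε.continuousOn hB hxq hq)
    (Filter.Eventually.of_forall fun w => (contDiffOn_faceFamily hψ hx hc he' hε w).mono hpq)
    ((ae_restrict_mem measurableSet_Icc).mono hM)
  rwa [show faceFamily ψ x i e k c _ _ = _ from
    funext fun w => funext fun s => faceFamily_eq_weightedKernel k c T w s] at key

/-- Differentiation of a boundary integral with weighted Cauchy kernel under the integral sign. -/
theorem bInt_fracDerivQ (hab : ∀ i, a i < b i) (hψ : IsStructuralSet ψ)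
    (hl : ∀ k, ContDiffOn ℝ 1 (l k) (Icc a b)) (hx : x ∈ box a b) (hγ : 0 < γ.re) (r : ℝ)
    {φ : ℝ → ℝ} (hφe : EqOn φ e (Icc (a i) (b i)))
    (he : ContDiff ℝ 1 e) (hpos : ∀ t, 0 < deriv e t)
    (T : Fin 3 → (Fin 3 → ℝ) → ℍ[ℂ] →L[ℂ] ℍ[ℂ])
    (hT : ∀ k, ContinuousOn (T k) (Icc a b)) {P : (Fin 3 → ℝ) → ℍ[ℂ]}
    (hP : ∀ z ∈ box a b, bInt a b (fun k ζ => T k ζ (weightedKernel ψ l ζ z)) = P z) :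
    FaceIntegrable a b (fun k ζ => T k ζ
      (fracDerivQ (a i) (1 - γ) r φ (line (weightedKernel ψ l ζ) x i) (x i))) ∧
    HasPropDeriv (e (a i)) γ r (fun s => P (Function.update x i (e.symm s)))
      (bInt a b (fun k ζ => T k ζ
        (fracDerivQ (a i) (1 - γ) r φ (line (weightedKernel ψ l ζ) x i) (x i)))) (e (x i)) := by
  have hxi : x i ∈ Ioo (a i) (b i) := hx i (mem_univ i)
  have he' := contDiff_orderIso_symm he hpos
  have key : ∀ k c, c = a k ∨ c = b k →
      IntegrableOn (fun w => T k (k.insertNth c w) (fracDerivQ (a i) (1 - γ) r φ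
        (line (weightedKernel ψ l (k.insertNth c w)) x i) (x i)))
        (Icc (a ∘ k.succAbove) (b ∘ k.succAbove)) ∧
      HasPropDeriv (e (a i)) γ r
        (fun s => ∫ w in Icc (a ∘ k.succAbove) (b ∘ k.succAbove), T k (k.insertNth c w)
          (weightedKernel ψ l (k.insertNth c w) (Function.update x i (e.symm s))))
        (∫ w in Icc (a ∘ k.succAbove) (b ∘ k.succAbove), T k (k.insertNth c w)
          (fracDerivQ (a i) (1 - γ) r φ
            (line (weightedKernel ψ l (k.insertNth c w)) x i) (x i))) (e (x i)) := by
    intro k c hc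
    -- Taking T to be the identity gives, for almost every ζ on the face, the proportional
    -- derivative of the kernel alone. By linearity and uniqueness the value for the given T is then
    -- T applied to it.
    obtain ⟨v₀, hv₀, -, -⟩ := exists_hasPropDeriv_face (i := i) hab hψ hl hx hγ r he he' k hc
      (fun _ => ContinuousLinearMap.id ℂ ℍ[ℂ]) continuousOn_const
    obtain ⟨v, hv, hvi, hvd⟩ := exists_hasPropDeriv_face (i := i) hab hψ hl hx hγ r he he' k hc
      (T k) (hT k)
    have heq : ∀ᵐ w ∂(volume.restrict (Icc (a ∘ k.succAbove) (b ∘ k.succAbove))), v w =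
        T k (k.insertNth c w) (fracDerivQ (a i) (1 - γ) r φ
          (line (weightedKernel ψ l (k.insertNth c w)) x i) (x i)) := by
      filter_upwards [hv₀, hv] with w hw₀ hw
      have h1 : HasPropDeriv (e (a i)) γ r
        (fun s => line (weightedKernel ψ l (k.insertNth c w)) x i (e.symm s)) (v₀ w) (e (x i)) := hw₀
      rw [h1.fracDerivQ_eq hφe he hpos hxi]
      exact hw.unique (h1.clm (T k (k.insertNth c w)))
    exact ⟨hvi.congr heq, by rwa [← integral_congr_ae heq]⟩
  refine ⟨fun k c hc => (key k c hc).1, ?_⟩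
  refine (HasPropDeriv.sum Finset.univ fun k _ =>
    (key k _ (Or.inr rfl)).2.sub (key k _ (Or.inl rfl)).2).congr (e.strictMono hxi.1)
    (e.strictMono hxi.2) fun s hs => ?_
  exact hP _ (update_mem_box hx (symm_mem_Ioo hs))

end FracPsi
end

/-! ### Recovering f from the reproducing formula -/

noncomputable section
namespace FracPsi

theorem hasPropDeriv_one {γ : ℂ} (hγ : 0 < γ.re) (r : ℝ) {A t : ℝ} (hA : A < t) :
    ∃ w : ℂ, HasPropDeriv A γ r (fun _ => (1 : ℂ)) w t :=
  ⟨_, exists_hasPropDeriv (d := t + 1) (M := 1) hγ r le_rfl hA (by linarith)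
    (integrableOn_const (by simp)) contDiffOn_const fun s _ => by simp⟩

theorem HasPropDeriv.const_smul {γ : ℂ} {r A t : ℝ} {w : ℂ}
    (H : HasPropDeriv A γ r (fun _ => (1 : ℂ)) w t) (q : ℍ[ℂ]) :
    HasPropDeriv A γ r (fun _ => q) (w • q) t := by
  simpa using H.clm ((1 : ℂ →L[ℂ] ℂ).smulRight q)

theorem HasPropDeriv.fracDeriv_eq {γ w : ℂ} {r : ℝ} {φ : ℝ → ℝ} {a b : ℝ} {e : ℝ ≃o ℝ} {t : ℝ}
    {h : ℝ → ℂ} (H : HasPropDeriv (e a) γ r (fun s => h (e.symm s)) w (e t))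
    (hφe : EqOn φ e (Icc a b)) (he : ContDiff ℝ 1 e)
    (hpos : ∀ t, 0 < deriv e t) (ht : t ∈ Ioo a b) :
    fracDeriv a (1 - γ) r φ h t = w := by
  obtain ⟨-, D, hD, rfl⟩ := H
  rw [← sub_sub_cancel 1 γ] at hD
  rw [FracPsi.fracDeriv_eq hφe he hpos ht hD, sub_sub_cancel]
  rfl

theorem intervalIntegrable_propKernel_smul {E : Type*} [NormedAddCommGroup E] [NormedSpace ℝ E]
    [NormedSpace ℂ E] [IsScalarTower ℝ ℂ E] {γ : ℂ} (hγ : 0 < γ.re) (r : ℝ) {A d t : ℝ}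
    (ht : t ∈ Ioo A d) {h : ℝ → E}
    (hi : IntegrableOn h (Ioo A d)) (hc : ContinuousOn h (Ioo A d)) :
    IntervalIntegrable (fun s => propKernel γ r (t - s) • h s) volume A t := by
  obtain ⟨p, hp, hpt⟩ := exists_between ht.1
  obtain ⟨q, htq, hq⟩ := exists_between ht.2
  obtain ⟨M, hM⟩ := (isCompact_Icc (a := p) (b := q)).exists_bound_of_continuousOn
    (hc.mono fun s hs => ⟨hp.trans_le hs.1, hs.2.trans_lt hq⟩)
  -- A family over a one-point space with Dirac measure reduces the claim to the Fubini lemma.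
  have h1 : Integrable (Function.uncurry fun (_ : Unit) s => h s)
      ((Measure.dirac ()).prod (volume.restrict (Ioo A q))) :=
    (hi.mono_set (Ioo_subset_Ioo_right hq.le)).comp_snd _
  obtain ⟨_, h2⟩ := (integrable_propKernel_smul hγ r hpt htq hp.le h1
    (Filter.Eventually.of_forall fun _ s hs => hM s (Ioo_subset_Icc_self hs))).prod_right_ae.exists
  rwa [intervalIntegrable_iff_integrableOn_Ioc_of_le ht.1.le]

theorem integrableOn_comp_symm {E : Type*} [NormedAddCommGroup E] [NormedSpace ℝ E] {h : ℝ → E}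
    {a b : ℝ} (hi : IntegrableOn h (Ioo a b)) {e : ℝ ≃o ℝ} (he : ContDiff ℝ 1 e) :
    IntegrableOn (fun s => h (e.symm s)) (Ioo (e a) (e b)) := by
  have hcont : Continuous fun x => |deriv e x| := (he.continuous_deriv le_rfl).abs
  rw [← OrderIso.image_Ioo, integrableOn_image_iff_integrableOn_abs_deriv_smul measurableSet_Ioo
    (fun x _ => ((he.differentiable (by simp)) x).hasDerivAt.hasDerivWithinAt) e.injective.injOn]
  simp only [OrderIso.symm_apply_apply]
  obtain ⟨B, hB⟩ := (isCompact_Icc (a := a) (b := b)).exists_bound_of_continuousOn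
    hcont.continuousOn
  refine (hi.norm.const_mul B).mono' (hcont.aestronglyMeasurable.smul hi.1) ?_
  filter_upwards [ae_restrict_mem measurableSet_Ioo] with x hx
  rw [norm_smul]
  exact mul_le_mul_of_nonneg_right (hB x (Ioo_subset_Icc_self hx)) (norm_nonneg _)

variable {a b x y : Fin 3 → ℝ} {i : Fin 3} {f : (Fin 3 → ℝ) → ℍ[ℝ]}

/-- Supplies the continuity that the fundamental theorem of calculus requires in
`hasDerivAt_propInt_propInt`. -/
theorem MemAC.continuousOn_line (hf : MemAC a b f) (hy : y ∈ box a b) (i : Fin 3) :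
    ContinuousOn (line f y i) (Ioo (a i) (b i)) := fun t ht => by
  obtain ⟨p, hp, hpt⟩ := exists_between ht.1
  obtain ⟨q, htq, hq⟩ := exists_between ht.2
  have h := ((hf.2 y hy i).1 p q hp (hpt.trans htq).le hq).continuousOn
  rw [uIcc_of_le (hpt.trans htq).le] at h
  exact (h.continuousAt (Icc_mem_nhds hpt htq)).continuousWithinAt

theorem MemAC.integrableOn_cq_line (hf : MemAC a b f) (hy : y ∈ box a b) (i : Fin 3)
    {e : ℝ ≃o ℝ} (he : ContDiff ℝ 1 e) :
    IntegrableOn (fun s => cq (line f y i (e.symm s))) (Ioo (e (a i)) (e (b i))) :=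
  cqL.integrable_comp (integrableOn_comp_symm (hf.2 y hy i).2 he)

theorem MemAC.continuousOn_cq_line (hf : MemAC a b f) (hy : y ∈ box a b) (i : Fin 3)
    (e : ℝ ≃o ℝ) :
    ContinuousOn (fun s => cq (line f y i (e.symm s))) (Ioo (e (a i)) (e (b i))) :=
  cqL.continuous.comp_continuousOn ((hf.continuousOn_line hy i).comp
    e.symm.continuous.continuousOn fun _ hs => symm_mem_Ioo hs)

variable {α : Fin 3 → ℂ} {σ : Fin 3 → ℝ} {φ : (Fin 3 → ℝ) → ℝ}

theorem IsScale.exists_orderIso (hab : ∀ i, a i < b i) (hy : y ∈ box a b) (hφ : IsScale a b y φ)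
    (i : Fin 3) : ∃ e : ℝ ≃o ℝ, EqOn (line φ y i) e (Icc (a i) (b i)) ∧ ContDiff ℝ 1 e ∧
      ∀ t, 0 < deriv e t :=
  exists_orderIso_extension (hab i)
    (hφ.1.comp (contDiff_update 1 y i).contDiffOn fun _ ht => update_mem_Icc (box_subset_Icc hy) ht)
    (hφ.2 i)

theorem boxFracInt_update (γ : Fin 3 → ℂ) (x : Fin 3 → ℝ) (i : Fin 3) (t : ℝ) :
    boxFracInt a γ σ φ f y (Function.update x i t) =
      fracIntQ (a i) (γ i) (σ i) (line φ y i) (fun t => cq (line f y i t)) t +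
        ∑ j ∈ Finset.univ.erase i,
          fracIntQ (a j) (γ j) (σ j) (line φ y j) (fun t => cq (line f y j t)) (x j) := by
  rw [boxFracInt, ← Finset.add_sum_erase _ _ (Finset.mem_univ i), Function.update_self]
  refine congrArg _ (Finset.sum_congr rfl fun j hj => ?_)
  rw [Function.update_of_ne (Finset.ne_of_mem_erase hj)]

/-- The derivative in the `i`-th variable of the fractional integral of `f` recovers `f`. -/
theorem HasPropDeriv.eq_of_boxFracInt (hf : MemAC a b f) (hy : y ∈ box a b) (hx : x ∈ box a b)
    (hα : 0 < (α i).re ∧ (α i).re < 1) (hσ : 0 < σ i) {e : ℝ ≃o ℝ}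
    (hφe : EqOn (line φ y i) e (Icc (a i) (b i))) (he : ContDiff ℝ 1 e)
    (hpos : ∀ t, 0 < deriv e t) {v : ℍ[ℂ]}
    (H : HasPropDeriv (e (a i)) (α i) (σ i)
      (fun s => boxFracInt a (fun i => 1 - α i) σ φ f y (Function.update x i (e.symm s))) v
      (e (x i))) :
    v = cq (f (Function.update y i (x i))) + ∑ j ∈ Finset.univ.erase i,
      fracDeriv (a i) (1 - α i) (σ i) (line φ y i) (fun _ => 1) (x i) •
        fracIntQ (a j) (1 - α j) (σ j) (line φ y j) (fun t => cq (line f y j t)) (x j) := by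
  have hxi : x i ∈ Ioo (a i) (b i) := hx i (mem_univ i)
  have hxe : e (x i) ∈ Ioo (e (a i)) (e (b i)) := ⟨e.strictMono hxi.1, e.strictMono hxi.2⟩
  obtain ⟨w, hw⟩ := hasPropDeriv_one hα.1 (σ i) hxe.1
  rw [HasPropDeriv.fracDeriv_eq (h := fun _ => 1) hw hφe he hpos hxi, ← Finset.smul_sum]
  set q := ∑ j ∈ Finset.univ.erase i,
    fracIntQ (a j) (1 - α j) (σ j) (line φ y j) (fun t => cq (line f y j t)) (x j) with hq
  have hi := hf.integrableOn_cq_line hy i he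
  have hc := hf.continuousOn_cq_line hy i e
  -- Once the summands constant in x_i are subtracted, what is left is the fractional integral of
  -- order 1 - α_i of f along the i-th line, to which the inversion applies.
  obtain ⟨-, D, hD, hv⟩ := (H.sub (hw.const_smul q)).congr
    (h' := propInt (e (a i)) (1 - α i) (σ i) fun s => cq (line f y i (e.symm s)))
    hxe.1 hxe.2 fun s hs => by
      have h1 := intervalIntegrable_propKernel_smul (γ := 1 - α i) (by simpa using hα.2) (σ i) hs
        hi hc
      rw [← e.apply_symm_apply s] at h1
      have h2 := fracIntQ_eq (h := fun t => cq (line f y i t)) hφe he hpos (symm_mem_Ioo hs) h1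
      rw [e.apply_symm_apply] at h2
      simp only [boxFracInt_update, h2, ← hq, add_sub_cancel_right]
  obtain ⟨D', hD', h'⟩ := hasDerivAt_propInt_propInt hα.1 hα.2 hσ hxe hi hc
  rw [hD.unique hD', h', e.symm_apply_apply, sub_eq_iff_eq_add] at hv
  exact hv

variable {ψ : Fin 3 → ℍ[ℝ]} {l : Fin 3 → (Fin 3 → ℝ) → ℝ}

/-- Apply the i-th fractional derivative to the reproducing formula `hP` and add over i. Each i
recovers one value of f, and the cross terms make up the remainder. -/
theorem bInt_fracKernel (hab : ∀ i, a i < b i) (hψ : IsStructuralSet ψ)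
    (hα : ∀ i, 0 < (α i).re ∧ (α i).re < 1) (hσ : ∀ i, 0 < σ i)
    (hy : y ∈ box a b) (hφ : IsScale a b y φ) (hl : ∀ k, ContDiffOn ℝ 1 (l k) (Icc a b))
    (hf : MemAC a b f) (hx : x ∈ box a b) (T : Fin 3 → (Fin 3 → ℝ) → ℍ[ℂ] →L[ℂ] ℍ[ℂ])
    (hT : ∀ k, ContinuousOn (T k) (Icc a b))
    (hP : ∀ z ∈ box a b, bInt a b (fun k ζ => T k ζ (weightedKernel ψ l ζ z)) =
      boxFracInt a (fun i => 1 - α i) σ φ f y z) :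
    FaceIntegrable a b (fun k ζ => T k ζ (fracKernel ψ a α σ φ y l ζ x)) ∧
    bInt a b (fun k ζ => T k ζ (fracKernel ψ a α σ φ y l ζ x)) =
      (∑ i, cq (f (Function.update y i (x i)))) + remainder a α σ φ f x y := by
  choose e hφe he hpos using hφ.exists_orderIso hab hy
  have key := fun i => bInt_fracDerivQ hab hψ hl hx (hα i).1 (σ i) (hφe i) (he i) (hpos i) T hT hP
  have hval := fun i => (key i).2.eq_of_boxFracInt hf hy hx (hα i) (hσ i) (hφe i) (he i) (hpos i)
  have hsum : (fun k ζ => T k ζ (fracKernel ψ a α σ φ y l ζ x)) = fun k ζ =>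
      T k ζ (fracDerivQ (a 0) (1 - α 0) (σ 0) (line φ y 0) (line (weightedKernel ψ l ζ) x 0) (x 0))
      + T k ζ (fracDerivQ (a 1) (1 - α 1) (σ 1) (line φ y 1) (line (weightedKernel ψ l ζ) x 1)
        (x 1))
      + T k ζ (fracDerivQ (a 2) (1 - α 2) (σ 2) (line φ y 2) (line (weightedKernel ψ l ζ) x 2)
        (x 2)) := by
    ext1 k
    ext1 ζ
    rw [← map_add, ← map_add, fracKernel, Fin.sum_univ_three]
    rfl
  have h01 := (key 0).1.add (key 1).1
  rw [hsum]
  refine ⟨h01.add (key 2).1, ?_⟩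
  rw [bInt_add h01 (key 2).1, bInt_add (key 0).1 (key 1).1]
  -- `remainder` sums over the integral first and the derivative second; differentiation produces
  -- the opposite order.
  have hrem : remainder a α σ φ f x y = ∑ i, ∑ j ∈ Finset.univ.erase i,
      fracDeriv (a i) (1 - α i) (σ i) (line φ y i) (fun _ => 1) (x i) •
        fracIntQ (a j) (1 - α j) (σ j) (line φ y j) (fun t => cq (line f y j t)) (x j) := by
    simp only [remainder, Finset.sum_smul]
    exact Finset.sum_comm' fun i j => by simp [ne_comm]
  rw [hrem, ← Finset.sum_add_distrib, Fin.sum_univ_three, hval 0, hval 1, hval 2]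

end FracPsi
end

/-! ### The left and right Cauchy formulas -/

noncomputable section
namespace FracPsi

variable {a b x y : Fin 3 → ℝ} {f : (Fin 3 → ℝ) → ℍ[ℝ]} {F : (Fin 3 → ℝ) → ℍ[ℂ]}
  {α : Fin 3 → ℂ} {σ : Fin 3 → ℝ} {φ : (Fin 3 → ℝ) → ℝ} {ψ : Fin 3 → ℍ[ℝ]}
  {l : Fin 3 → (Fin 3 → ℝ) → ℝ}

theorem IsLeftHyperholomorphicAt.bInt_fracKernel (hab : ∀ i, a i < b i) (hψ : IsStructuralSet ψ)
    (hα : ∀ i, 0 < (α i).re ∧ (α i).re < 1) (hσ : ∀ i, 0 < σ i)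
    (hy : y ∈ box a b) (hφ : IsScale a b y φ) (hl : IsWeight ψ a b σ φ y l)
    (hf : IsLeftHyperholomorphicAt ψ a b α σ φ y f)
    (hF : IsC1Extension a b (boxFracInt a (fun i => 1 - α i) σ φ f y) F) (hx : x ∈ box a b) :
    FaceIntegrable a b (fun k ζ => fracKernel ψ a α σ φ y l ζ x * cq (ψ k) * F ζ) ∧
    bInt a b (fun k ζ => fracKernel ψ a α σ φ y l ζ x * cq (ψ k) * F ζ) =
      (∑ i, cq (f (Function.update y i (x i)))) + remainder a α σ φ f x y := by
  have hF1 := contDiffOn_of_allCoords hF.1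
  have hT : ∀ k (ζ : Fin 3 → ℝ) (v : ℍ[ℂ]),
      mulL.flip (cq (ψ k) * F ζ) v = v * cq (ψ k) * F ζ := fun k ζ v => by
    rw [ContinuousLinearMap.flip_apply, mulL_apply, mul_assoc]
  have key := FracPsi.bInt_fracKernel hab hψ hα hσ hy hφ hl.1 hf.1 hx
    -- The boundary data stand to the right of the kernel, so T is right multiplication by ψ_k F(ζ).
    (fun k ζ => mulL.flip (cq (ψ k) * F ζ))
    (fun k => (mulL.flip.comp (mulL (cq (ψ k)))).continuous.comp_continuousOn hF1.continuousOn)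
    (fun z hz => by
      simp only [hT]
      exact (bInt_weighted_left hab hψ hl.1 hF1
        (fun _ hx => hf.monogenic hψ hσ hφ hl hF hx) hz).trans (hF.2 hz))
  simpa only [hT] using key

theorem IsRightHyperholomorphicAt.bInt_fracKernel (hab : ∀ i, a i < b i)
    (hψ : IsStructuralSet ψ)
    (hα : ∀ i, 0 < (α i).re ∧ (α i).re < 1) (hσ : ∀ i, 0 < σ i)
    (hy : y ∈ box a b) (hφ : IsScale a b y φ) (hl : IsWeight ψ a b σ φ y l)
    (hf : IsRightHyperholomorphicAt ψ a b α σ φ y f)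
    (hF : IsC1Extension a b (boxFracInt a (fun i => 1 - α i) σ φ f y) F) (hx : x ∈ box a b) :
    FaceIntegrable a b (fun k ζ => F ζ * cq (ψ k) * fracKernel ψ a α σ φ y l ζ x) ∧
    bInt a b (fun k ζ => F ζ * cq (ψ k) * fracKernel ψ a α σ φ y l ζ x) =
      (∑ i, cq (f (Function.update y i (x i)))) + remainder a α σ φ f x y := by
  have hF1 := contDiffOn_of_allCoords hF.1
  have key := FracPsi.bInt_fracKernel hab hψ hα hσ hy hφ hl.1 hf.1 hx
    -- Here the data stand to the left of the kernel, so T is left multiplication by F(ζ) ψ_k.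
    (fun k ζ => mulL (F ζ * cq (ψ k)))
    (fun k => (mulL.comp (mulL.flip (cq (ψ k)))).continuous.comp_continuousOn hF1.continuousOn)
    (fun z hz => by
      simp only [mulL_apply]
      exact (bInt_weighted_right hab hψ hl.1 hF1
        (fun _ hx => hf.monogenic hψ hσ hφ hl hF hx) hz).trans (hF.2 hz))
  simpa only [mulL_apply] using key

end FracPsi
end

theorem mainTheorem3 (ψ : Fin 3 → ℍ[ℝ]) (hψ : FracPsi.IsStructuralSet ψ)
    (a b : Fin 3 → ℝ) (hab : ∀ i, a i < b i)
    (α β : Fin 3 → ℂ) (hα : ∀ i, 0 < (α i).re ∧ (α i).re < 1)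
    (hβ : ∀ i, 0 < (β i).re ∧ (β i).re < 1)
    (σ ρ : Fin 3 → ℝ) (hσ : ∀ i, 0 < σ i ∧ σ i ≤ 1) (hρ : ∀ i, 0 < ρ i ∧ ρ i ≤ 1)
    (y : Fin 3 → ℝ) (hy : y ∈ FracPsi.box a b)
    (φ θ : (Fin 3 → ℝ) → ℝ) (hφ : FracPsi.IsScale a b y φ) (hθ : FracPsi.IsScale a b y θ)
    (lam mu : Fin 3 → (Fin 3 → ℝ) → ℝ)
    (hlam : FracPsi.IsWeight ψ a b σ φ y lam) (hmu : FracPsi.IsWeight ψ a b ρ θ y mu)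
    (f g : (Fin 3 → ℝ) → ℍ[ℝ])
    (hf : FracPsi.IsLeftHyperholomorphicAt ψ a b α σ φ y f)
    (hg : FracPsi.IsRightHyperholomorphicAt ψ a b β ρ θ y g)
    (F G : (Fin 3 → ℝ) → ℍ[ℂ])
    (hF : FracPsi.IsC1Extension a b (FracPsi.boxFracInt a (fun i => 1 - α i) σ φ f y) F)
    (hG : FracPsi.IsC1Extension a b (FracPsi.boxFracInt a (fun i => 1 - β i) ρ θ g y) G) :
    FracPsi.boundaryIntegral a b (fun k x =>
        (Real.exp (∑ j, (mu j x + lam j x)) : ℂ) • (G x * FracPsi.cq (ψ k) * F x)) = 0 ∧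
    ∀ x ∈ FracPsi.box a b,
      FracPsi.BoundaryIntegrable a b (fun k ζ =>
          FracPsi.fracKernel ψ a α σ φ y lam ζ x * FracPsi.cq (ψ k) * F ζ +
            G ζ * FracPsi.cq (ψ k) * FracPsi.fracKernel ψ a β ρ θ y mu ζ x) ∧
      FracPsi.boundaryIntegral a b (fun k ζ =>
          FracPsi.fracKernel ψ a α σ φ y lam ζ x * FracPsi.cq (ψ k) * F ζ +
            G ζ * FracPsi.cq (ψ k) * FracPsi.fracKernel ψ a β ρ θ y mu ζ x) =
        (∑ i, FracPsi.cq (f (Function.update y i (x i)) + g (Function.update y i (x i)))) +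
          FracPsi.remainder a α σ φ f x y + FracPsi.remainder a β ρ θ g x y := by
  have hσ' := fun i => (hσ i).1
  have hρ' := fun i => (hρ i).1
  refine ⟨FracPsi.boundaryIntegral_weighted hab hlam.1 hmu.1
    (FracPsi.contDiffOn_of_allCoords hF.1) (FracPsi.contDiffOn_of_allCoords hG.1)
    (fun _ hx => hf.monogenic hψ hσ' hφ hlam hF hx)
    (fun _ hx => hg.monogenic hψ hρ' hθ hmu hG hx), fun x hx => ?_⟩
  obtain ⟨hL, hL'⟩ := hf.bInt_fracKernel hab hψ hα hσ' hy hφ hlam hF hx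
  obtain ⟨hR, hR'⟩ := hg.bInt_fracKernel hab hψ hβ hρ' hy hθ hmu hG hx
  refine ⟨(hL.add hR).boundaryIntegrable, ?_⟩
  rw [(hL.add hR).boundaryIntegral_eq, FracPsi.bInt_add hL hR, hL', hR']
  simp only [FracPsi.cq_add, Finset.sum_add_distrib]
  abel
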